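/- **Model.** For each $N\ge 1$ let $A=(a_{ij})_{1\le i,j\le N}$ be the adjacency matrix of an undirected graph without loops on $\{1,\dots,N\}$, in which, for $N\ge 2$, every node has degree $d_i=\sum_j a_{ij}\ge 1$, and put $w_{ij}=a_{ij}/d_i$ (with $w_{11}=0$ if $N=1$). A parameter is $\nu=(\theta,r)$ with $\theta=(\omega,\alpha^{(1)},\alpha^{(2)},\xi,\beta)\in\Theta=\{\omega>0,\ \alpha^{(1)},\alpha^{(2)},\xi,\beta\ge 0\}$ and $r\in\mathbb Z_+=\{0,1,2,\dots\}$. For each $N$ the counts $y_{it}\in\{0,1,2,\dots\}$, $1\le i\le N$, $t\in\mathbb Z$, adapted to a filtration $(\mathcal H_t)_{t\in\mathbb Z}$, follow the Poisson threshold network GARCH model with true parameter $\nu_0=(\theta_0,r_0)$: conditionally on $\mathcal H_{t-1}$ the variables $y_{1t},\dots,y_{Nt}$ are independent Poisson with $\mathcal H_{t-1}$-measurable means $\lambda_{1t},\dots,\lambda_{Nt}$, and with $\nu=\nu_0$ $$\lambda_{it}=\omega+\bigl(\alpha^{(1)}1_{\{y_{i,t-1}\ge r\}}+\alpha^{(2)}1_{\{y_{i,t-1}<r\}}\bigr)y_{i,t-1}+\xi\sum_{j=1}^N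 w_{ij}y_{j,t-1}+\beta\lambda_{i,t-1}.$$ There is a genuine threshold: $\alpha^{(1)}_0\ne\alpha^{(2)}_0$ and $r_0\ge 2$. **Estimator.** Let $\tilde\lambda_{it}(\nu)$, $t\ge 1$, be computed from the same recursion with parameter $\nu$, started at given constants $\tilde\lambda_{i0}\in[0,c]$, where $c$ does not depend on $i,N$. Let $$\tilde L_{NT}(\nu)=\frac1{NT}\sum_{i=1}^N\sum_{t=1}^T\bigl(y_{it}\log\tilde\lambda_{it}(\nu)-\tilde\lambda_{it}(\nu)\bigr),$$ and let $\hat\nu_{NT}=(\hat\theta_{NT},\hat r_{NT})$ be any maximizer of $\tilde L_{NT}$ over $\{(\theta,r): r\in\mathbb Z_+,\ \theta\in\Theta_r\}$, where the $\Theta_r$ are compact sets (possibly empty) contained in a common compact subset of $\Theta$. (For example, $\Theta_r$ is one and the same compact subset of $\Theta$ for all $r\in\mathbb Z_+$, or for all $r$ in a prescribed range, and is empty otherwise.) **Theorem.** Assume that 1. $\theta_0$ is an interior point of $\Theta_{r_0}$, and $\max\{\alpha_0^{(1)},\alpha_0^{(2)},|\alpha_0^{(1)}r_0-\alpha_0^{(2)}(r_0-1)|\}+\xi_0+\beta_0<1$;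 2. $\sup_{N,T\ge1}\sup_{1\le i\le N,\,1\le t\le T}\mathbb E\,|y_{it}|^{2p}<\infty$ for some $p>1$; 3. the array $\{y_{it}:1\le i\le N,\ 1\le t\le T\}$, $N,T\ge 1$, is $\eta$-weakly dependent with coefficients $\bar\eta_y(s)=\mathcal O(s^{-\mu_y})$ for some $\mu_y>2\frac{2p-1}{p-1}$; that is, $\bar\eta_y(s)\to0$ and, for all $N,T,s\ge1$, all finite sets $U,V$ of indices in $\{1,\dots,N\}\times\{1,\dots,T\}$ at distance at least $s$ for the metric $\max\{|i-j|,|t-\tau|\}$, and all bounded functions $f:\mathbb R^U\to\mathbb R$, $g:\mathbb R^V\to\mathbb R$ that are Lipschitz for the $\ell^1$ distance, $$|\mathrm{Cov}(f(y_U),g(y_V))|\le\bigl(|U|\,\mathrm{Lip}(f)\|g\|_\infty+|V|\,\mathrm{Lip}(g)\|f\|_\infty\bigr)\bar\eta_y(s);$$ 4. there are constants $C>0$ and $b>\mu_y$, not depending on $N$, with $w_{ij}\le C|i-j|^{-b}$ for all $i\ne j$. Then $\hat\nu_{NT}\to\nu_0$ in probability as $T\to\infty$ and $N\to\infty$ (jointly,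 at arbitrary relative rates); in particular $\mathbb P(\hat r_{NT}=r_0)\to1$. -/

import Mathlib

open MeasureTheory ProbabilityTheory Filter Topology
open scoped ENNReal NNReal

noncomputable section

namespace PTNGARCH

/-! ### Parameters -/

/-- The coefficient vector `θ = (ω, α⁽¹⁾, α⁽²⁾, ξ, β)`. -/
abbrev Coef : Type := Fin 5 → ℝ

/-- The full parameter `ν = (θ, r)` with an integer threshold `r`. -/
abbrev Param : Type := Coef × ℕ

/-- The base parameter `ω`. -/
def base (θ : Coef) : ℝ := θ 0

/-- The coefficient `α⁽¹⁾`, in force at or above the threshold. -/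
def alphaUp (θ : Coef) : ℝ := θ 1

/-- The coefficient `α⁽²⁾`, in force below the threshold. -/
def alphaDown (θ : Coef) : ℝ := θ 2

/-- The network coefficient `ξ`. -/
def netCoef (θ : Coef) : ℝ := θ 3

/-- The autoregressive coefficient `β`. -/
def garchCoef (θ : Coef) : ℝ := θ 4

/-- The set `Θ` of admissible coefficient vectors: `ω > 0`, all the others nonnegative. -/
def admissible : Set Coef :=
  {θ | 0 < base θ ∧ 0 ≤ alphaUp θ ∧ 0 ≤ alphaDown θ ∧ 0 ≤ netCoef θ ∧ 0 ≤ garchCoef θ}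

/-- The contraction condition
`max {α⁽¹⁾, α⁽²⁾, |α⁽¹⁾ r - α⁽²⁾ (r - 1)|} + ξ + β < 1`. -/
def Contraction (ν : Param) : Prop :=
  max (max (alphaUp ν.1) (alphaDown ν.1))
      |alphaUp ν.1 * (ν.2 : ℝ) - alphaDown ν.1 * ((ν.2 : ℝ) - 1)|
    + netCoef ν.1 + garchCoef ν.1 < 1

/-! ### The network -/

open Classical in
/-- The entry `a_ij` of the adjacency matrix of an undirected graph without loops. -/
def adjEntry {N : ℕ} (G : SimpleGraph (Fin N)) (i j : Fin N) : ℝ :=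
  if G.Adj i j then 1 else 0

/-- The degree `d_i = ∑_j a_ij`. -/
def nodeDegree {N : ℕ} (G : SimpleGraph (Fin N)) (i : Fin N) : ℝ :=
  ∑ j, adjEntry G i j

/-- The entry `w_ij = a_ij / d_i` of the row-normalized adjacency matrix. -/
def weight {N : ℕ} (G : SimpleGraph (Fin N)) (i j : Fin N) : ℝ :=
  adjEntry G i j / nodeDegree G i

/-! ### The model -/

/-- The right-hand side of the intensity recursion at node `i`, given the previous counts `y`
and the previous intensity `l` of that node:
`ω + (α⁽¹⁾ 1{y_i ≥ r} + α⁽²⁾ 1{y_i < r}) y_i + ξ ∑_j w_ij y_j + β l`. -/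
def nextIntensity {N : ℕ} (G : SimpleGraph (Fin N)) (ν : Param) (i : Fin N)
    (y : Fin N → ℕ) (l : ℝ) : ℝ :=
  base ν.1 + (if ν.2 ≤ y i then alphaUp ν.1 else alphaDown ν.1) * (y i : ℝ)
    + netCoef ν.1 * ∑ j, weight G i j * (y j : ℝ) + garchCoef ν.1 * l

/-- The Poisson threshold network GARCH(1,1) model with parameter `ν` on the network `G`: given
the information up to time `t - 1`, the counts `y_1t, …, y_Nt` are independent Poisson variables
with means `lam_1t, …, lam_Nt`, and the intensities obey the threshold recursion. -/
structure IsModel {Ω : Type*} [mΩ : MeasurableSpace Ω] (P : Measure Ω) {N : ℕ}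
    (G : SimpleGraph (Fin N)) (ν : Param) (ℋ : Filtration ℤ mΩ)
    (y : Fin N → ℤ → Ω → ℕ) (lam : Fin N → ℤ → Ω → ℝ) : Prop where
  adapted : ∀ i t, Measurable[ℋ t] (y i t)
  predictable : ∀ i t, Measurable[ℋ (t - 1)] (lam i t)
  nonneg : ∀ i t ω, 0 ≤ lam i t ω
  condPoisson : ∀ (t : ℤ) (n : Fin N → ℕ),
    P[Set.indicator {ω | ∀ i, y i t ω = n i} (fun _ => (1 : ℝ)) | ℋ (t - 1)]
      =ᵐ[P] fun ω => ∏ i, Real.exp (-lam i t ω) * lam i t ω ^ n i / (Nat.factorial (n i) : ℝ)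
  recursion : ∀ i t, ∀ᵐ ω ∂P,
    lam i t ω = nextIntensity G ν i (fun j => y j (t - 1) ω) (lam i (t - 1) ω)

/-! ### The likelihood and its maximizer -/

/-- The intensities computed from observed counts `y` and initial values `init` at
time `0`. -/
def fittedIntensity {N : ℕ} (G : SimpleGraph (Fin N)) (init : Fin N → ℝ)
    (y : Fin N → ℤ → ℕ) (ν : Param) (i : Fin N) : ℕ → ℝ
  | 0 => init i
  | t + 1 => nextIntensity G ν i (fun j => y j (t : ℤ)) (fittedIntensity G init y ν i t)

/-- The normalized approximate log-likelihood
`(N T)⁻¹ ∑_{i ≤ N, 1 ≤ t ≤ T} (y_it log λ_it(ν) - λ_it(ν))`, with fitted intensities. -/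
def logLik {N : ℕ} (G : SimpleGraph (Fin N)) (init : Fin N → ℝ) (T : ℕ)
    (y : Fin N → ℤ → ℕ) (ν : Param) : ℝ :=
  1 / ((N : ℝ) * (T : ℝ)) * ∑ i : Fin N, ∑ t ∈ Finset.Icc 1 T,
    ((y i (t : ℤ) : ℝ) * Real.log (fittedIntensity G init y ν i t)
      - fittedIntensity G init y ν i t)

/-- `ν̂` maximizes the approximate log-likelihood over all `(θ, r)` with `θ ∈ S r`. -/
def IsMLE {N : ℕ} (G : SimpleGraph (Fin N)) (init : Fin N → ℝ) (T : ℕ)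
    (y : Fin N → ℤ → ℕ) (S : ℕ → Set Coef) (ν' : Param) : Prop :=
  ν'.1 ∈ S ν'.2 ∧ ∀ ν : Param, ν.1 ∈ S ν.2 → logLik G init T y ν ≤ logLik G init T y ν'

/-! ### Weak dependence of arrays of random fields -/

/-- The distance `max {|i - j|, |t - τ|}` of two space-time points. -/
def siteDist {N : ℕ} (u v : Fin N × ℤ) : ℤ :=
  max |((u.1 : ℕ) : ℤ) - ((v.1 : ℕ) : ℤ)| |u.2 - v.2|

/-- `f` is bounded by `M` and Lipschitz with constant `L` for the `ℓ¹` distance. -/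
def BoundedLipschitz {ι : Type*} [Fintype ι] (f : (ι → ℝ) → ℝ) (M L : ℝ) : Prop :=
  0 ≤ L ∧ (∀ x, |f x| ≤ M) ∧ ∀ x x', |f x - f x'| ≤ L * ∑ k, |x k - x' k|

/-- The array `{X_it : 1 ≤ i ≤ N, 1 ≤ t ≤ T}`, `N, T ≥ 1`, is `η`-weakly dependent with
coefficients `η s → 0`: for finite index sets `U`, `V` at distance at least `s` and bounded
Lipschitz `f`, `g`,
`|Cov (f (X_U), g (X_V))| ≤ (|U| Lip(f) ‖g‖_∞ + |V| Lip(g) ‖f‖_∞) η s`,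
uniformly in `N` and `T`. -/
def EtaWeaklyDependent {Ω : ℕ → Type*} [∀ N, MeasurableSpace (Ω N)]
    (P : ∀ N, Measure (Ω N)) (X : ∀ N, Fin N → ℤ → Ω N → ℝ) (η : ℕ → ℝ) : Prop :=
  Tendsto η atTop (𝓝 0) ∧
  ∀ N T s : ℕ, 1 ≤ N → 1 ≤ T → 1 ≤ s →
  ∀ U V : Finset (Fin N × ℤ),
    (∀ u ∈ U, u.2 ∈ Set.Icc (1 : ℤ) T) → (∀ v ∈ V, v.2 ∈ Set.Icc (1 : ℤ) T) →
    (∀ u ∈ U, ∀ v ∈ V, (s : ℤ) ≤ siteDist u v) →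
  ∀ (f : (U → ℝ) → ℝ) (g : (V → ℝ) → ℝ) (Mf Lf Mg Lg : ℝ),
    BoundedLipschitz f Mf Lf → BoundedLipschitz g Mg Lg →
    |covariance (fun ω => f (fun u => X N u.1.1 u.1.2 ω))
        (fun ω => g (fun v => X N v.1.1 v.1.2 ω)) (P N)|
      ≤ ((U.card : ℝ) * Lf * Mg + (V.card : ℝ) * Lg * Mf) * η s

end PTNGARCH

end

/-! The proof compares likelihoods by exponential martingales, with bounds uniform over all networks
of bounded degree. For a Poisson variable of mean λ, half the log-likelihood ratio of the mean b
against λ has exponential moment exp(-(√b - √λ)²/2) (`tsum_poissonWeight_likelihoodRatio`). By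
conditional independence, the product of the compensated factors over nodes and times is a
martingale of mean one. Markov's inequality (`IsModel.prob_likelihood_ge`) then bounds the
log-likelihood at a fixed ν, relative to that of the true intensities, by minus the sum H of the
squared differences of √λ(ν) and √λ, up to an exponentially unlikely error. A fixed wrong parameter
is therefore excluded as soon as H is at least a fixed multiple of NT.

Identification supplies this lower bound. The combination (λ_{t+1}(ν) - λ_{t+1}) - β(λ_t(ν) - λ_t),
called `recursionGap`, depends only on the counts and the true intensity at time t. Where the total
intensity on a closed neighbourhood is bounded, the zero configuration there and the one with a
single nonzero node both have conditional probability bounded below. If ν differs from ν₀ in the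
threshold, in a slope or in ξ, one of the two makes the gap large, whatever the intensity. If it
differs only in ω or β, two consecutive times are needed: the first moves the intensity to a value
where Δω + Δβ λ is not small, and a zero configuration at the second makes this the gap. A one-sided
law of large numbers (`prob_frequency_le`) turns conditional probabilities into frequencies
(`exists_prob_gapEvent_le`), and Cauchy–Schwarz passes from frequent gaps to a large H
(`le_sum_sqrt_sub_sq_of_frequency`).

The passage from a fixed ν to the maximizer uses a finite net and a union bound
(`eventually_prob_le_dist_le`). Thresholds are truncated at a large R, which costs little because
moments of order above 2 are bounded, and on β ≤ b < 1 fitted intensities are mean-square continuous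
in θ. Values of β closer to 1, where the contraction degenerates, are excluded directly: the fitted
intensities then grow so large that the likelihood falls below that of ν₀. Wrong initial values are
forgotten geometrically and cost O(N) in the sum of squares, against NT. The decay of the weights
serves to bound the degrees (`nodeDegree_le`), hence the neighbourhoods on which configurations must
be controlled. -/

namespace PTNGARCH

/-! ### Poisson weights -/

/-- The Poisson probability of `k` for the mean `l`, as an extended nonnegative real. -/
noncomputable def poissonWeight (l : ℝ) (k : ℕ) : ℝ≥0∞ :=
  ENNReal.ofReal (Real.exp (-l) * l ^ k / (Nat.factorial k : ℝ))

lemma measurable_poissonWeight (k : ℕ) : Measurable fun l => poissonWeight l k := by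
  unfold poissonWeight
  fun_prop

/-- The Poisson moment generating function, with a constant d carried along. With c = 0 it gives the
total mass, and with c half a log ratio of means it gives the Hellinger identity. -/
lemma tsum_poissonWeight_mul_exp {l : ℝ} (hl : 0 ≤ l) (c d : ℝ) :
    ∑' k, poissonWeight l k * ENNReal.ofReal (Real.exp (k * c + d))
      = ENNReal.ofReal (Real.exp (l * (Real.exp c - 1) + d)) := by
  have h : HasSum (fun k : ℕ => Real.exp (-l) * l ^ k / (Nat.factorial k : ℝ)
      * Real.exp (k * c + d)) (Real.exp (l * (Real.exp c - 1) + d)) := by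
    have h1 := NormedSpace.expSeries_div_hasSum_exp (l * Real.exp c)
    rw [← Real.exp_eq_exp_ℝ] at h1
    have h2 := h1.mul_left (Real.exp (-l + d))
    rw [← Real.exp_add] at h2
    have e : -l + d + l * Real.exp c = l * (Real.exp c - 1) + d := by ring
    rw [e] at h2
    refine (congrArg (fun f : ℕ → ℝ => HasSum f _) (funext fun k => ?_)).mpr h2
    rw [mul_pow, ← Real.exp_nat_mul, Real.exp_add, Real.exp_add]
    ring
  have hn : ∀ k : ℕ, 0 ≤ Real.exp (-l) * l ^ k / (Nat.factorial k : ℝ) := fun k => by positivity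
  simp only [poissonWeight, ← ENNReal.ofReal_mul (hn _)]
  rw [← ENNReal.ofReal_tsum_of_nonneg (fun k => by have := hn k; positivity) h.summable,
    h.tsum_eq]

lemma tsum_poissonWeight {l : ℝ} (hl : 0 ≤ l) : ∑' k, poissonWeight l k = 1 := by
  simpa using tsum_poissonWeight_mul_exp hl 0 0

lemma tsum_poissonWeight_mul_natCast {l : ℝ} (hl : 0 ≤ l) :
    ∑' k, poissonWeight l k * (k : ℝ≥0∞) = ENNReal.ofReal l := by
  rw [tsum_eq_zero_add' ENNReal.summable]
  have h : ∀ k : ℕ, poissonWeight l (k + 1) * ((k + 1 : ℕ) : ℝ≥0∞)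
      = ENNReal.ofReal l * poissonWeight l k := by
    intro k
    rw [poissonWeight, poissonWeight, ← ENNReal.ofReal_natCast, ← ENNReal.ofReal_mul (by positivity),
      ← ENNReal.ofReal_mul hl]
    congr 1
    rw [Nat.factorial_succ]
    push_cast
    field_simp
    ring
  simp only [h, ENNReal.tsum_mul_left, tsum_poissonWeight hl]
  simp

/-- Jensen's inequality for the moments of a Poisson variable. -/
lemma rpow_le_tsum_poissonWeight {l q : ℝ} (hl : 0 ≤ l) (hq : 1 ≤ q) :
    ENNReal.ofReal l ^ q ≤ ∑' k, poissonWeight l k * (k : ℝ≥0∞) ^ q := by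
  have hq0 : 0 ≤ q := by linarith
  rcases hl.eq_or_lt with rfl | hl'
  · simp [ENNReal.zero_rpow_of_pos (by linarith : 0 < q)]
  -- This is the tangent of x ↦ x^q at x = l, that is, Bernoulli's inequality at k/l - 1. The
  -- negative term stands on the other side so that everything lives in `ℝ≥0∞`; it is finite and
  -- cancels after summation.
  have key : ∀ k : ℕ, ENNReal.ofReal (q * l ^ (q - 1)) * k
      ≤ (k : ℝ≥0∞) ^ q + ENNReal.ofReal ((q - 1) * l ^ q) := by
    intro k
    rw [← ENNReal.ofReal_natCast, ENNReal.ofReal_rpow_of_nonneg (by positivity) hq0,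
      ← ENNReal.ofReal_mul (by positivity), ← ENNReal.ofReal_add (by positivity)
        (mul_nonneg (by linarith) (by positivity))]
    apply ENNReal.ofReal_le_ofReal
    have hs : (-1 : ℝ) ≤ k / l - 1 := by
      have : (0 : ℝ) ≤ k / l := by positivity
      linarith
    have h := one_add_mul_self_le_rpow_one_add hs hq
    rw [add_sub_cancel, Real.div_rpow (by positivity) hl, le_div_iff₀ (by positivity)] at h
    have h3 : l ^ q = l ^ (q - 1) * l := by
      rw [Real.rpow_sub_one hl'.ne']; field_simp
    have h4 : (1 + q * (k / l - 1)) * l ^ q = q * l ^ (q - 1) * k - (q - 1) * l ^ q := by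
      rw [h3]; field_simp; ring
    linarith
  have h := ENNReal.tsum_le_tsum fun k => mul_le_mul_right (key k) (poissonWeight l k)
  simp only [mul_add, ENNReal.tsum_add, ENNReal.tsum_mul_right, tsum_poissonWeight hl,
    one_mul] at h
  have h5 : ∑' k, poissonWeight l k * (ENNReal.ofReal (q * l ^ (q - 1)) * (k : ℝ≥0∞))
      = ENNReal.ofReal l ^ q + ENNReal.ofReal ((q - 1) * l ^ q) := by
    simp only [mul_left_comm _ (ENNReal.ofReal (q * l ^ (q - 1))), ENNReal.tsum_mul_left,
      tsum_poissonWeight_mul_natCast hl]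
    rw [← ENNReal.ofReal_mul (by positivity), ENNReal.ofReal_rpow_of_nonneg hl hq0,
      ← ENNReal.ofReal_add (by positivity) (mul_nonneg (by linarith) (by positivity))]
    congr 1
    have h3 : l ^ q = l ^ (q - 1) * l := by
      rw [Real.rpow_sub_one hl'.ne']; field_simp
    rw [h3]; ring
  rw [h5] at h
  exact (ENNReal.add_le_add_iff_right ENNReal.ofReal_ne_top).1 h

lemma tsum_pi_prod {N : ℕ} (g : Fin N → ℕ → ℝ≥0∞) :
    ∑' n : Fin N → ℕ, ∏ i, g i (n i) = ∏ i, ∑' k, g i k := by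
  induction N with
  | zero => simp
  | succ N ih =>
    rw [← (Fin.consEquiv fun _ => ℕ).tsum_eq, Fin.prod_univ_succ, ← ih, ← ENNReal.tsum_mul_right]
    simp only [Fin.consEquiv, Equiv.coe_fn_mk, Fin.prod_univ_succ, Fin.cons_zero, Fin.cons_succ]
    rw [ENNReal.tsum_prod (f := fun k (n : Fin N → ℕ) => g 0 k * ∏ i : Fin N, g i.succ (n i))]
    simp only [ENNReal.tsum_mul_left]

/-! ### Conditional expectations given the past -/

section Conditional

variable {Ω : Type*} [mΩ : MeasurableSpace Ω] {P : Measure Ω} {N : ℕ}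
  {G : SimpleGraph (Fin N)} {ν : Param} {ℋ : Filtration ℤ mΩ}
  {y : Fin N → ℤ → Ω → ℕ} {lam : Fin N → ℤ → Ω → ℝ}

lemma IsModel.measurable_count (h : IsModel P G ν ℋ y lam) (i : Fin N) (t : ℤ) :
    Measurable (y i t) := (h.adapted i t).mono (ℋ.le t) le_rfl

lemma IsModel.measurable_intensity (h : IsModel P G ν ℋ y lam) (i : Fin N) (t : ℤ) :
    Measurable (lam i t) := (h.predictable i t).mono (ℋ.le _) le_rfl

/-- Turns the conditional law, given as a conditional expectation of an indicator, into an identity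
for lower integrals. The weight W can then be any measurable function with values in `ℝ≥0∞`, without
integrability. -/
lemma IsModel.lintegral_configuration [IsProbabilityMeasure P] (h : IsModel P G ν ℋ y lam) (t : ℤ) (n : Fin N → ℕ)
    {W : Ω → ℝ≥0∞} (hW : Measurable[ℋ (t - 1)] W) :
    ∫⁻ ω, W ω * ({ω | ∀ i, y i t ω = n i}.indicator 1 ω) ∂P
      = ∫⁻ ω, W ω * ∏ i, poissonWeight (lam i t ω) (n i) ∂P := by
  have hle := ℋ.le (t - 1)
  set E : Set Ω := {ω | ∀ i, y i t ω = n i} with hE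
  have hEm : MeasurableSet E := by
    rw [hE, Set.ofPred_forall]
    exact MeasurableSet.iInter fun i => h.measurable_count i t (measurableSet_singleton (n i))
  have hreal : ∀ ω, 0 ≤ ∏ i, Real.exp (-lam i t ω) * lam i t ω ^ n i / (Nat.factorial (n i) : ℝ) :=
    fun ω => Finset.prod_nonneg fun i _ => by have := h.nonneg i t ω; positivity
  have hden : ∀ ω, ∏ i, poissonWeight (lam i t ω) (n i) = ENNReal.ofReal
      (∏ i, Real.exp (-lam i t ω) * lam i t ω ^ n i / (Nat.factorial (n i) : ℝ)) := fun ω => by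
    rw [ENNReal.ofReal_prod_of_nonneg fun i _ => by have := h.nonneg i t ω; positivity]
    rfl
  have hdm : Measurable[ℋ (t - 1)] fun ω => ∏ i, poissonWeight (lam i t ω) (n i) :=
    Finset.measurable_prod _ fun i _ => (measurable_poissonWeight (n i)).comp (h.predictable i t)
  have hint : Integrable (E.indicator fun _ => (1 : ℝ)) P :=
    (integrable_const 1).indicator hEm
  -- The restriction of P to the event and P with the Poisson density agree on the past; integrating
  -- W only requires this equality of trimmed measures.
  have hmeas : (P.restrict E).trim hle
      = (P.withDensity fun ω => ∏ i, poissonWeight (lam i t ω) (n i)).trim hle := by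
    refine @Measure.ext _ (ℋ (t - 1)) _ _ fun A hA => ?_
    rw [trim_measurableSet_eq hle hA, trim_measurableSet_eq hle hA,
      Measure.restrict_apply (hle A hA), withDensity_apply _ (hle A hA)]
    have h1 := setIntegral_condExp hle hint hA
    rw [setIntegral_congr_ae (g := fun ω => ∏ i, Real.exp (-lam i t ω) * lam i t ω ^ n i
      / (Nat.factorial (n i) : ℝ)) (hle A hA) ((h.condPoisson t n).mono fun ω hω _ => hω)] at h1
    rw [setIntegral_indicator hEm, setIntegral_const, smul_eq_mul, mul_one] at h1
    have h2 : Integrable (fun ω => ∏ i, Real.exp (-lam i t ω) * lam i t ω ^ n i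
        / (Nat.factorial (n i) : ℝ)) P :=
      (integrable_congr (h.condPoisson t n)).1 integrable_condExp
    simp only [hden]
    rw [← ofReal_integral_eq_lintegral_ofReal h2.integrableOn (ae_of_all _ hreal), h1,
      measureReal_def, ENNReal.ofReal_toReal (measure_ne_top _ _)]
  have e1 : ∫⁻ ω, W ω * E.indicator 1 ω ∂P = ∫⁻ ω, W ω ∂(P.restrict E) := by
    rw [← lintegral_indicator hEm]
    congr 1
    ext ω
    by_cases hω : ω ∈ E <;> simp [hω]
  rw [e1, ← lintegral_trim hle hW, hmeas, lintegral_trim hle hW,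
    lintegral_withDensity_eq_lintegral_mul _ (hdm.mono hle le_rfl) (hW.mono hle le_rfl)]
  simp only [Pi.mul_apply, mul_comm]

/-- Given the past, the counts are independent Poisson variables: integration of products. -/
lemma IsModel.lintegral_prod [IsProbabilityMeasure P] (h : IsModel P G ν ℋ y lam) (t : ℤ) {W : Ω → ℝ≥0∞}
    (hW : Measurable[ℋ (t - 1)] W) {g : Fin N → ℕ → Ω → ℝ≥0∞}
    (hg : ∀ i k, Measurable[ℋ (t - 1)] (g i k)) :
    ∫⁻ ω, W ω * ∏ i, g i (y i t ω) ω ∂P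
      = ∫⁻ ω, W ω * ∏ i, ∑' k, poissonWeight (lam i t ω) k * g i k ω ∂P := by
  have hle := ℋ.le (t - 1)
  have hm : ∀ n : Fin N → ℕ, Measurable[ℋ (t - 1)] fun ω => W ω * ∏ i, g i (n i) ω := fun n =>
    hW.mul (Finset.measurable_prod _ fun i _ => hg i (n i))
  have hEm : ∀ n : Fin N → ℕ, MeasurableSet {ω | ∀ i, y i t ω = n i} := fun n => by
    rw [Set.ofPred_forall]
    exact MeasurableSet.iInter fun i => h.measurable_count i t (measurableSet_singleton (n i))
  have e1 : ∀ ω, W ω * ∏ i, g i (y i t ω) ω = ∑' n : Fin N → ℕ,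
      (W ω * ∏ i, g i (n i) ω) * ({ω | ∀ i, y i t ω = n i}.indicator 1 ω) := by
    intro ω
    rw [tsum_eq_single (fun i => y i t ω)]
    · simp
    · intro n hn
      have : ω ∉ {ω | ∀ i, y i t ω = n i} := fun h' => hn (funext fun i => (h' i).symm)
      simp [this]
  simp only [e1]
  rw [lintegral_tsum (f := fun (n : Fin N → ℕ) ω => (W ω * ∏ i, g i (n i) ω)
    * ({ω | ∀ i, y i t ω = n i}.indicator 1 ω)) fun n => (((hm n).mono hle le_rfl).mul
    (measurable_one.indicator (hEm n))).aemeasurable]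
  simp only [h.lintegral_configuration t _ (hm _)]
  rw [← lintegral_tsum (f := fun (n : Fin N → ℕ) ω => (W ω * ∏ i, g i (n i) ω)
    * ∏ i, poissonWeight (lam i t ω) (n i)) fun n => (((hm n).mono hle le_rfl).mul (Finset.measurable_prod _ fun i _ =>
    (measurable_poissonWeight (n i)).comp (h.measurable_intensity i t))).aemeasurable]
  congr 1
  ext ω
  simp only [← tsum_pi_prod, ← ENNReal.tsum_mul_left, Finset.prod_mul_distrib]
  exact tsum_congr fun n => by ring

/-- Conditional Jensen inequality: intensities are conditional means, so they inherit the moments of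
the counts. -/
lemma IsModel.lintegral_rpow_le [IsProbabilityMeasure P] (h : IsModel P G ν ℋ y lam) (i : Fin N) (t : ℤ) {q : ℝ}
    (hq : 1 ≤ q) :
    ∫⁻ ω, ENNReal.ofReal (lam i t ω) ^ q ∂P ≤ ∫⁻ ω, (y i t ω : ℝ≥0∞) ^ q ∂P := by
  classical
  have h1 := h.lintegral_prod t (W := fun _ => 1) measurable_const
    (g := fun j k _ => if j = i then (k : ℝ≥0∞) ^ q else 1) (fun _ _ => measurable_const)
  simp only [one_mul, Finset.prod_ite_eq', Finset.mem_univ, if_true] at h1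
  rw [h1]
  refine lintegral_mono fun ω => ?_
  rw [Finset.prod_eq_single i]
  · simpa using rpow_le_tsum_poissonWeight (h.nonneg i t ω) hq
  · intro j _ hj
    simp [hj, tsum_poissonWeight (h.nonneg j t ω)]
  · simp

/-- The probability of a configuration on a set of nodes, given the past. -/
lemma IsModel.lintegral_local_configuration [IsProbabilityMeasure P] (h : IsModel P G ν ℋ y lam) (t : ℤ)
    (B : Finset (Fin N)) (n : Fin N → ℕ) {W : Ω → ℝ≥0∞} (hW : Measurable[ℋ (t - 1)] W) :
    ∫⁻ ω, W ω * ({ω | ∀ i ∈ B, y i t ω = n i}.indicator 1 ω) ∂P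
      = ∫⁻ ω, W ω * ∏ i ∈ B, poissonWeight (lam i t ω) (n i) ∂P := by
  classical
  have h1 := h.lintegral_prod t hW
    (g := fun i k _ => if i ∈ B then (if k = n i then 1 else 0) else 1)
    (fun _ _ => measurable_const)
  calc _ = _ := lintegral_congr fun ω => ?_
    _ = _ := h1
    _ = _ := lintegral_congr fun ω => ?_
  · congr 1
    rw [Finset.prod_ite, Finset.prod_const_one, mul_one, Finset.filter_mem_eq_inter,
      Finset.univ_inter, Finset.prod_ite_zero]
    simp [Set.indicator_apply]
  · congr 1
    rw [← Finset.prod_subset (Finset.subset_univ B)]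
    · refine Finset.prod_congr rfl fun i hi => ?_
      simp [hi]
    · intro i _ hi
      simp [hi, tsum_poissonWeight (h.nonneg i t ω)]

end Conditional

/-! ### Exponential supermartingales -/

section Supermartingale

variable {Ω : Type*} [mΩ : MeasurableSpace Ω] {P : Measure Ω} [IsProbabilityMeasure P]
  {F : Filtration ℕ mΩ}

/-- Factors with conditional mean at most one are peeled off from the last time backwards. The
earlier product plays the role of W, and its integral is finite by the induction hypothesis. -/
lemma lintegral_prod_le_one {g : ℕ → Ω → ℝ≥0∞} (hg : ∀ t, Measurable[F (t + 1)] (g t))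
    (h : ∀ t (W : Ω → ℝ≥0∞), Measurable[F t] W → ∫⁻ ω, W ω ∂P ≠ ∞ →
      ∫⁻ ω, W ω * g t ω ∂P ≤ ∫⁻ ω, W ω ∂P) (T : ℕ) :
    ∫⁻ ω, ∏ t ∈ Finset.range T, g t ω ∂P ≤ 1 := by
  induction T with
  | zero => simp
  | succ T ih =>
    simp only [Finset.prod_range_succ]
    refine (h T _ (Finset.measurable_prod _ fun t ht => ?_) (ih.trans_lt ENNReal.one_lt_top).ne).trans ih
    exact (hg t).mono (F.mono (Finset.mem_range.1 ht)) le_rfl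

lemma prob_le_exp_neg {Z : ℕ → Ω → ℝ} (hZ : ∀ t, Measurable[F (t + 1)] (Z t))
    (h : ∀ t (W : Ω → ℝ≥0∞), Measurable[F t] W → ∫⁻ ω, W ω ∂P ≠ ∞ →
      ∫⁻ ω, W ω * ENNReal.ofReal (Real.exp (Z t ω)) ∂P ≤ ∫⁻ ω, W ω ∂P) (T : ℕ) (x : ℝ) :
    P {ω | x ≤ ∑ t ∈ Finset.range T, Z t ω} ≤ ENNReal.ofReal (Real.exp (-x)) := by
  have hm : ∀ t, Measurable[F (t + 1)] fun ω => ENNReal.ofReal (Real.exp (Z t ω)) := fun t =>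
    ENNReal.measurable_ofReal.comp (Real.measurable_exp.comp (hZ t))
  have h1 := lintegral_prod_le_one hm h T
  have h2 := mul_meas_ge_le_lintegral₀ (μ := P)
    (Finset.measurable_prod (Finset.range T) fun t _ => (hm t).mono (F.le _) le_rfl).aemeasurable
    (ENNReal.ofReal (Real.exp x))
  have h3 : {ω | x ≤ ∑ t ∈ Finset.range T, Z t ω} ⊆ {ω | ENNReal.ofReal (Real.exp x)
      ≤ ∏ t ∈ Finset.range T, ENNReal.ofReal (Real.exp (Z t ω))} := by
    intro ω hω
    rw [Set.mem_ofPred_eq] at hω ⊢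
    rw [← ENNReal.ofReal_prod_of_nonneg fun _ _ => (Real.exp_pos _).le, ← Real.exp_sum]
    exact ENNReal.ofReal_le_ofReal (Real.exp_le_exp.2 hω)
  have h4 := (mul_le_mul_right (measure_mono (μ := P) h3) _).trans (h2.trans h1)
  rw [Real.exp_neg, ENNReal.ofReal_inv_of_pos (Real.exp_pos x)]
  rw [mul_comm] at h4
  exact (ENNReal.le_inv_iff_mul_le).2 h4

/-- A one-sided law of large numbers for adapted variables in `[0, 1]` whose conditional
means have predictable lower bounds. -/
lemma prob_sum_le_half_sum {B p : ℕ → Ω → ℝ} (hB : ∀ t, Measurable[F (t + 1)] (B t))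
    (hp : ∀ t, Measurable[F t] (p t)) (hB0 : ∀ t ω, B t ω ∈ Set.Icc 0 1)
    (hp0 : ∀ t ω, p t ω ∈ Set.Icc 0 1)
    (h : ∀ t (W : Ω → ℝ≥0∞), Measurable[F t] W →
      ∫⁻ ω, W ω * ENNReal.ofReal (p t ω) ∂P ≤ ∫⁻ ω, W ω * ENNReal.ofReal (B t ω) ∂P)
    (T : ℕ) (x : ℝ) :
    P {ω | ∑ t ∈ Finset.range T, B t ω ≤ 1 / 2 * ∑ t ∈ Finset.range T, p t ω - x}
      ≤ ENNReal.ofReal (Real.exp (-x)) := by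
  have hpm : ∀ t, Measurable[F (t + 1)] (p t) := fun t =>
    (hp t).mono (F.mono t.le_succ) le_rfl
  have key := prob_le_exp_neg (P := P) (F := F) (Z := fun t ω => 1 / 2 * p t ω - B t ω)
    (fun t => ((hpm t).const_mul _).sub (hB t)) ?_ T x
  · refine (measure_mono fun ω hω => ?_).trans key
    rw [Set.mem_ofPred_eq] at hω ⊢
    rw [Finset.sum_sub_distrib, ← Finset.mul_sum]
    linarith
  -- On [0, 1] one has exp(-B) ≤ 1 - B/2, so its conditional mean is at most 1 - p/2 ≤ exp(-p/2). As
  -- `ℝ≥0∞` has no usable subtraction, both inequalities are kept in additive form, with weight V,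
  -- and the common finite term is cancelled at the end.
  intro t W hW hfin
  have hle := F.le t
  set W' : Ω → ℝ≥0∞ := fun ω => W ω * ENNReal.ofReal (Real.exp (1 / 2 * p t ω)) with hW'
  set V : Ω → ℝ≥0∞ := fun ω => W' ω * ENNReal.ofReal (1 / 2) with hV
  have hW'm : Measurable[F t] W' := hW.mul
    (ENNReal.measurable_ofReal.comp (Real.measurable_exp.comp ((hp t).const_mul _)))
  have hVm : Measurable[F t] V := hW'm.mul measurable_const
  have hfin' : ∫⁻ ω, V ω * ENNReal.ofReal (p t ω) ∂P ≠ ∞ := by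
    have h1 : ∫⁻ ω, V ω * ENNReal.ofReal (p t ω) ∂P
        ≤ ∫⁻ ω, W ω * ENNReal.ofReal (Real.exp 1) ∂P := by
      refine lintegral_mono fun ω => ?_
      obtain ⟨h0, h1⟩ := hp0 t ω
      simp only [hV, hW', mul_assoc]
      rw [← ENNReal.ofReal_mul (by norm_num), ← ENNReal.ofReal_mul (Real.exp_pos _).le]
      gcongr
      calc Real.exp (1 / 2 * p t ω) * (1 / 2 * p t ω) ≤ Real.exp 1 * 1 := by
            gcongr
            · linarith
            · linarith
        _ = Real.exp 1 := mul_one _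
    rw [lintegral_mul_const _ (hW.mono hle le_rfl)] at h1
    exact (h1.trans_lt (ENNReal.mul_lt_top hfin.lt_top ENNReal.ofReal_lt_top)).ne
  have ha : ∫⁻ ω, W ω * ENNReal.ofReal (Real.exp (1 / 2 * p t ω - B t ω)) ∂P
      + ∫⁻ ω, V ω * ENNReal.ofReal (B t ω) ∂P ≤ ∫⁻ ω, W' ω ∂P := by
    have hm : Measurable fun ω => V ω * ENNReal.ofReal (B t ω) :=
      (hVm.mono hle le_rfl).mul (ENNReal.measurable_ofReal.comp ((hB t).mono (F.le _) le_rfl))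
    rw [← lintegral_add_right _ hm]
    refine lintegral_mono fun ω => ?_
    obtain ⟨h0, h1⟩ := hB0 t ω
    simp only [hV, hW', mul_assoc, ← mul_add]
    rw [← ENNReal.ofReal_mul (by norm_num), ← ENNReal.ofReal_mul (Real.exp_pos _).le,
      ← ENNReal.ofReal_add (Real.exp_pos _).le (by positivity)]
    gcongr
    rw [sub_eq_add_neg, Real.exp_add, ← mul_add]
    have h2 : Real.exp (-B t ω) + 1 / 2 * B t ω ≤ 1 := by
      have h3 : Real.exp (-B t ω) ≤ 1 / (1 + B t ω) := by
        rw [Real.exp_neg, inv_eq_one_div]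
        exact one_div_le_one_div_of_le (by linarith) (by linarith [Real.add_one_le_exp (B t ω)])
      have h4 : 1 / (1 + B t ω) ≤ 1 - 1 / 2 * B t ω := by
        rw [div_le_iff₀ (by linarith)]
        nlinarith
      linarith
    calc _ ≤ Real.exp (1 / 2 * p t ω) * 1 := by gcongr
      _ = _ := mul_one _
  have hc : ∫⁻ ω, W' ω ∂P ≤ ∫⁻ ω, W ω ∂P + ∫⁻ ω, V ω * ENNReal.ofReal (p t ω) ∂P := by
    rw [← lintegral_add_left (hW.mono hle le_rfl)]
    refine lintegral_mono fun ω => ?_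
    obtain ⟨h0, h1⟩ := hp0 t ω
    simp only [hV, hW', mul_assoc]
    rw [← ENNReal.ofReal_mul (by norm_num), ← ENNReal.ofReal_mul (Real.exp_pos _).le]
    nth_rw 2 [← mul_one (W ω)]
    rw [← mul_add, ← ENNReal.ofReal_one, ← ENNReal.ofReal_add zero_le_one (by positivity)]
    gcongr
    have h2 := Real.add_one_le_exp (-(1 / 2 * p t ω))
    have h3 := mul_le_mul_of_nonneg_left h2 (Real.exp_pos (1 / 2 * p t ω)).le
    rw [← Real.exp_add, add_neg_cancel, Real.exp_zero] at h3
    linarith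
  have hd : ∫⁻ ω, W ω * ENNReal.ofReal (Real.exp (1 / 2 * p t ω - B t ω)) ∂P
      + ∫⁻ ω, V ω * ENNReal.ofReal (p t ω) ∂P
      ≤ ∫⁻ ω, W ω ∂P + ∫⁻ ω, V ω * ENNReal.ofReal (p t ω) ∂P :=
    (add_le_add_right (h t V hVm) _).trans (ha.trans hc)
  exact (ENNReal.add_le_add_iff_right hfin').1 hd

open Classical in
/-- Lower bound for the frequency of events whose conditional probabilities are at least `q` on
predictable events. -/
lemma prob_frequency_le {N : ℕ} {E A : Fin N → ℕ → Set Ω}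
    (hE : ∀ i t, MeasurableSet[F (t + 1)] (E i t)) (hA : ∀ i t, MeasurableSet[F t] (A i t))
    {q : ℝ} (hq : q ∈ Set.Icc 0 1)
    (h : ∀ i t (W : Ω → ℝ≥0∞), Measurable[F t] W →
      ∫⁻ ω, W ω * (ENNReal.ofReal q * (A i t).indicator 1 ω) ∂P
        ≤ ∫⁻ ω, W ω * (E i t).indicator 1 ω ∂P) (T : ℕ) (x : ℝ) :
    P {ω | ∑ t ∈ Finset.range T, (1 / N * ∑ i, if ω ∈ E i t then (1 : ℝ) else 0)
        ≤ q / 2 * ∑ t ∈ Finset.range T, (1 / N * ∑ i, if ω ∈ A i t then (1 : ℝ) else 0) - x}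
      ≤ ENNReal.ofReal (Real.exp (-x)) := by
  have hfreq : ∀ (s : Fin N → Prop),
      (1 / (N : ℝ) * ∑ i, if s i then (1 : ℝ) else 0) ∈ Set.Icc (0 : ℝ) 1 := by
    intro s
    have h0 : ∀ i, (if s i then (1 : ℝ) else 0) ∈ Set.Icc (0 : ℝ) 1 := fun i => by
      split_ifs <;> simp
    refine ⟨mul_nonneg (by positivity) (Finset.sum_nonneg fun i _ => (h0 i).1), ?_⟩
    have h1 : ∑ i, (if s i then (1 : ℝ) else 0) ≤ N := by
      simpa using Finset.sum_le_sum fun i (_ : i ∈ Finset.univ) => (h0 i).2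
    rcases Nat.eq_zero_or_pos N with rfl | hN
    · simp
    · rw [one_div, inv_mul_le_iff₀ (by positivity)]
      linarith
  have hofReal : ∀ (D : Fin N → Set Ω) ω,
      ENNReal.ofReal (1 / N * ∑ i, if ω ∈ D i then (1 : ℝ) else 0)
        = ENNReal.ofReal (1 / N) * ∑ i, (D i).indicator 1 ω := by
    intro D ω
    rw [ENNReal.ofReal_mul (by positivity), ENNReal.ofReal_sum_of_nonneg fun i _ => by
      split_ifs <;> simp]
    congr 1
    refine Finset.sum_congr rfl fun i _ => ?_
    by_cases hi : ω ∈ D i <;> simp [hi]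
  have hmeas : ∀ (m : MeasurableSpace Ω) (D : Fin N → Set Ω), (∀ i, MeasurableSet[m] (D i)) →
      Measurable[m] fun ω => 1 / (N : ℝ) * ∑ i, if ω ∈ D i then (1 : ℝ) else 0 := by
    intro m D hD
    exact (Finset.measurable_sum _ fun i _ =>
      Measurable.ite (hD i) measurable_const measurable_const).const_mul _
  -- Averaging over the nodes first gives one variable in [0, 1] per time, so the concentration
  -- comes from the time direction alone.
  have key := prob_sum_le_half_sum (P := P) (F := F)
    (B := fun t ω => 1 / N * ∑ i, if ω ∈ E i t then (1 : ℝ) else 0)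
    (p := fun t ω => q * (1 / N * ∑ i, if ω ∈ A i t then (1 : ℝ) else 0))
    (fun t => hmeas _ _ fun i => hE i t) (fun t => (hmeas _ _ fun i => hA i t).const_mul q)
    (fun t ω => hfreq _) (fun t ω => ⟨mul_nonneg hq.1 (hfreq _).1,
      mul_le_one₀ hq.2 (hfreq _).1 (hfreq _).2⟩) ?_ T x
  · refine (measure_mono fun ω hω => ?_).trans key
    rw [Set.mem_ofPred_eq] at hω ⊢
    rw [← Finset.mul_sum (a := q)]
    linarith
  intro t W hW
  have hle := F.le t
  have hWm := hW.mono hle le_rfl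
  have e1 : ∀ ω, W ω * ENNReal.ofReal (q * (1 / N * ∑ i, if ω ∈ A i t then (1 : ℝ) else 0))
      = ENNReal.ofReal (1 / N) *
        ∑ i, W ω * (ENNReal.ofReal q * (A i t).indicator 1 ω) := by
    intro ω
    rw [ENNReal.ofReal_mul hq.1, hofReal, ← Finset.mul_sum, ← Finset.mul_sum]
    ring
  have e2 : ∀ ω, W ω * ENNReal.ofReal (1 / N * ∑ i, if ω ∈ E i t then (1 : ℝ) else 0)
      = ENNReal.ofReal (1 / N) * ∑ i, W ω * (E i t).indicator 1 ω := by
    intro ω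
    rw [hofReal, ← Finset.mul_sum]
    ring
  have m1 : ∀ i, Measurable fun ω => W ω * (ENNReal.ofReal q * (A i t).indicator 1 ω) := fun i =>
    hWm.mul (measurable_const.mul (measurable_one.indicator (hle _ (hA i t))))
  have m2 : ∀ i, Measurable fun ω => W ω * (E i t).indicator 1 ω := fun i =>
    hWm.mul (measurable_one.indicator (F.le _ _ (hE i t)))
  simp only [e1, e2]
  rw [lintegral_const_mul _ (Finset.measurable_sum _ fun i _ => m1 i),
    lintegral_const_mul _ (Finset.measurable_sum _ fun i _ => m2 i),
    lintegral_finsetSum _ fun i _ => m1 i, lintegral_finsetSum _ fun i _ => m2 i]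
  exact mul_le_mul_right (Finset.sum_le_sum fun i _ => h i t W hW) _

end Supermartingale

/-! ### Consequences of the conditional Poisson law -/

/-- The filtration restricted to the nonnegative times. -/
def natFiltration {Ω : Type*} [mΩ : MeasurableSpace Ω] (ℋ : Filtration ℤ mΩ) : Filtration ℕ mΩ where
  seq t := ℋ t
  mono' _ _ h := ℋ.mono (by exact_mod_cast h)
  le' t := ℋ.le t

section Conditional

variable {Ω : Type*} [mΩ : MeasurableSpace Ω] {P : Measure Ω} [IsProbabilityMeasure P] {N : ℕ}
  {G : SimpleGraph (Fin N)} {ν : Param} {ℋ : Filtration ℤ mΩ}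
  {y : Fin N → ℤ → Ω → ℕ} {lam : Fin N → ℤ → Ω → ℝ}

/-- The contribution of one observation to the log-likelihood. -/
noncomputable def logLikTerm (k : ℕ) (l : ℝ) : ℝ := k * Real.log l - l

/-- The exponential moment of the halved log-likelihood ratio is governed by the Hellinger
distance. -/
lemma tsum_poissonWeight_likelihoodRatio {l b : ℝ} (hl : 0 < l) (hb : 0 < b) :
    ∑' k, poissonWeight l k * ENNReal.ofReal (Real.exp
      (1 / 2 * (logLikTerm k b - logLikTerm k l) + 1 / 2 * (√b - √l) ^ 2)) = 1 := by
  -- With the Hellinger term added, the exponent is affine in k, so the moment generating function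
  -- applies; its value has exponent l(√b/√l - 1) + l - √b√l = 0.
  have e : ∀ k : ℕ, 1 / 2 * (logLikTerm k b - logLikTerm k l) + 1 / 2 * (√b - √l) ^ 2
      = k * (1 / 2 * (Real.log b - Real.log l)) + (l - √b * √l) := by
    intro k
    have h1 := Real.sq_sqrt hb.le
    have h2 := Real.sq_sqrt hl.le
    unfold logLikTerm
    linear_combination 1 / 2 * h1 + 1 / 2 * h2
  simp only [e]
  rw [tsum_poissonWeight_mul_exp hl.le]
  have h3 : Real.exp (1 / 2 * (Real.log b - Real.log l)) = √b / √l := by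
    rw [← Real.log_div hb.ne' hl.ne', ← Real.sqrt_div hb.le, Real.sqrt_eq_rpow,
      Real.rpow_def_of_pos (by positivity)]
    ring_nf
  have h4 : l * (√b / √l - 1) + (l - √b * √l) = 0 := by
    have h2 := Real.sq_sqrt hl.le
    have : 0 < √l := Real.sqrt_pos.2 hl
    field_simp
    linear_combination (-√b) * h2
  rw [h3, h4]
  simp

/-- The log-likelihood at predictable intensities falls short of the true one by the
Hellinger distance, up to an exponentially unlikely error. -/
lemma IsModel.prob_likelihood_ge (h : IsModel P G ν ℋ y lam) {b : Fin N → ℕ → Ω → ℝ}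
    (hb : ∀ i (t : ℕ), Measurable[ℋ (t : ℤ)] (b i (t + 1))) (hb0 : ∀ i t ω, 0 < b i (t + 1) ω)
    (hlam : ∀ᵐ ω ∂P, ∀ i (t : ℕ), 0 < lam i ((t + 1 : ℕ) : ℤ) ω) (T : ℕ) (x : ℝ) :
    P {ω | x ≤ ∑ t ∈ Finset.range T, ∑ i,
        (1 / 2 * (logLikTerm (y i ((t + 1 : ℕ) : ℤ) ω) (b i (t + 1) ω)
          - logLikTerm (y i ((t + 1 : ℕ) : ℤ) ω) (lam i ((t + 1 : ℕ) : ℤ) ω))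
          + 1 / 2 * (√(b i (t + 1) ω) - √(lam i ((t + 1 : ℕ) : ℤ) ω)) ^ 2)}
      ≤ ENNReal.ofReal (Real.exp (-x)) := by
  have hcast : ∀ t : ℕ, ((t + 1 : ℕ) : ℤ) - 1 = t := fun t => by push_cast; ring
  have hlm : ∀ i (t : ℕ), Measurable[ℋ (t : ℤ)] (lam i ((t + 1 : ℕ) : ℤ)) := fun i t => by
    have := h.predictable i ((t + 1 : ℕ) : ℤ)
    rwa [hcast] at this
  have hterm : ∀ (m : MeasurableSpace Ω) (k : ℕ) (f g : Ω → ℝ), Measurable[m] f → Measurable[m] g →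
      Measurable[m] fun ω => 1 / 2 * (logLikTerm k (f ω) - logLikTerm k (g ω))
        + 1 / 2 * (√(f ω) - √(g ω)) ^ 2 := by
    intro m k f g hf hg
    unfold logLikTerm
    fun_prop
  refine prob_le_exp_neg (F := natFiltration ℋ) (fun t => ?_) (fun t W hW _ => ?_) T x
  · have hmono : ℋ (t : ℤ) ≤ ℋ ((t + 1 : ℕ) : ℤ) := ℋ.mono (by simp)
    have hy : ∀ i, Measurable[ℋ ((t + 1 : ℕ) : ℤ)] fun ω => (y i ((t + 1 : ℕ) : ℤ) ω : ℝ) := fun i =>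
      (measurable_from_top (f := fun k : ℕ => (k : ℝ))).comp (h.adapted i _)
    have hb' := fun i => (hb i t).mono hmono le_rfl
    have hl' := fun i => (hlm i t).mono hmono le_rfl
    change Measurable[ℋ ((t + 1 : ℕ) : ℤ)] _
    unfold logLikTerm
    exact Finset.measurable_sum _ fun i _ => (((hy i).mul (Real.measurable_log.comp (hb' i))
      |>.sub (hb' i)).sub (((hy i).mul (Real.measurable_log.comp (hl' i))).sub (hl' i))
      |>.const_mul _).add (((hb' i).sqrt.sub (hl' i).sqrt).pow_const 2 |>.const_mul _)
  · have h1 := h.lintegral_prod ((t + 1 : ℕ) : ℤ) (W := W) (by rw [hcast]; exact hW)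
      (g := fun i k ω => ENNReal.ofReal (Real.exp
        (1 / 2 * (logLikTerm k (b i (t + 1) ω) - logLikTerm k (lam i ((t + 1 : ℕ) : ℤ) ω))
          + 1 / 2 * (√(b i (t + 1) ω) - √(lam i ((t + 1 : ℕ) : ℤ) ω)) ^ 2)))
      (fun i k => by
        rw [hcast]
        exact ENNReal.measurable_ofReal.comp (Real.measurable_exp.comp
          (hterm _ k _ _ (hb i t) (hlm i t))))
    simp only [Real.exp_sum]
    simp only [ENNReal.ofReal_prod_of_nonneg fun _ _ => (Real.exp_pos _).le]
    rw [h1]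
    refine le_of_eq (lintegral_congr_ae ?_)
    filter_upwards [hlam] with ω hω
    rw [Finset.prod_eq_one, mul_one]
    exact fun i _ => tsum_poissonWeight_likelihoodRatio (hω i t) (hb0 i t ω)

/-- A lower bound for the conditional probabilities of configurations with entries at most `r` on
a set of nodes whose intensities are at least `w` and sum up to at most `M`. -/
noncomputable def configProb (w M : ℝ) (r : ℕ) : ℝ :=
  Real.exp (-M) * (min 1 w ^ r / (Nat.factorial r : ℝ))

lemma configProb_pos {w : ℝ} (hw : 0 < w) (M : ℝ) (r : ℕ) : 0 < configProb w M r := by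
  have : 0 < min 1 w := lt_min one_pos hw
  unfold configProb
  positivity

lemma configProb_le_one {w : ℝ} (hw : 0 < w) {M : ℝ} (hM : 0 ≤ M) (r : ℕ) :
    configProb w M r ≤ 1 := by
  have h0 : 0 < min 1 w := lt_min one_pos hw
  have h1 : min 1 w ^ r ≤ 1 := pow_le_one₀ h0.le (min_le_left _ _)
  have h2 : (1 : ℝ) ≤ (Nat.factorial r : ℝ) := by exact_mod_cast Nat.factorial_pos r
  refine mul_le_one₀ (Real.exp_le_one_iff.2 (by linarith)) (by positivity) ?_
  exact div_le_one_of_le₀ (h1.trans h2) (by positivity)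

/-- The exponential factors multiply to exp of minus the total intensity, at least exp(-M). The only
other factor belongs to the node j, and is absent if j lies outside B. -/
lemma configProb_le_prod {B : Finset (Fin N)} {l : Fin N → ℝ} {w M : ℝ} (hw : 0 < w)
    (hl : ∀ j, w ≤ l j) (hM : ∑ j ∈ B, l j ≤ M) {r k : ℕ} (hk : k ≤ r) (j : Fin N) :
    ENNReal.ofReal (configProb w M r) ≤ ∏ i ∈ B, poissonWeight (l i) ((Pi.single j k : Fin N → ℕ) i) := by
  classical
  have hpos : ∀ i, 0 < l i := fun i => hw.trans_le (hl i)
  simp only [poissonWeight]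
  rw [← ENNReal.ofReal_prod_of_nonneg fun i _ => by have := hpos i; positivity]
  apply ENNReal.ofReal_le_ofReal
  have e : ∀ i, Real.exp (-l i) * l i ^ (Pi.single j k : Fin N → ℕ) i
      / (Nat.factorial ((Pi.single j k : Fin N → ℕ) i) : ℝ)
      = Real.exp (-l i) * (if i = j then l j ^ k / (Nat.factorial k : ℝ) else 1) := by
    intro i
    by_cases hi : i = j
    · subst hi; simp; ring
    · simp [hi]
  simp only [e, Finset.prod_mul_distrib, ← Real.exp_sum, Finset.sum_neg_distrib]
  have h0 : 0 < min 1 w := lt_min one_pos hw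
  have hr1 : min 1 w ^ r ≤ 1 := pow_le_one₀ h0.le (min_le_left _ _)
  have h2 : (1 : ℝ) ≤ (Nat.factorial r : ℝ) := by exact_mod_cast Nat.factorial_pos r
  have h3 : min 1 w ^ r / (Nat.factorial r : ℝ)
      ≤ ∏ i ∈ B, (if i = j then l j ^ k / (Nat.factorial k : ℝ) else 1) := by
    rw [Finset.prod_ite_eq']
    split_ifs
    · have h4 : min 1 w ^ r ≤ l j ^ k :=
        (pow_le_pow_of_le_one h0.le (min_le_left _ _) hk).trans
          (pow_le_pow_left₀ h0.le ((min_le_right _ _).trans (hl j)) k)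
      have h5 : (Nat.factorial k : ℝ) ≤ Nat.factorial r := by exact_mod_cast Nat.factorial_le hk
      have := hpos j
      gcongr
    · exact div_le_one_of_le₀ (hr1.trans h2) (by positivity)
  unfold configProb
  gcongr

open Classical in
/-- If at every point of the predictable event `A` one of two configurations makes `|F|` at least
`s`, then `|F| ≥ s` has positive conditional probability on `A`. -/
lemma IsModel.lintegral_large_ge (h : IsModel P G ν ℋ y lam) (t : ℤ) {B : Finset (Fin N)}
    {F : (Fin N → ℕ) → Ω → ℝ} (hF : ∀ n, Measurable[ℋ (t - 1)] (F n))
    (hloc : ∀ n n' : Fin N → ℕ, (∀ j ∈ B, n j = n' j) → F n = F n')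
    {A : Set Ω} (hA : MeasurableSet[ℋ (t - 1)] A) {w M s : ℝ} (hw : 0 < w) {r k : ℕ} (hk : k ≤ r)
    {j : Fin N} (hcase : ∀ ω ∈ A, (∀ j, w ≤ lam j t ω) ∧ ∑ j ∈ B, lam j t ω ≤ M ∧
      (s ≤ |F 0 ω| ∨ s ≤ |F (Pi.single j k) ω|))
    {W : Ω → ℝ≥0∞} (hW : Measurable[ℋ (t - 1)] W) :
    ∫⁻ ω, W ω * (ENNReal.ofReal (configProb w M r) * A.indicator 1 ω) ∂P
      ≤ ∫⁻ ω, W ω * {ω | s ≤ |F (fun i => y i t ω) ω|}.indicator 1 ω ∂P := by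
  have hle := ℋ.le (t - 1)
  have hS : ∀ n, MeasurableSet[ℋ (t - 1)] {ω | s ≤ |F n ω|} := fun n =>
    hF n (measurableSet_le measurable_const measurable_id.abs)
  have key : ∀ (D : Set Ω) (k' : ℕ), k' ≤ r → MeasurableSet[ℋ (t - 1)] D → D ⊆ A →
      (∀ ω ∈ D, s ≤ |F (Pi.single j k') ω|) →
      ∫⁻ ω, W ω * (ENNReal.ofReal (configProb w M r) * D.indicator 1 ω) ∂P
        ≤ ∫⁻ ω, (W ω * D.indicator 1 ω)
          * {ω | s ≤ |F (fun i => y i t ω) ω|}.indicator 1 ω ∂P := by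
    intro D k' hk' hD hDA hDF
    have h1 := h.lintegral_local_configuration t B (Pi.single j k')
      (W := fun ω => W ω * D.indicator 1 ω) (hW.mul (Measurable.indicator measurable_const hD))
    calc _ ≤ ∫⁻ ω, (W ω * D.indicator 1 ω)
          * ∏ i ∈ B, poissonWeight (lam i t ω) ((Pi.single j k' : Fin N → ℕ) i) ∂P := by
          refine lintegral_mono fun ω => ?_
          by_cases hω : ω ∈ D
          · obtain ⟨h2, h3, -⟩ := hcase ω (hDA hω)
            simp only [hω, Set.indicator_of_mem, Pi.one_apply, mul_one]
            gcongr
            exact configProb_le_prod hw h2 h3 hk' j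
          · simp [hω]
      _ = _ := h1.symm
      _ ≤ _ := by
          refine lintegral_mono fun ω => ?_
          by_cases hω : ω ∈ D
          · by_cases hc : ∀ i ∈ B, y i t ω = (Pi.single j k' : Fin N → ℕ) i
            · have h2 : s ≤ |F (fun i => y i t ω) ω| := by
                rw [hloc _ (Pi.single j k') hc]
                exact hDF ω hω
              simp only [hω, h2, Set.indicator_of_mem, Pi.one_apply, mul_one, Set.mem_ofPred_eq]
              exact mul_le_of_le_one_right' (Set.indicator_le_self' (by simp) ω)
            · have h2 : ω ∉ {ω | ∀ i ∈ B, y i t ω = (Pi.single j k' : Fin N → ℕ) i} := hc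
              rw [Set.indicator_of_notMem h2]
              simp
          · simp [hω]
  -- Whether the zero configuration already makes F large is known from the past, so A can be split
  -- accordingly and one configuration used on each piece. Since `Pi.single j 0 = 0`, both pieces
  -- are instances of `key`.
  have hD1 : MeasurableSet[ℋ (t - 1)] (A ∩ {ω | s ≤ |F 0 ω|}) := hA.inter (hS 0)
  have hD2 : MeasurableSet[ℋ (t - 1)] (A \ {ω | s ≤ |F 0 ω|}) := hA.diff (hS 0)
  have k1 := key _ 0 (Nat.zero_le r) hD1 Set.inter_subset_left (fun ω hω => by
    simpa using hω.2)
  have k2 := key _ k hk hD2 Set.sdiff_subset (fun ω hω => by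
    exact (hcase ω hω.1).2.2.resolve_left hω.2)
  have hWm := hW.mono hle le_rfl
  have m1 : Measurable fun ω => W ω * (ENNReal.ofReal (configProb w M r)
      * (A ∩ {ω | s ≤ |F 0 ω|}).indicator 1 ω) :=
    hWm.mul (measurable_const.mul (measurable_one.indicator (hle _ hD1)))
  have hsplit : ∀ ω, A.indicator (1 : Ω → ℝ≥0∞) ω
      = (A ∩ {ω | s ≤ |F 0 ω|}).indicator 1 ω + (A \ {ω | s ≤ |F 0 ω|}).indicator 1 ω := by
    intro ω
    by_cases h1 : ω ∈ A <;> by_cases h2 : s ≤ |F 0 ω| <;> simp [h1, h2]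
  calc _ = ∫⁻ ω, W ω * (ENNReal.ofReal (configProb w M r)
          * (A ∩ {ω | s ≤ |F 0 ω|}).indicator 1 ω) ∂P
        + ∫⁻ ω, W ω * (ENNReal.ofReal (configProb w M r)
          * (A \ {ω | s ≤ |F 0 ω|}).indicator 1 ω) ∂P := by
        rw [← lintegral_add_left m1]
        refine lintegral_congr fun ω => ?_
        rw [hsplit]
        ring
    _ ≤ _ := add_le_add k1 k2
    _ ≤ ∫⁻ ω, (W ω * (A ∩ {ω | s ≤ |F 0 ω|}).indicator 1 ω)
          * {ω | s ≤ |F (fun i => y i t ω) ω|}.indicator 1 ω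
          + (W ω * (A \ {ω | s ≤ |F 0 ω|}).indicator 1 ω)
          * {ω | s ≤ |F (fun i => y i t ω) ω|}.indicator 1 ω ∂P := le_lintegral_add _ _
    _ ≤ _ := by
        refine lintegral_mono fun ω => ?_
        rw [← add_mul, ← mul_add, ← hsplit]
        refine mul_le_mul_left ?_ _
        calc _ ≤ W ω * 1 := mul_le_mul_right (Set.indicator_le_self' (by simp) ω) _
          _ = _ := mul_one _

end Conditional

/-! ### Contracting recursions -/

lemma sum_le_of_contraction {z u : ℕ → ℝ} {b : ℝ} (hb0 : 0 ≤ b) (hb : b < 1)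
    (hz : ∀ t, 0 ≤ z t) (h : ∀ t, z (t + 1) ≤ u t + b * z t) (T : ℕ) :
    ∑ t ∈ Finset.range (T + 1), z t ≤ (z 0 + ∑ t ∈ Finset.range T, u t) / (1 - b) := by
  have h1 : ∑ t ∈ Finset.range T, z (t + 1)
      ≤ ∑ t ∈ Finset.range T, u t + b * ∑ t ∈ Finset.range T, z t := by
    rw [Finset.mul_sum, ← Finset.sum_add_distrib]
    exact Finset.sum_le_sum fun t _ => h t
  have h2 : ∑ t ∈ Finset.range T, z t ≤ ∑ t ∈ Finset.range (T + 1), z t := by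
    rw [Finset.sum_range_succ]
    linarith [hz T]
  have h3 := mul_le_mul_of_nonneg_left h2 hb0
  rw [le_div_iff₀ (by linarith)]
  rw [Finset.sum_range_succ'] at h3 ⊢
  linarith

/-- Convexity of the square gives (v + bx)² ≤ v²/(1 - b) + bx², so the squares obey a contracting
recursion with the same factor b. -/
lemma sum_sq_le_of_contraction {x v : ℕ → ℝ} {b : ℝ} (hb0 : 0 ≤ b) (hb : b < 1)
    (hx : ∀ t, 0 ≤ x t) (h : ∀ t, x (t + 1) ≤ v t + b * x t) (T : ℕ) :
    ∑ t ∈ Finset.range (T + 1), x t ^ 2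
      ≤ (x 0 ^ 2 + (∑ t ∈ Finset.range T, v t ^ 2) / (1 - b)) / (1 - b) := by
  rw [Finset.sum_div]
  refine sum_le_of_contraction (z := fun t => x t ^ 2) hb0 hb (fun t => sq_nonneg _)
    (fun t => ?_) T
  have h0 : 0 < 1 - b := by linarith
  have h1 : x (t + 1) ^ 2 ≤ (v t + b * x t) ^ 2 := pow_le_pow_left₀ (hx _) (h t) 2
  have h2 : v t ^ 2 / (1 - b) + b * x t ^ 2 - (v t + b * x t) ^ 2
      = b / (1 - b) * (v t - (1 - b) * x t) ^ 2 := by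
    field_simp
    ring
  have h3 : 0 ≤ b / (1 - b) * (v t - (1 - b) * x t) ^ 2 := by positivity
  linarith

/-! ### The network -/

section Network

variable {N : ℕ} (G : SimpleGraph (Fin N))

lemma adjEntry_nonneg (i j : Fin N) : 0 ≤ adjEntry G i j := by
  unfold adjEntry
  split_ifs <;> simp

lemma nodeDegree_nonneg (i : Fin N) : 0 ≤ nodeDegree G i :=
  Finset.sum_nonneg fun j _ => adjEntry_nonneg G i j

lemma weight_nonneg (i j : Fin N) : 0 ≤ weight G i j :=
  div_nonneg (adjEntry_nonneg G i j) (nodeDegree_nonneg G i)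

lemma sum_weight_le_one (i : Fin N) : ∑ j, weight G i j ≤ 1 := by
  unfold weight
  rw [← Finset.sum_div]
  exact div_self_le_one _

lemma weight_eq_zero_of_not_adj {i j : Fin N} (h : ¬ G.Adj i j) : weight G i j = 0 := by
  simp [weight, adjEntry, h]

/-- The weighted mean `∑_j w_ij n_j` over the neighbours of a node. -/
noncomputable def netMean (n : Fin N → ℕ) (i : Fin N) : ℝ := ∑ j, weight G i j * (n j : ℝ)

lemma netMean_nonneg (n : Fin N → ℕ) (i : Fin N) : 0 ≤ netMean G n i :=
  Finset.sum_nonneg fun j _ => mul_nonneg (weight_nonneg G i j) (Nat.cast_nonneg _)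

/-- Cauchy–Schwarz for weights of total mass at most one; the bound does not depend on the degree.
-/
lemma netMean_sq_le (n : Fin N → ℕ) (i : Fin N) :
    netMean G n i ^ 2 ≤ ∑ j, weight G i j * (n j : ℝ) ^ 2 := by
  have h := Finset.sum_sq_le_sum_mul_sum_of_sq_le_mul Finset.univ
    (r := fun j => weight G i j * (n j : ℝ)) (f := fun j => weight G i j)
    (g := fun j => weight G i j * (n j : ℝ) ^ 2) (fun j _ => weight_nonneg G i j)
    (fun j _ => mul_nonneg (weight_nonneg G i j) (by positivity)) (fun j _ => le_of_eq (by ring))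
  have h0 : 0 ≤ ∑ j, weight G i j * (n j : ℝ) ^ 2 :=
    Finset.sum_nonneg fun j _ => mul_nonneg (weight_nonneg G i j) (by positivity)
  exact h.trans (mul_le_of_le_one_left h0 (sum_weight_le_one G i))

/-- The term of the intensity recursion that carries the threshold. -/
noncomputable def regimeTerm (ν : Param) (k : ℕ) : ℝ :=
  (if ν.2 ≤ k then alphaUp ν.1 else alphaDown ν.1) * (k : ℝ)

lemma nextIntensity_eq (ν : Param) (i : Fin N) (n : Fin N → ℕ) (l : ℝ) :
    nextIntensity G ν i n l
      = base ν.1 + regimeTerm ν (n i) + netCoef ν.1 * netMean G n i + garchCoef ν.1 * l := rfl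

/-- The contribution of one site to the sum that dominates all path functionals. -/
noncomputable def momentTerm (q : ℝ) (n : Fin N → ℕ) (i : Fin N) : ℝ :=
  1 + (n i : ℝ) ^ q + ∑ j, weight G i j * (n j : ℝ) ^ 2

lemma natCast_sq_le_rpow {q : ℝ} (hq : 2 ≤ q) (k : ℕ) : (k : ℝ) ^ 2 ≤ (k : ℝ) ^ q := by
  rcases Nat.eq_zero_or_pos k with rfl | hk
  · simp [Real.zero_rpow (by linarith : q ≠ 0)]
  · rw [← Real.rpow_natCast]
    exact Real.rpow_le_rpow_of_exponent_le (by exact_mod_cast hk) (by exact_mod_cast hq)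

lemma one_add_sq_add_sq_le_momentTerm {q : ℝ} (hq : 2 ≤ q) (n : Fin N → ℕ) (i : Fin N) :
    1 + (n i : ℝ) ^ 2 + netMean G n i ^ 2 ≤ momentTerm G q n i := by
  have h1 := natCast_sq_le_rpow hq (n i)
  have h2 := netMean_sq_le G n i
  unfold momentTerm
  linarith

lemma one_le_momentTerm {q : ℝ} (hq : 2 ≤ q) (n : Fin N → ℕ) (i : Fin N) :
    1 ≤ momentTerm G q n i := by
  have := one_add_sq_add_sq_le_momentTerm G hq n i
  nlinarith [sq_nonneg (n i : ℝ), sq_nonneg (netMean G n i)]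

end Network

/-! ### Fitted intensities along a path -/

/-- Nonnegative coefficients bounded by `A`. -/
def CoefBound (A : ℝ) (θ : Coef) : Prop := ∀ k, θ k ∈ Set.Icc 0 A

section Path

variable {N : ℕ} (G : SimpleGraph (Fin N)) {init : Fin N → ℝ} {y : Fin N → ℤ → ℕ}

lemma regimeTerm_nonneg {A : ℝ} {ν : Param} (hν : CoefBound A ν.1) (k : ℕ) :
    0 ≤ regimeTerm ν k := by
  have h1 := (hν 1).1
  have h2 := (hν 2).1
  unfold regimeTerm alphaUp alphaDown
  split_ifs <;> positivity

lemma regimeTerm_le {A : ℝ} {ν : Param} (hν : CoefBound A ν.1) (k : ℕ) :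
    regimeTerm ν k ≤ A * k := by
  have h1 := (hν 1).2
  have h2 := (hν 2).2
  unfold regimeTerm alphaUp alphaDown
  split_ifs <;> gcongr

lemma fittedIntensity_nonneg {A : ℝ} {ν : Param} (hν : CoefBound A ν.1)
    (hinit : ∀ i, 0 ≤ init i) (i : Fin N) (t : ℕ) : 0 ≤ fittedIntensity G init y ν i t := by
  induction t with
  | zero => exact hinit i
  | succ t ih =>
    rw [fittedIntensity, nextIntensity_eq]
    have h0 : 0 ≤ base ν.1 := (hν 0).1
    have h1 := regimeTerm_nonneg hν (y i t)
    have h2 := mul_nonneg (hν 3).1 (netMean_nonneg G (fun j => y j t) i)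
    have h3 := mul_nonneg (hν 4).1 ih
    unfold netCoef garchCoef
    linarith

lemma base_le_fittedIntensity_succ {A : ℝ} {ν : Param} (hν : CoefBound A ν.1)
    (hinit : ∀ i, 0 ≤ init i) (i : Fin N) (t : ℕ) :
    base ν.1 ≤ fittedIntensity G init y ν i (t + 1) := by
  rw [fittedIntensity, nextIntensity_eq]
  have h1 := regimeTerm_nonneg hν (y i t)
  have h2 := mul_nonneg (hν 3).1 (netMean_nonneg G (fun j => y j t) i)
  have h3 := mul_nonneg (hν 4).1 (fittedIntensity_nonneg G (y := y) hν hinit i t)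
  unfold netCoef garchCoef
  linarith

/-- The sum of the moment terms over all nodes and the times `0, …, T`. -/
noncomputable def momentSum (q : ℝ) (y : Fin N → ℤ → ℕ) (T : ℕ) : ℝ :=
  ∑ i, ∑ t ∈ Finset.range (T + 1), momentTerm G q (fun j => y j (t : ℤ)) i

lemma sum_range_momentTerm_le {q : ℝ} (hq : 2 ≤ q) (T : ℕ) :
    ∑ i, ∑ t ∈ Finset.range T, momentTerm G q (fun j => y j (t : ℤ)) i ≤ momentSum G q y T := by
  refine Finset.sum_le_sum fun i _ => ?_
  rw [Finset.sum_range_succ]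
  linarith [one_le_momentTerm G hq (fun j => y j (T : ℤ)) i]

lemma card_le_momentSum {q : ℝ} (hq : 2 ≤ q) (T : ℕ) : (N : ℝ) ≤ momentSum G q y T := by
  have h : ∀ i : Fin N, (1 : ℝ) ≤ ∑ t ∈ Finset.range (T + 1), momentTerm G q (fun j => y j (t : ℤ)) i := by
    intro i
    rw [Finset.sum_range_succ']
    have := Finset.sum_nonneg fun t (_ : t ∈ Finset.range T) =>
      zero_le_one.trans (one_le_momentTerm G hq (fun j => y j ((t + 1 : ℕ) : ℤ)) i)
    linarith [one_le_momentTerm G hq (fun j => y j ((0 : ℕ) : ℤ)) i]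
  simpa [momentSum] using Finset.sum_le_sum fun i (_ : i ∈ Finset.univ) => h i

/-- The inputs of the contracting recursion are at most A(1 + y + netMean), whose square is at most
3A² times the moment term. -/
lemma sum_fittedIntensity_sq_le {A b q : ℝ} (hb : b < 1) (hq : 2 ≤ q) {ν : Param}
    (hν : CoefBound A ν.1) (hνb : garchCoef ν.1 ≤ b) (hinit : ∀ i, 0 ≤ init i) (T : ℕ) :
    ∑ i, ∑ t ∈ Finset.range (T + 1), fittedIntensity G init y ν i t ^ 2
      ≤ (∑ i, init i ^ 2 + 3 * A ^ 2 / (1 - b) * momentSum G q y T) / (1 - b) := by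
  have h1b : 0 < 1 - b := by linarith
  have hA : 0 ≤ A := (hν 0).1.trans (hν 0).2
  have hb0 : 0 ≤ b := (hν 4).1.trans hνb
  have hi : ∀ i, ∑ t ∈ Finset.range (T + 1), fittedIntensity G init y ν i t ^ 2
      ≤ (init i ^ 2 + (∑ t ∈ Finset.range T,
        (A * (1 + (y i t : ℝ) + netMean G (fun j => y j t) i)) ^ 2) / (1 - b)) / (1 - b) := by
    intro i
    refine sum_sq_le_of_contraction hb0 hb (fittedIntensity_nonneg G hν hinit i) (fun t => ?_) T
    rw [fittedIntensity, nextIntensity_eq]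
    have h0 : base ν.1 ≤ A := (hν 0).2
    have h1 := regimeTerm_le hν (y i t)
    have h2 := mul_le_mul_of_nonneg_right (hν 3).2 (netMean_nonneg G (fun j => y j t) i)
    have h3 := mul_le_mul_of_nonneg_right hνb (fittedIntensity_nonneg G (y := y) hν hinit i t)
    unfold netCoef
    nlinarith
  refine (Finset.sum_le_sum fun i _ => hi i).trans ?_
  rw [← Finset.sum_div, Finset.sum_add_distrib, ← Finset.sum_div]
  gcongr
  rw [div_mul_eq_mul_div]
  gcongr
  refine le_trans ?_ (mul_le_mul_of_nonneg_left (sum_range_momentTerm_le G (y := y) hq T)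
    (by positivity))
  rw [Finset.mul_sum]
  refine Finset.sum_le_sum fun i _ => ?_
  rw [Finset.mul_sum]
  refine Finset.sum_le_sum fun t _ => ?_
  have h4 := one_add_sq_add_sq_le_momentTerm G hq (fun j => y j (t : ℤ)) i
  rw [mul_pow, mul_comm (3 : ℝ), mul_assoc]
  refine mul_le_mul_of_nonneg_left ?_ (by positivity)
  nlinarith [sq_nonneg ((y i t : ℝ) - 1), sq_nonneg (netMean G (fun j => y j t) i - 1),
    sq_nonneg ((y i t : ℝ) - netMean G (fun j => y j t) i)]

/-- Counts below R fall into the same regime for the thresholds r and min(r, R), so only the slopes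
differ. Counts from R on are bounded crudely; the moments make them rare. -/
lemma abs_regimeTerm_sub_le {A δ : ℝ} {ν ν' : Param} (hν : CoefBound A ν.1)
    (hν' : CoefBound A ν'.1) (hδ : ∀ k, |ν.1 k - ν'.1 k| ≤ δ) {R : ℕ} (hR : ν'.2 = min ν.2 R)
    (k : ℕ) :
    |regimeTerm ν k - regimeTerm ν' k| ≤ δ * k + if R ≤ k then A * k else 0 := by
  have hδ0 : 0 ≤ δ := (abs_nonneg _).trans (hδ 0)
  split_ifs with hk
  · have h1 := regimeTerm_nonneg hν k
    have h2 := regimeTerm_nonneg hν' k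
    have h3 := regimeTerm_le hν k
    have h4 := regimeTerm_le hν' k
    have : 0 ≤ δ * k := by positivity
    rw [abs_le]
    constructor <;> linarith
  · have hiff : ν'.2 ≤ k ↔ ν.2 ≤ k := by
      rw [hR, min_le_iff]
      tauto
    unfold regimeTerm alphaUp alphaDown
    simp only [hiff]
    rw [← sub_mul, abs_mul, Nat.abs_cast, add_zero]
    gcongr
    split_ifs
    · exact hδ 1
    · exact hδ 2

/-- Mean-square continuity in the parameter: the difference obeys a contracting recursion driven by
the coefficient error δ and by the counts beyond R. Having order q > 2 in the moment sum makes the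
second contribution vanish as R grows. It reduces infinitely many thresholds to finitely many. -/
lemma sum_fittedIntensity_sub_sq_le {A b q c δ : ℝ} (hb : b < 1) (hq : 2 ≤ q) {ν ν' : Param}
    (hν : CoefBound A ν.1) (hν' : CoefBound A ν'.1) (hνb : garchCoef ν.1 ≤ b)
    (hνb' : garchCoef ν'.1 ≤ b) (hinit : ∀ i, init i ∈ Set.Icc 0 c)
    (hδ : ∀ k, |ν.1 k - ν'.1 k| ≤ δ) {R : ℕ} (hR0 : 0 < R) (hR : ν'.2 = min ν.2 R) (T : ℕ) :
    ∑ i, ∑ t ∈ Finset.range (T + 1),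
        (fittedIntensity G init y ν i t - fittedIntensity G init y ν' i t) ^ 2
      ≤ (8 * δ ^ 2 + 2 * A ^ 2 * (R : ℝ) ^ (2 - q)) *
        ((1 + (c ^ 2 + 3 * A ^ 2 / (1 - b)) / (1 - b)) / (1 - b) ^ 2 * momentSum G q y T) := by
  have h1b : 0 < 1 - b := by linarith
  have hA : 0 ≤ A := (hν 0).1.trans (hν 0).2
  have hb0 : 0 ≤ b := (hν 4).1.trans hνb
  have hδ0 : 0 ≤ δ := (abs_nonneg _).trans (hδ 0)
  set x := fittedIntensity G init y ν with hx
  set x' := fittedIntensity G init y ν' with hx'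
  set κ := 8 * δ ^ 2 + 2 * A ^ 2 * (R : ℝ) ^ (2 - q) with hκ
  have hκ0 : 0 ≤ κ := by positivity
  have hx0 : ∀ i t, 0 ≤ x i t := fittedIntensity_nonneg G hν fun i => (hinit i).1
  set m : Fin N → ℕ → ℝ := fun i t => netMean G (fun j => y j t) i with hm
  set v : Fin N → ℕ → ℝ := fun i t => δ * (1 + y i t + m i t + x i t)
    + if R ≤ y i t then A * (y i t : ℝ) else 0 with hv
  have hrec : ∀ i t, |x i (t + 1) - x' i (t + 1)| ≤ v i t + b * |x i t - x' i t| := by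
    intro i t
    -- The coefficient differences multiply the quantities of ν, while the previous discrepancy is
    -- multiplied by β of ν' and contracts.
    have e : x i (t + 1) - x' i (t + 1) = (ν.1 0 - ν'.1 0)
        + (regimeTerm ν (y i t) - regimeTerm ν' (y i t)) + (ν.1 3 - ν'.1 3) * m i t
        + (ν.1 4 - ν'.1 4) * x i t + ν'.1 4 * (x i t - x' i t) := by
      simp only [hx, hx', fittedIntensity, nextIntensity_eq, base, netCoef, garchCoef, hm]
      ring
    have hm0 : 0 ≤ m i t := netMean_nonneg G _ i
    have a1 := abs_regimeTerm_sub_le hν hν' hδ hR (y i t)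
    have a2 : |(ν.1 3 - ν'.1 3) * m i t| ≤ δ * m i t := by
      rw [abs_mul, abs_of_nonneg hm0]
      exact mul_le_mul_of_nonneg_right (hδ 3) hm0
    have a3 : |(ν.1 4 - ν'.1 4) * x i t| ≤ δ * x i t := by
      rw [abs_mul, abs_of_nonneg (hx0 i t)]
      exact mul_le_mul_of_nonneg_right (hδ 4) (hx0 i t)
    have a4 : |ν'.1 4 * (x i t - x' i t)| ≤ b * |x i t - x' i t| := by
      rw [abs_mul, abs_of_nonneg (hν' 4).1]
      exact mul_le_mul_of_nonneg_right hνb' (abs_nonneg _)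
    rw [e]
    refine (abs_add_le _ _).trans (add_le_add ((abs_add_le _ _).trans ?_) a4)
    refine (add_le_add ((abs_add_le _ _).trans (add_le_add ((abs_add_le _ _).trans
      (add_le_add (hδ 0) a1)) a2)) a3).trans (le_of_eq ?_)
    simp only [hv]
    ring
  have hv2 : ∀ i t, v i t ^ 2 ≤ κ * (momentTerm G q (fun j => y j (t : ℤ)) i + x i t ^ 2) := by
    intro i t
    have h1 := one_add_sq_add_sq_le_momentTerm G hq (fun j => y j (t : ℤ)) i
    have hV : (y i t : ℝ) ^ q ≤ momentTerm G q (fun j => y j (t : ℤ)) i := by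
      have : 0 ≤ ∑ j, weight G i j * (y j t : ℝ) ^ 2 :=
        Finset.sum_nonneg fun j _ => mul_nonneg (weight_nonneg G i j) (by positivity)
      unfold momentTerm
      linarith
    set V := momentTerm G q (fun j => y j (t : ℤ)) i
    have h2 : (1 + (y i t : ℝ) + m i t + x i t) ^ 2 ≤ 4 * (V + x i t ^ 2) := by
      have : (1 + (y i t : ℝ) + m i t + x i t) ^ 2
          ≤ 4 * (1 + (y i t : ℝ) ^ 2 + m i t ^ 2 + x i t ^ 2) := by
        nlinarith [sq_nonneg ((y i t : ℝ) - 1), sq_nonneg (m i t - 1), sq_nonneg (x i t - 1),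
          sq_nonneg ((y i t : ℝ) - m i t), sq_nonneg ((y i t : ℝ) - x i t),
          sq_nonneg (m i t - x i t)]
      linarith
    -- Truncation by moments: on y ≥ R one has y² = y^(2-q) y^q ≤ R^(2-q) y^q.
    have h3 : (if R ≤ y i t then A * (y i t : ℝ) else 0) ^ 2 ≤ A ^ 2 * (R : ℝ) ^ (2 - q) * V := by
      split_ifs with hRy
      · have hRp : (0 : ℝ) < R := by exact_mod_cast hR0
        have hRy' : (R : ℝ) ≤ y i t := by exact_mod_cast hRy
        have hyp : (0 : ℝ) < y i t := hRp.trans_le hRy'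
        have h4 : (y i t : ℝ) ^ 2 = (y i t : ℝ) ^ (2 - q) * (y i t : ℝ) ^ q := by
          rw [← Real.rpow_add hyp, sub_add_cancel]
          norm_cast
        have h5 : (y i t : ℝ) ^ (2 - q) ≤ (R : ℝ) ^ (2 - q) :=
          Real.rpow_le_rpow_of_nonpos hRp hRy' (by linarith)
        rw [mul_pow, h4, mul_assoc]
        gcongr
      · have : 0 ≤ V := (by positivity : 0 ≤ (y i t : ℝ) ^ q).trans hV
        rw [zero_pow two_ne_zero]
        positivity
    have h5 : v i t ^ 2 ≤ 2 * (δ ^ 2 * (1 + (y i t : ℝ) + m i t + x i t) ^ 2)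
        + 2 * (if R ≤ y i t then A * (y i t : ℝ) else 0) ^ 2 := by
      rw [← mul_pow]
      simp only [hv]
      nlinarith [sq_nonneg (δ * (1 + (y i t : ℝ) + m i t + x i t)
        - if R ≤ y i t then A * (y i t : ℝ) else 0)]
    have h6 := mul_le_mul_of_nonneg_left h2 (sq_nonneg δ)
    have h7 : 0 ≤ A ^ 2 * (R : ℝ) ^ (2 - q) * x i t ^ 2 := by positivity
    rw [hκ]
    linarith
  have hsum : ∀ i, ∑ t ∈ Finset.range (T + 1), (x i t - x' i t) ^ 2
      ≤ κ / (1 - b) ^ 2 * ∑ t ∈ Finset.range T,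
        (momentTerm G q (fun j => y j (t : ℤ)) i + x i t ^ 2) := by
    intro i
    have h1 := sum_sq_le_of_contraction (x := fun t => |x i t - x' i t|) hb0 hb
      (fun t => abs_nonneg _) (hrec i) T
    simp only [sq_abs] at h1
    have h0 : x i 0 - x' i 0 = 0 := sub_self _
    rw [h0, zero_pow two_ne_zero, zero_add, div_div, ← sq] at h1
    refine h1.trans ?_
    rw [div_mul_eq_mul_div]
    gcongr
    rw [Finset.mul_sum]
    exact Finset.sum_le_sum fun t _ => hv2 i t
  have hxs : ∑ i, ∑ t ∈ Finset.range T, x i t ^ 2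
      ≤ (c ^ 2 + 3 * A ^ 2 / (1 - b)) / (1 - b) * momentSum G q y T := by
    have h1 := sum_fittedIntensity_sq_le G (y := y) hb hq hν hνb (fun i => (hinit i).1) T
    have h2 : ∑ i, ∑ t ∈ Finset.range T, x i t ^ 2
        ≤ ∑ i, ∑ t ∈ Finset.range (T + 1), x i t ^ 2 :=
      Finset.sum_le_sum fun i _ => by
        rw [Finset.sum_range_succ]
        linarith [sq_nonneg (x i T)]
    have h3 : ∑ i, init i ^ 2 ≤ c ^ 2 * momentSum G q y T := by
      have h4 : ∑ i, init i ^ 2 ≤ N * c ^ 2 := by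
        simpa using Finset.sum_le_sum fun i (_ : i ∈ Finset.univ) =>
          pow_le_pow_left₀ (hinit i).1 (hinit i).2 2
      have h5 := mul_le_mul_of_nonneg_left (card_le_momentSum G (y := y) hq T) (sq_nonneg c)
      linarith
    refine h2.trans (h1.trans ?_)
    rw [div_mul_eq_mul_div (c ^ 2 + 3 * A ^ 2 / (1 - b)), add_mul]
    gcongr
  refine (Finset.sum_le_sum fun i _ => hsum i).trans ?_
  rw [← Finset.mul_sum]
  simp only [Finset.sum_add_distrib]
  have h8 := sum_range_momentTerm_le G (y := y) hq T
  calc _ ≤ κ / (1 - b) ^ 2 * (momentSum G q y T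
        + (c ^ 2 + 3 * A ^ 2 / (1 - b)) / (1 - b) * momentSum G q y T) := by gcongr
    _ = _ := by ring

/-- The same counts enter both recursions and cancel, so the discrepancy decays like powers of β and
its sum over time is bounded independently of T. -/
lemma sum_fittedIntensity_init_sub_sq_le {A b : ℝ} (hb : b < 1) {ν : Param}
    (hν : CoefBound A ν.1) (hνb : garchCoef ν.1 ≤ b) (init' : Fin N → ℝ) (T : ℕ) :
    ∑ i, ∑ t ∈ Finset.range (T + 1),
        (fittedIntensity G init y ν i t - fittedIntensity G init' y ν i t) ^ 2
      ≤ (∑ i, (init i - init' i) ^ 2) / (1 - b) := by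
  rw [Finset.sum_div]
  refine Finset.sum_le_sum fun i _ => ?_
  have h1 := sum_sq_le_of_contraction (v := fun _ => 0)
    (x := fun t => |fittedIntensity G init y ν i t - fittedIntensity G init' y ν i t|)
    ((hν 4).1.trans hνb) hb (fun t => abs_nonneg _) (fun t => ?_) T
  · simpa [fittedIntensity, sq_abs] using h1
  · have e : fittedIntensity G init y ν i (t + 1) - fittedIntensity G init' y ν i (t + 1)
        = ν.1 4 * (fittedIntensity G init y ν i t - fittedIntensity G init' y ν i t) := by
      simp only [fittedIntensity, nextIntensity_eq, garchCoef]
      ring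
    rw [e, abs_mul, abs_of_nonneg (hν 4).1, zero_add]
    exact mul_le_mul_of_nonneg_right hνb (abs_nonneg _)

lemma abs_logLikTerm_sub_le {w a b : ℝ} (hw : 0 < w) (ha : w ≤ a) (hb : w ≤ b) (k : ℕ) :
    |logLikTerm k a - logLikTerm k b| ≤ (k / w + 1) * |a - b| := by
  have key : ∀ {a b : ℝ}, w ≤ a → w ≤ b → Real.log a - Real.log b ≤ |a - b| / w := by
    intro a b ha hb
    have ha0 := hw.trans_le ha
    have hb0 := hw.trans_le hb
    rw [← Real.log_div ha0.ne' hb0.ne']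
    refine (Real.log_le_sub_one_of_pos (by positivity)).trans ?_
    calc a / b - 1 = (a - b) / b := by field_simp
      _ ≤ |a - b| / b := by gcongr; exact le_abs_self _
      _ ≤ |a - b| / w := by gcongr
  have h1 : |Real.log a - Real.log b| ≤ |a - b| / w :=
    abs_le'.2 ⟨key ha hb, by rw [neg_sub, abs_sub_comm]; exact key hb ha⟩
  have e : logLikTerm k a - logLikTerm k b
      = k * (Real.log a - Real.log b) - (a - b) := by unfold logLikTerm; ring
  rw [e]
  refine (abs_sub _ _).trans ?_
  rw [abs_mul, Nat.abs_cast]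
  have h2 := mul_le_mul_of_nonneg_left h1 (Nat.cast_nonneg (α := ℝ) k)
  calc _ ≤ k * (|a - b| / w) + |a - b| := by linarith
    _ = _ := by ring

lemma sum_Icc_eq_sum_range {M : Type*} [AddCommMonoid M] (f : ℕ → M) (T : ℕ) :
    ∑ t ∈ Finset.Icc 1 T, f t = ∑ t ∈ Finset.range T, f (t + 1) := by
  rw [Finset.range_eq_Ico, Finset.sum_Ico_add' f 0 T 1]
  rfl

/-- The log-likelihood sum is Lipschitz in the intensities, in the mean square sense. -/
lemma abs_sum_logLikTerm_sub_le {q w τ : ℝ} (hq : 2 ≤ q) (hw : 0 < w) (hτ : 0 < τ)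
    {a b : Fin N → ℕ → ℝ} (ha : ∀ i t, w ≤ a i (t + 1)) (hb : ∀ i t, w ≤ b i (t + 1)) (T : ℕ) :
    |∑ i, ∑ t ∈ Finset.Icc 1 T, logLikTerm (y i t) (a i t)
        - ∑ i, ∑ t ∈ Finset.Icc 1 T, logLikTerm (y i t) (b i t)|
      ≤ τ * (2 / w ^ 2 + 2) * momentSum G q y T
        + τ⁻¹ * ∑ i, ∑ t ∈ Finset.range (T + 1), (a i t - b i t) ^ 2 := by
  rw [← Finset.sum_sub_distrib]
  simp only [← Finset.sum_sub_distrib, sum_Icc_eq_sum_range]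
  have hterm : ∀ i (t : ℕ), |logLikTerm (y i ((t + 1 : ℕ) : ℤ)) (a i (t + 1))
      - logLikTerm (y i ((t + 1 : ℕ) : ℤ)) (b i (t + 1))|
      ≤ τ * (2 / w ^ 2 + 2) * momentTerm G q (fun j => y j ((t + 1 : ℕ) : ℤ)) i
        + τ⁻¹ * (a i (t + 1) - b i (t + 1)) ^ 2 := by
    intro i t
    refine (abs_logLikTerm_sub_le hw (ha i t) (hb i t) _).trans ?_
    set k : ℝ := (y i ((t + 1 : ℕ) : ℤ) : ℝ)
    have h1 := one_add_sq_add_sq_le_momentTerm G hq (fun j => y j ((t + 1 : ℕ) : ℤ)) i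
    set V := momentTerm G q (fun j => y j ((t + 1 : ℕ) : ℤ)) i
    set u := k / w + 1
    set d := a i (t + 1) - b i (t + 1)
    have h2 : u ^ 2 ≤ (2 / w ^ 2 + 2) * V := by
      have h3 : u ^ 2 ≤ 2 / w ^ 2 * k ^ 2 + 2 := by
        have : 2 / w ^ 2 * k ^ 2 = 2 * (k / w) ^ 2 := by field_simp
        rw [this]
        nlinarith [sq_nonneg (k / w - 1)]
      have h4 : k ^ 2 ≤ V := by nlinarith [sq_nonneg (netMean G (fun j => y j ((t + 1 : ℕ) : ℤ)) i)]
      have h5 : 1 ≤ V := one_le_momentTerm G hq _ i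
      have : 2 / w ^ 2 * k ^ 2 ≤ 2 / w ^ 2 * V := by gcongr
      linarith
    -- Young's inequality with a free weight: τ is fixed first to make the moment part small, and
    -- the discrepancy is then made small relative to τ.
    have h6 : u * |d| ≤ τ * u ^ 2 + τ⁻¹ * d ^ 2 := by
      have h7 : τ * u ^ 2 + τ⁻¹ * d ^ 2 - u * |d|
          = τ * (u - τ⁻¹ * |d| / 2) ^ 2 + 3 / 4 * τ⁻¹ * d ^ 2 := by
        rw [← sq_abs d]
        field_simp
        ring
      have h8 : 0 ≤ τ * (u - τ⁻¹ * |d| / 2) ^ 2 + 3 / 4 * τ⁻¹ * d ^ 2 := by positivity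
      linarith
    have h9 := mul_le_mul_of_nonneg_left h2 hτ.le
    linarith
  refine (Finset.abs_sum_le_sum_abs _ _).trans ?_
  refine (Finset.sum_le_sum fun i _ => (Finset.abs_sum_le_sum_abs _ _).trans
    (Finset.sum_le_sum fun t _ => hterm i t)).trans ?_
  simp only [momentSum, Finset.mul_sum, ← Finset.sum_add_distrib]
  refine Finset.sum_le_sum fun i _ => ?_
  rw [Finset.sum_range_succ' _ T]
  have h1 := one_le_momentTerm G hq (fun j => y j ((0 : ℕ) : ℤ)) i
  have : 0 ≤ τ * (2 / w ^ 2 + 2) * momentTerm G q (fun j => y j ((0 : ℕ) : ℤ)) i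
      + τ⁻¹ * (a i 0 - b i 0) ^ 2 := by positivity
  linarith

/-- By the Cauchy–Schwarz inequality, a small Hellinger distance makes intensities close in
mean. -/
lemma sq_sum_abs_sub_le {ι : Type*} (s : Finset ι) {a b : ι → ℝ} (ha : ∀ k, 0 ≤ a k)
    (hb : ∀ k, 0 ≤ b k) :
    (∑ k ∈ s, |a k - b k|) ^ 2
      ≤ (∑ k ∈ s, (√(a k) - √(b k)) ^ 2) * (2 * ∑ k ∈ s, (a k + b k)) := by
  rw [Finset.mul_sum]
  refine Finset.sum_sq_le_sum_mul_sum_of_sq_le_mul s (fun k _ => sq_nonneg _)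
    (fun k _ => by linarith [ha k, hb k]) (fun k _ => ?_)
  have h1 := Real.sq_sqrt (ha k)
  have h2 := Real.sq_sqrt (hb k)
  rw [sq_abs]
  nth_rw 1 [← h1, ← h2]
  rw [show √(a k) ^ 2 - √(b k) ^ 2 = (√(a k) - √(b k)) * (√(a k) + √(b k)) by ring, mul_pow]
  gcongr
  nlinarith [sq_nonneg (√(a k) - √(b k))]

/-- Intensities with `β` close to `1` grow until they exceed any given level. -/
lemma base_mul_min_le_fittedIntensity {A w : ℝ} {ν : Param} (hν : CoefBound A ν.1)
    (hw : 0 ≤ w) (hwν : w ≤ base ν.1) (hinit : ∀ i, 0 ≤ init i) {m : ℕ} (hm : 0 < m)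
    (hβ : 1 - 1 / (2 * m) ≤ garchCoef ν.1) (i : Fin N) (t : ℕ) :
    w * (min (t : ℝ) (m : ℝ) / 2) ≤ fittedIntensity G init y ν i t := by
  induction t with
  | zero => simpa [fittedIntensity] using hinit i
  | succ t ih =>
    rw [fittedIntensity, nextIntensity_eq]
    have h1 := regimeTerm_nonneg hν (y i t)
    have h2 := mul_nonneg (hν 3).1 (netMean_nonneg G (fun j => y j t) i)
    have hm' : (1 : ℝ) ≤ m := by exact_mod_cast hm
    set μ : ℝ := min (t : ℝ) m
    have hμ0 : 0 ≤ μ := le_min (Nat.cast_nonneg _) (Nat.cast_nonneg _)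
    have hμm : μ ≤ m := min_le_right _ _
    have hβ0 : (0 : ℝ) ≤ 1 - 1 / (2 * m) := by
      rw [sub_nonneg, div_le_one (by positivity)]
      linarith
    have h3 : (1 - 1 / (2 * m)) * (w * (μ / 2))
        ≤ garchCoef ν.1 * fittedIntensity G init y ν i t :=
      mul_le_mul hβ ih (by positivity) (hβ0.trans hβ)
    have h4 : min ((t + 1 : ℕ) : ℝ) m ≤ μ + 1 := by
      push_cast
      rw [← min_add_add_right]
      exact min_le_min le_rfl (by linarith)
    -- Since μ ≤ m, the factor β loses at most w/4 of the level wμ/2, while the base adds w. Hence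
    -- the level rises by at least w/2 per step until it reaches wm/2.
    have h5 : 1 / (2 * (m : ℝ)) * (μ / 2) ≤ 1 / 4 := by
      rw [div_mul_div_comm, div_le_div_iff₀ (by positivity) (by norm_num)]
      linarith
    have h6 : w * (min ((t + 1 : ℕ) : ℝ) m / 2) ≤ w * (1 + (1 - 1 / (2 * m)) * (μ / 2)) := by
      gcongr
      linarith
    unfold netCoef
    linarith

/-- From log l ≤ 2√l and 2k√l ≤ 2k² + l/2. The remaining -l/2 penalizes large intensities at a cost
quadratic in the count. -/
lemma logLikTerm_le {l : ℝ} (hl : 0 < l) (k : ℕ) : logLikTerm k l ≤ 2 * (k : ℝ) ^ 2 - l / 2 := by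
  have h1 : Real.log l ≤ 2 * √l := by
    have h := Real.log_le_sub_one_of_pos (Real.sqrt_pos.2 hl)
    rw [Real.log_sqrt hl.le] at h
    linarith
  have h2 := Real.sq_sqrt hl.le
  have h3 := mul_le_mul_of_nonneg_left h1 (Nat.cast_nonneg (α := ℝ) k)
  unfold logLikTerm
  nlinarith [sq_nonneg (2 * (k : ℝ) - √l)]

end Path

/-! ### Neighbourhoods -/

section Network

variable {N : ℕ} (G : SimpleGraph (Fin N))

open Classical in
lemma nodeDegree_eq_card (i : Fin N) :
    nodeDegree G i = ((Finset.univ.filter fun j => G.Adj i j).card : ℝ) := by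
  simp [nodeDegree, adjEntry]

/-- If the weights decay at least quadratically, the degrees are bounded. -/
lemma nodeDegree_le {C b : ℝ} (hb : 2 ≤ b) (i : Fin N)
    (h : ∀ j, i ≠ j → weight G i j ≤ C * |((j : ℕ) : ℝ) - ((i : ℕ) : ℝ)| ^ (-b)) :
    nodeDegree G i ≤ 4 * |C| + 2 := by
  classical
  set s := Finset.univ.filter fun j => G.Adj i j with hs
  rw [nodeDegree_eq_card]
  set d : ℝ := (s.card : ℝ) with hd
  have hd0 : 0 ≤ d := Nat.cast_nonneg _
  -- Each neighbour has weight exactly 1/d, so the decay of the weights reads |i - j|^b ≤ Cd; nodes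
  -- have integer distance at least 1, so b ≥ 2 can be replaced by 2.
  have hdist : ∀ j ∈ s, (((j : ℕ) : ℝ) - ((i : ℕ) : ℝ)) ^ 2 ≤ C * d := by
    intro j hj
    have hadj : G.Adj i j := by simpa [hs] using hj
    have h1 := h j hadj.ne
    have hdpos : 0 < d := by
      rw [hd]
      exact_mod_cast Finset.card_pos.2 ⟨j, hj⟩
    have hw : weight G i j = 1 / d := by
      simp [weight, adjEntry, hadj, nodeDegree_eq_card, hd, hs]
    have hge : 1 ≤ |((j : ℕ) : ℝ) - ((i : ℕ) : ℝ)| := by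
      have hne : ((j : ℕ) : ℤ) - ((i : ℕ) : ℤ) ≠ 0 := by
        intro h'
        exact hadj.ne (Fin.ext (by omega))
      have := Int.one_le_abs hne
      exact_mod_cast this
    set ρ := |((j : ℕ) : ℝ) - ((i : ℕ) : ℝ)| with hρ
    have hρ0 : 0 < ρ := by linarith
    rw [hw, Real.rpow_neg hρ0.le, ← div_eq_mul_inv, div_le_div_iff₀ hdpos (by positivity),
      one_mul] at h1
    rw [← sq_abs, ← hρ]
    refine le_trans ?_ h1
    rw [← Real.rpow_natCast]
    exact Real.rpow_le_rpow_of_exponent_le hge (by exact_mod_cast hb)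
  -- All neighbours lie in a window of radius m, so d ≤ 2m + 1 and (d - 1)² ≤ 4|C|d, which fails for
  -- d > 4|C| + 2.
  set m : ℕ := ⌊√(|C| * d)⌋₊ with hm
  have hmsq : (m : ℝ) ^ 2 ≤ |C| * d := by
    have h1 : (m : ℝ) ≤ √(|C| * d) := Nat.floor_le (Real.sqrt_nonneg _)
    calc (m : ℝ) ^ 2 ≤ √(|C| * d) ^ 2 := by gcongr
      _ = _ := Real.sq_sqrt (by positivity)
  have hcard : s.card ≤ 2 * m + 1 := by
    have h1 : (s.image fun j : Fin N => ((j : ℕ) : ℤ))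
        ⊆ Finset.Icc (((i : ℕ) : ℤ) - m) (((i : ℕ) : ℤ) + m) := by
      intro z hz
      obtain ⟨j, hj, rfl⟩ := Finset.mem_image.1 hz
      have h2 : |((j : ℕ) : ℝ) - ((i : ℕ) : ℝ)| ≤ √(|C| * d) := by
        apply Real.abs_le_sqrt
        exact (hdist j hj).trans (by gcongr; exact le_abs_self C)
      have h3 : (((j : ℕ) : ℤ) - ((i : ℕ) : ℤ)).natAbs ≤ m := by
        apply Nat.le_floor
        refine le_trans (le_of_eq ?_) h2
        rw [← Int.cast_natCast, Int.natCast_natAbs]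
        push_cast
        rfl
      rw [Finset.mem_Icc]
      omega
    have h2 := Finset.card_le_card h1
    rw [Finset.card_image_of_injective _ (fun a b hab => Fin.ext (by simpa using hab))] at h2
    rw [Int.card_Icc] at h2
    omega
  have hcard' : d ≤ 2 * m + 1 := by rw [hd]; exact_mod_cast hcard
  by_contra! hcon
  have h1 : 0 ≤ d - 1 := by linarith [abs_nonneg C]
  have h2 : (d - 1) ^ 2 ≤ (2 * (m : ℝ)) ^ 2 := pow_le_pow_left₀ h1 (by linarith) 2
  nlinarith [abs_nonneg C]

open Classical in
/-- The set of a node and its neighbours. -/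
noncomputable def closedNbhd (i : Fin N) : Finset (Fin N) :=
  Finset.univ.filter fun j => j = i ∨ G.Adj i j

lemma mem_closedNbhd {i j : Fin N} : j ∈ closedNbhd G i ↔ j = i ∨ G.Adj i j := by
  simp [closedNbhd]

lemma self_mem_closedNbhd (i : Fin N) : i ∈ closedNbhd G i := by
  simp [closedNbhd]

lemma card_closedNbhd_le (i : Fin N) : ((closedNbhd G i).card : ℝ) ≤ nodeDegree G i + 1 := by
  classical
  have h : closedNbhd G i ⊆ insert i (Finset.univ.filter fun j => G.Adj i j) := by
    intro j hj
    simpa [closedNbhd] using hj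
  rw [nodeDegree_eq_card]
  exact_mod_cast (Finset.card_le_card h).trans (Finset.card_insert_le _ _)

lemma nextIntensity_congr (ν : Param) (i : Fin N) {n n' : Fin N → ℕ}
    (h : ∀ j ∈ closedNbhd G i, n j = n' j) (l : ℝ) :
    nextIntensity G ν i n l = nextIntensity G ν i n' l := by
  have h1 : netMean G n i = netMean G n' i := by
    refine Finset.sum_congr rfl fun j _ => ?_
    by_cases hj : G.Adj i j
    · rw [h j ((mem_closedNbhd G).2 (Or.inr hj))]
    · simp [weight_eq_zero_of_not_adj G hj]
  rw [nextIntensity_eq, nextIntensity_eq, h1, h i (self_mem_closedNbhd G i)]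

lemma regimeTerm_zero (ν : Param) : regimeTerm ν 0 = 0 := by simp [regimeTerm]

lemma netMean_single (i j : Fin N) (k : ℕ) :
    netMean G (Pi.single j k) i = weight G i j * k := by
  rw [netMean, Finset.sum_eq_single j]
  · simp
  · intro l _ hl
    simp [hl]
  · simp

lemma nextIntensity_zero (ν : Param) (i : Fin N) (l : ℝ) :
    nextIntensity G ν i 0 l = base ν.1 + garchCoef ν.1 * l := by
  simp [nextIntensity_eq, regimeTerm_zero, netMean]

lemma nextIntensity_single_self (ν : Param) (i : Fin N) (k : ℕ) (l : ℝ) :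
    nextIntensity G ν i (Pi.single i k) l = base ν.1 + regimeTerm ν k + garchCoef ν.1 * l := by
  simp [nextIntensity_eq, netMean_single, weight_eq_zero_of_not_adj G (G.irrefl (v := i))]

lemma nextIntensity_single_of_adj (ν : Param) {i j : Fin N} (h : G.Adj i j) (k : ℕ) (l : ℝ) :
    nextIntensity G ν i (Pi.single j k) l
      = base ν.1 + netCoef ν.1 * (weight G i j * k) + garchCoef ν.1 * l := by
  simp [nextIntensity_eq, netMean_single, regimeTerm_zero, h.ne]

end Network

/-! ### Identification of the parameter -/

/-- The properties of the true parameter that the proof uses. -/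
structure IsRegular (A w : ℝ) (ν₀ : Param) : Prop where
  bound : CoefBound A ν₀.1
  pos : 0 < w
  le_base : w ≤ base ν₀.1
  alphaUp_pos : 0 < alphaUp ν₀.1
  alphaDown_pos : 0 < alphaDown ν₀.1
  garch_pos : 0 < garchCoef ν₀.1
  garch_lt : garchCoef ν₀.1 < 1
  threshold : 2 ≤ ν₀.2
  ne : alphaUp ν₀.1 ≠ alphaDown ν₀.1

/-- `ν` differs from `ν₀` in the threshold or by at least `ε` in some coefficient. -/
def IsFar (ε : ℝ) (ν₀ ν : Param) : Prop := ν.2 ≠ ν₀.2 ∨ ∃ k, ε ≤ |ν.1 k - ν₀.1 k|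

/-- The least identifiable difference of parameters at distance `ε`. -/
noncomputable def identGap (ε : ℝ) (ν₀ : Param) : ℝ :=
  min ε (|alphaUp ν₀.1 - alphaDown ν₀.1| / 2)

lemma identGap_pos {A w ε : ℝ} {ν₀ : Param} (h₀ : IsRegular A w ν₀) (hε : 0 < ε) :
    0 < identGap ε ν₀ :=
  lt_min hε (half_pos (abs_pos.2 (sub_ne_zero.2 h₀.ne)))

/-- With equal thresholds the slopes are read off at the counts r₀ and 1, and r₀ ≥ 2 puts 1 in the
lower regime. With different thresholds, two positive counts up to r₀ share a regime of ν but lie in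
different regimes of ν₀, and one slope cannot be within half of |α⁽¹⁾ - α⁽²⁾| of both true slopes.
-/
lemma IsFar.cases {A w ε : ℝ} {ν₀ ν : Param} (h₀ : IsRegular A w ν₀) (h : IsFar ε ν₀ ν) :
    (∃ k ≤ ν₀.2, identGap ε ν₀ ≤ |regimeTerm ν k - regimeTerm ν₀ k|)
      ∨ identGap ε ν₀ ≤ |netCoef ν.1 - netCoef ν₀.1|
      ∨ (identGap ε ν₀ ≤ |base ν.1 - base ν₀.1| ∨
          identGap ε ν₀ ≤ |garchCoef ν.1 - garchCoef ν₀.1|) := by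
  have hr := h₀.threshold
  set e := identGap ε ν₀ with he
  have heε : e ≤ ε := min_le_left _ _
  have heα : 2 * e ≤ |alphaUp ν₀.1 - alphaDown ν₀.1| := by
    have : e ≤ |alphaUp ν₀.1 - alphaDown ν₀.1| / 2 := min_le_right _ _
    linarith
  have hscale : ∀ (a b : ℝ) (k : ℕ), 1 ≤ k → |a - b| ≤ |a * k - b * k| := by
    intro a b k hk
    rw [← sub_mul, abs_mul, Nat.abs_cast]
    exact le_mul_of_one_le_right (abs_nonneg _) (by exact_mod_cast hk)
  by_cases hreq : ν.2 = ν₀.2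
  · obtain ⟨k, hk⟩ := h.resolve_left (fun h' => h' hreq)
    have hk' := heε.trans hk
    fin_cases k
    · exact Or.inr (Or.inr (Or.inl hk'))
    · refine Or.inl ⟨ν₀.2, le_rfl, hk'.trans ?_⟩
      have := hscale (alphaUp ν.1) (alphaUp ν₀.1) ν₀.2 (by omega)
      simpa [regimeTerm, hreq, alphaUp] using this
    · refine Or.inl ⟨1, by omega, hk'.trans ?_⟩
      have h1 : ¬ ν₀.2 ≤ 1 := by omega
      simp [regimeTerm, hreq, h1, alphaDown]
    · exact Or.inr (Or.inl hk')
    · exact Or.inr (Or.inr (Or.inr hk'))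
  · left
    by_contra! hcon
    -- a slope that fits neither of the two regimes
    have key : ∀ (a : ℝ) (k k' : ℕ), 1 ≤ k → k ≤ ν₀.2 → 1 ≤ k' → k' ≤ ν₀.2 →
        regimeTerm ν k = a * k → regimeTerm ν k' = a * k' →
        regimeTerm ν₀ k = alphaDown ν₀.1 * k → regimeTerm ν₀ k' = alphaUp ν₀.1 * k' → False := by
      intro a k k' h1 h2 h1' h2' e1 e2 e3 e4
      have c1 := hcon k h2
      have c2 := hcon k' h2'
      rw [e1, e3] at c1
      rw [e2, e4] at c2
      have c3 := (hscale _ _ k h1).trans_lt c1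
      have c4 := (hscale _ _ k' h1').trans_lt c2
      have c5 := abs_sub_le (alphaUp ν₀.1) a (alphaDown ν₀.1)
      rw [abs_sub_comm (alphaUp ν₀.1) a] at c5
      linarith
    rcases lt_or_gt_of_ne hreq with hlt | hgt
    -- The lower witness must be positive because the regime term vanishes at 0 whatever the slope;
    -- this matters when ν has threshold 0.
    · refine key (alphaUp ν.1) (max 1 ν.2) ν₀.2 (le_max_left _ _) (by omega) (by omega) le_rfl
        ?_ ?_ ?_ ?_
      · simp [regimeTerm]
      · simp [regimeTerm, hlt.le]
      · have : ¬ ν₀.2 ≤ max 1 ν.2 := by omega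
        simp [regimeTerm, this]
      · simp [regimeTerm]
    · refine key (alphaDown ν.1) 1 ν₀.2 le_rfl (by omega) (by omega) le_rfl ?_ ?_ ?_ ?_
      · have : ¬ ν.2 ≤ 1 := by omega
        simp [regimeTerm, this]
      · have : ¬ ν.2 ≤ ν₀.2 := by omega
        simp [regimeTerm, this]
      · have : ¬ ν₀.2 ≤ 1 := by omega
        simp [regimeTerm, this]
      · simp [regimeTerm]

/-! ### Configurations of counts that reveal a difference of parameters -/

section Gap

variable {N : ℕ} (G : SimpleGraph (Fin N))

/-- The difference of the right-hand sides of the intensity recursions for two parameters. -/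
noncomputable def recursionGap (ν₀ ν : Param) (i : Fin N) (n : Fin N → ℕ) (l : ℝ) : ℝ :=
  nextIntensity G ν i n l - nextIntensity G ν₀ i n l

lemma recursionGap_zero (ν₀ ν : Param) (i : Fin N) (l : ℝ) :
    recursionGap G ν₀ ν i 0 l
      = base ν.1 - base ν₀.1 + (garchCoef ν.1 - garchCoef ν₀.1) * l := by
  simp only [recursionGap, nextIntensity_zero]
  ring

lemma le_abs_or_le_abs_of_two_mul_le {a b s : ℝ} (h : 2 * s ≤ |b - a|) : s ≤ |a| ∨ s ≤ |b| := by
  by_contra! hcon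
  have := abs_sub b a
  linarith [hcon.1, hcon.2]

/-- The contribution Δω + Δβ l is common to both configurations and cancels in their difference.
What is left is the regime difference for a count at i, or Δξ divided by the degree for a count at a
neighbour. At least half of it is seen at one of the two, and j, k do not depend on l. -/
lemma exists_config_recursionGap_ge {e D : ℝ} {ν₀ ν : Param} (hr : 1 ≤ ν₀.2)
    (hD : ∀ i, 1 ≤ nodeDegree G i ∧ nodeDegree G i ≤ D)
    (h : (∃ k ≤ ν₀.2, e ≤ |regimeTerm ν k - regimeTerm ν₀ k|)
      ∨ e ≤ |netCoef ν.1 - netCoef ν₀.1|) (he : 0 ≤ e) (i : Fin N) :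
    ∃ j k, k ≤ ν₀.2 ∧ ∀ l, e / (2 * D) ≤ |recursionGap G ν₀ ν i 0 l|
      ∨ e / (2 * D) ≤ |recursionGap G ν₀ ν i (Pi.single j k) l| := by
  have hD1 : 1 ≤ D := (hD i).1.trans (hD i).2
  have e1 : 2 * (e / (2 * D)) = e / D := by field_simp
  rcases h with ⟨k, hk, h⟩ | h
  · refine ⟨i, k, hk, fun l => le_abs_or_le_abs_of_two_mul_le ?_⟩
    rw [recursionGap_zero, recursionGap, nextIntensity_single_self, nextIntensity_single_self, e1]
    refine (div_le_self he hD1).trans (h.trans (le_of_eq ?_))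
    congr 1
    ring
  · obtain ⟨j, hj⟩ : ∃ j, G.Adj i j := by
      by_contra! hcon
      have h1 := (hD i).1
      simp [nodeDegree, adjEntry, hcon] at h1
      linarith
    refine ⟨j, 1, hr, fun l => le_abs_or_le_abs_of_two_mul_le ?_⟩
    have hw : weight G i j = 1 / nodeDegree G i := by simp [weight, adjEntry, hj]
    rw [recursionGap_zero, recursionGap, nextIntensity_single_of_adj G _ hj,
      nextIntensity_single_of_adj G _ hj, e1, hw]
    have h2 : base ν.1 + netCoef ν.1 * (1 / nodeDegree G i * (1 : ℕ)) + garchCoef ν.1 * l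
        - (base ν₀.1 + netCoef ν₀.1 * (1 / nodeDegree G i * (1 : ℕ)) + garchCoef ν₀.1 * l)
        - (base ν.1 - base ν₀.1 + (garchCoef ν.1 - garchCoef ν₀.1) * l)
        = (netCoef ν.1 - netCoef ν₀.1) / nodeDegree G i := by
      push_cast
      ring
    have hpos : 0 < nodeDegree G i := by linarith [(hD i).1]
    rw [h2, abs_div, abs_of_pos hpos]
    exact div_le_div₀ (abs_nonneg _) h hpos (hD i).2

/-- The size of `Δω + Δβ λ` that one of two possible values `λ ≤ base + M` and
`λ + α⁽²⁾` yields. -/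
noncomputable def affineGap (e : ℝ) (ν₀ : Param) (M : ℝ) : ℝ :=
  e / (1 + 2 * (1 + base ν₀.1 + M) / alphaDown ν₀.1)

lemma affineGap_pos {A w e M : ℝ} {ν₀ : Param} (h₀ : IsRegular A w ν₀) (he : 0 < e)
    (hM : 0 ≤ M) : 0 < affineGap e ν₀ M := by
  have h1 := h₀.alphaDown_pos
  have h2 := h₀.pos.trans_le h₀.le_base
  unfold affineGap
  positivity

/-- A count 1 lies below the threshold, so the two possible next intensities differ by exactly α⁽²⁾.
An affine function small at two points of a bounded interval at this distance has a small slope,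
hence also a small constant term. -/
lemma affineGap_le_or {A w e M : ℝ} {ν₀ ν : Param} (h₀ : IsRegular A w ν₀) (he : 0 < e)
    (h : e ≤ |base ν.1 - base ν₀.1| ∨ e ≤ |garchCoef ν.1 - garchCoef ν₀.1|) (i : Fin N) {l : ℝ}
    (hl0 : 0 ≤ l) (hl : l ≤ M) :
    affineGap e ν₀ M ≤ |base ν.1 - base ν₀.1
        + (garchCoef ν.1 - garchCoef ν₀.1) * nextIntensity G ν₀ i 0 l|
      ∨ affineGap e ν₀ M ≤ |base ν.1 - base ν₀.1
        + (garchCoef ν.1 - garchCoef ν₀.1) * nextIntensity G ν₀ i (Pi.single i 1) l| := by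
  have hα := h₀.alphaDown_pos
  have hω := h₀.pos.trans_le h₀.le_base
  have hM : 0 ≤ M := hl0.trans hl
  have hs := affineGap_pos h₀ he hM
  have hes : e = affineGap e ν₀ M * (1 + 2 * (1 + base ν₀.1 + M) / alphaDown ν₀.1) := by
    unfold affineGap
    field_simp
  set s := affineGap e ν₀ M
  rw [nextIntensity_zero, nextIntensity_single_self]
  have hr : regimeTerm ν₀ 1 = alphaDown ν₀.1 := by
    have : ¬ ν₀.2 ≤ 1 := by have := h₀.threshold; omega
    simp [regimeTerm, this]
  rw [hr]
  set a := base ν.1 - base ν₀.1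
  set c := garchCoef ν.1 - garchCoef ν₀.1
  set x := base ν₀.1 + garchCoef ν₀.1 * l with hx
  have hx0 : 0 ≤ x := by have := h₀.garch_pos; positivity
  have hxM : x ≤ base ν₀.1 + M := by
    have : garchCoef ν₀.1 * l ≤ l := mul_le_of_le_one_left hl0 h₀.garch_lt.le
    linarith
  have e2 : base ν₀.1 + alphaDown ν₀.1 + garchCoef ν₀.1 * l = x + alphaDown ν₀.1 := by
    rw [hx]; ring
  rw [e2]
  by_contra! hcon
  obtain ⟨h1, h2⟩ := hcon
  have h3 : |c| * alphaDown ν₀.1 < 2 * s := by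
    have h4 := abs_sub (a + c * (x + alphaDown ν₀.1)) (a + c * x)
    rw [show a + c * (x + alphaDown ν₀.1) - (a + c * x) = c * alphaDown ν₀.1 by ring, abs_mul,
      abs_of_pos hα] at h4
    linarith
  have hc : |c| < 2 * s / alphaDown ν₀.1 := by rwa [lt_div_iff₀ hα]
  have ha : |a| < s + 2 * s / alphaDown ν₀.1 * (base ν₀.1 + M) := by
    have h4 := abs_sub (a + c * x) (c * x)
    rw [add_sub_cancel_right, abs_mul, abs_of_nonneg hx0] at h4
    have h5 : |c| * x ≤ 2 * s / alphaDown ν₀.1 * (base ν₀.1 + M) := by gcongr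
    linarith
  have he' : e = s + 2 * s / alphaDown ν₀.1 * (base ν₀.1 + M) + 2 * s / alphaDown ν₀.1 := by
    rw [hes]; ring
  have h6 : 0 ≤ 2 * s / alphaDown ν₀.1 * (base ν₀.1 + M) := by positivity
  have h7 : 0 < 2 * s / alphaDown ν₀.1 := by positivity
  rcases h with h | h <;> linarith

end Gap

/-! ### Frequencies of site properties -/

section Frequency

variable {N : ℕ}

open Classical in
/-- The number of sites `(i, t)`, `t < T`, with a property, divided by the number of nodes. -/
noncomputable def frequency (T : ℕ) (p : Fin N → ℕ → Prop) : ℝ :=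
  ∑ t ∈ Finset.range T, (1 / N * ∑ i, if p i t then (1 : ℝ) else 0)

lemma frequency_le_add {T : ℕ} {p p' p'' : Fin N → ℕ → Prop}
    (h : ∀ i t, p i t → p' i t ∨ p'' i t) :
    frequency T p ≤ frequency T p' + frequency T p'' := by
  unfold frequency
  rw [← Finset.sum_add_distrib]
  refine Finset.sum_le_sum fun t _ => ?_
  rw [← mul_add, ← Finset.sum_add_distrib]
  refine mul_le_mul_of_nonneg_left (Finset.sum_le_sum fun i _ => ?_) (by positivity)
  have := h i t
  by_cases h1 : p i t <;> by_cases h2 : p' i t <;> by_cases h3 : p'' i t <;> simp_all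

lemma frequency_true (hN : 0 < N) (T : ℕ) :
    frequency T (fun (_ : Fin N) _ => True) = T := by
  have : (N : ℝ) ≠ 0 := by positivity
  simp [frequency, this]

/-- Each single time contributes at most 1, so shifting the window by one step costs at most 1. -/
lemma frequency_succ_le (T : ℕ) (p : Fin N → ℕ → Prop) :
    frequency T (fun i t => p i (t + 1)) ≤ frequency T p + 1 := by
  classical
  set f : ℕ → ℝ := fun t => 1 / N * ∑ i, if p i t then (1 : ℝ) else 0 with hf
  have h0 : 0 ≤ f 0 := by
    refine mul_nonneg (by positivity) (Finset.sum_nonneg fun i _ => ?_)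
    split_ifs <;> norm_num
  have h1 : f T ≤ 1 := by
    have h2 : ∑ i, (if p i T then (1 : ℝ) else 0) ≤ N := by
      simpa using Finset.sum_le_sum fun i (_ : i ∈ Finset.univ) =>
        (by split_ifs <;> norm_num : (if p i T then (1 : ℝ) else 0) ≤ 1)
    rcases Nat.eq_zero_or_pos N with rfl | hN
    · simp [hf]
    · simp only [hf]
      rw [one_div, inv_mul_le_iff₀ (by positivity)]
      linarith
  have h2 : ∑ t ∈ Finset.range T, f (t + 1) ≤ ∑ t ∈ Finset.range T, f t + 1 := by
    have h3 := Finset.sum_range_succ f T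
    rw [Finset.sum_range_succ'] at h3
    linarith
  have e1 : frequency T (fun i t => p i (t + 1)) = ∑ t ∈ Finset.range T, f (t + 1) := by
    simp only [frequency, hf]
  have e2 : frequency T p = ∑ t ∈ Finset.range T, f t := by
    simp only [frequency, hf]
  rw [e1, e2]
  exact h2

/-- Markov's inequality for frequencies. -/
lemma frequency_lt_le {l : Fin N → ℕ → ℝ} (hN : 0 < N) (hl : ∀ i t, 0 ≤ l i t) {T : ℕ} {B K : ℝ}
    (hK : 0 < K) (h : ∑ i, ∑ t ∈ Finset.Icc 1 T, l i t ≤ B * (N * T)) :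
    frequency (T - 1) (fun i t => K < l i (t + 1)) ≤ B / K * T := by
  classical
  have hN' : (0 : ℝ) < N := by exact_mod_cast hN
  have h1 : K * (N * frequency (T - 1) (fun i t => K < l i (t + 1))) ≤ B * (N * T) := by
    refine le_trans ?_ h
    unfold frequency
    rw [Finset.mul_sum, Finset.mul_sum, Finset.sum_comm]
    simp only [sum_Icc_eq_sum_range]
    refine (Finset.sum_le_sum (g := fun t => ∑ i, l i (t + 1)) fun t _ => ?_).trans
      (Finset.sum_le_sum_of_subset_of_nonneg (Finset.range_mono (Nat.sub_le T 1))
        fun t _ _ => Finset.sum_nonneg fun i _ => hl i (t + 1))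
    rw [one_div, mul_inv_cancel_left₀ hN'.ne', Finset.mul_sum]
    refine Finset.sum_le_sum fun i _ => ?_
    split_ifs with h2
    · linarith
    · simpa using hl i (t + 1)
  have e : B / K * T = (B * (N * T)) / (K * N) := by field_simp
  rw [e, le_div_iff₀ (by positivity)]
  linarith

end Frequency

/-! ### The frequency of separated sites -/

section Separation

variable {Ω : Type*} [mΩ : MeasurableSpace Ω] {P : Measure Ω} [IsProbabilityMeasure P] {N : ℕ}
  {G : SimpleGraph (Fin N)} {ν₀ : Param} {ℋ : Filtration ℤ mΩ}
  {y : Fin N → ℤ → Ω → ℕ} {lam : Fin N → ℤ → Ω → ℝ}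

omit [IsProbabilityMeasure P] in
lemma IsModel.ae_recursion (h : IsModel P G ν₀ ℋ y lam) : ∀ᵐ ω ∂P, ∀ i t,
    lam i t ω = nextIntensity G ν₀ i (fun j => y j (t - 1) ω) (lam i (t - 1) ω) := by
  rw [ae_all_iff]
  intro i
  rw [ae_all_iff]
  exact h.recursion i

lemma le_nextIntensity {A w : ℝ} (h₀ : IsRegular A w ν₀) (i : Fin N) (n : Fin N → ℕ) {l : ℝ}
    (hl : 0 ≤ l) : w ≤ nextIntensity G ν₀ i n l := by
  rw [nextIntensity_eq]
  have h1 := regimeTerm_nonneg h₀.bound (n i)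
  have h2 := mul_nonneg (h₀.bound 3).1 (netMean_nonneg G n i)
  have h3 := mul_nonneg (h₀.bound 4).1 hl
  have h4 := h₀.le_base
  unfold netCoef garchCoef
  linarith

omit [IsProbabilityMeasure P] in
lemma IsModel.ae_le_intensity {A w : ℝ} (h : IsModel P G ν₀ ℋ y lam) (h₀ : IsRegular A w ν₀) :
    ∀ᵐ ω ∂P, ∀ i t, w ≤ lam i t ω := by
  filter_upwards [h.ae_recursion] with ω hω i t
  rw [hω i t]
  exact le_nextIntensity h₀ i _ (h.nonneg i _ ω)

/-- The total intensity on a closed neighbourhood. -/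
noncomputable def load (G : SimpleGraph (Fin N)) (lam : Fin N → ℤ → Ω → ℝ) (i : Fin N) (t : ℤ)
    (ω : Ω) : ℝ := ∑ j ∈ closedNbhd G i, lam j t ω

/-- The event that the loads are at most `B` on average over the nodes and the times
`1, …, T`. -/
def loadEvent (G : SimpleGraph (Fin N)) (lam : Fin N → ℤ → Ω → ℝ) (B : ℝ) (T : ℕ) : Set Ω :=
  {ω | ∑ i, ∑ t ∈ Finset.Icc 1 T, load G lam i (t : ℤ) ω ≤ B * (N * T)}

lemma natCast_succ_sub_one (t : ℕ) : ((t + 1 : ℕ) : ℤ) - 1 = t := by push_cast; ring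

omit [IsProbabilityMeasure P] in
lemma IsModel.measurable_intensity_succ (h : IsModel P G ν₀ ℋ y lam) (i : Fin N) (t : ℕ) :
    Measurable[ℋ (t : ℤ)] (lam i ((t + 1 : ℕ) : ℤ)) := by
  have := h.predictable i ((t + 1 : ℕ) : ℤ)
  rwa [natCast_succ_sub_one] at this

omit [IsProbabilityMeasure P] in
lemma IsModel.measurableSet_load (h : IsModel P G ν₀ ℋ y lam) (w K : ℝ) (i : Fin N) (t : ℕ) :
    MeasurableSet[ℋ (t : ℤ)] {ω | (∀ j, w ≤ lam j ((t + 1 : ℕ) : ℤ) ω)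
      ∧ load G lam i ((t + 1 : ℕ) : ℤ) ω ≤ K} := by
  refine MeasurableSet.inter (s₁ := {ω | ∀ j, w ≤ lam j ((t + 1 : ℕ) : ℤ) ω})
    (s₂ := {ω | load G lam i ((t + 1 : ℕ) : ℤ) ω ≤ K}) ?_ ?_
  · rw [Set.ofPred_forall]
    exact MeasurableSet.iInter fun j => h.measurable_intensity_succ j t measurableSet_Ici
  · exact (Finset.measurable_sum _ fun j _ => h.measurable_intensity_succ j t) measurableSet_Iic

omit mΩ in
lemma measurable_eval_counts {m : MeasurableSpace Ω} {n : Fin N → Ω → ℕ}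
    (hn : ∀ i, Measurable[m] (n i)) {F : (Fin N → ℕ) → Ω → ℝ} (hF : ∀ k, Measurable[m] (F k)) :
    Measurable[m] fun ω => F (fun i => n i ω) ω :=
  measurable_from_prod_countable_right (f := fun z : (Fin N → ℕ) × Ω => F z.1 z.2) hF
    |>.comp ((measurable_pi_lambda _ hn).prodMk measurable_id)

omit mΩ in
lemma measurable_nextIntensity {m : MeasurableSpace Ω} (ν : Param) (i : Fin N) (n : Fin N → ℕ)
    {l : Ω → ℝ} (hl : Measurable[m] l) :
    Measurable[m] fun ω => nextIntensity G ν i n (l ω) := by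
  unfold nextIntensity
  exact (hl.const_mul _).const_add _

/-- A functional of the counts that is large for one of two configurations at the sites of a
predictable set `A` is large with at least a fixed frequency. -/
lemma IsModel.prob_frequency_large_le (h : IsModel P G ν₀ ℋ y lam) {F : Fin N → (Fin N → ℕ) → ℝ → ℝ}
    (hFm : ∀ i n, Measurable (F i n))
    (hFloc : ∀ i n n', (∀ j ∈ closedNbhd G i, n j = n' j) → F i n = F i n')
    {A : Fin N → ℕ → Set Ω} (hA : ∀ i t, MeasurableSet[ℋ ((t : ℕ) : ℤ)] (A i t)) {w K s : ℝ}
    (hw : 0 < w) (hK : 0 ≤ K) {r : ℕ}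
    (hcase : ∀ i, ∃ j k, k ≤ r ∧ ∀ t, ∀ ω ∈ A i t,
      (s ≤ |F i 0 (lam i ((t + 1 : ℕ) : ℤ) ω)|
        ∨ s ≤ |F i (Pi.single j k) (lam i ((t + 1 : ℕ) : ℤ) ω)|))
    (T : ℕ) (x : ℝ) :
    P {ω | frequency T (fun i t => s ≤ |F i (fun j => y j ((t + 1 : ℕ) : ℤ) ω)
          (lam i ((t + 1 : ℕ) : ℤ) ω)|)
        ≤ configProb w K r / 2 * frequency T (fun i t => ω ∈ A i t
          ∧ (∀ j, w ≤ lam j ((t + 1 : ℕ) : ℤ) ω) ∧ load G lam i ((t + 1 : ℕ) : ℤ) ω ≤ K) - x}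
      ≤ ENNReal.ofReal (Real.exp (-x)) := by
  have hmono : ∀ t : ℕ, ℋ (t : ℤ) ≤ ℋ ((t + 1 : ℕ) : ℤ) := fun t => ℋ.mono (by simp)
  have hA' : ∀ i t, MeasurableSet[natFiltration ℋ t] (A i t ∩
      {ω | (∀ j, w ≤ lam j ((t + 1 : ℕ) : ℤ) ω) ∧ load G lam i ((t + 1 : ℕ) : ℤ) ω ≤ K}) :=
    fun i t => (hA i t).inter (h.measurableSet_load w K i t)
  refine prob_frequency_le (F := natFiltration ℋ)
    (E := fun i t => {ω | s ≤ |F i (fun j => y j ((t + 1 : ℕ) : ℤ) ω)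
      (lam i ((t + 1 : ℕ) : ℤ) ω)|}) (fun i t => ?_) hA'
    ⟨(configProb_pos hw K r).le, configProb_le_one hw hK r⟩ (fun i t W hW => ?_) T x
  · have h1 : Measurable[ℋ ((t + 1 : ℕ) : ℤ)] fun ω =>
        F i (fun j => y j ((t + 1 : ℕ) : ℤ) ω) (lam i ((t + 1 : ℕ) : ℤ) ω) :=
      measurable_eval_counts (F := fun n ω => F i n (lam i ((t + 1 : ℕ) : ℤ) ω))
        (fun j => h.adapted j _) fun n =>
          (hFm i n).comp ((h.measurable_intensity_succ i t).mono (hmono t) le_rfl)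
    exact h1 (measurableSet_le measurable_const measurable_id.abs)
  · obtain ⟨j, k, hk, hjk⟩ := hcase i
    refine h.lintegral_large_ge ((t + 1 : ℕ) : ℤ) (B := closedNbhd G i)
      (F := fun n ω => F i n (lam i ((t + 1 : ℕ) : ℤ) ω)) (j := j) (k := k) (fun n => ?_)
      (fun n n' hn => ?_) ?_ hw hk (fun ω hω => ?_) ?_
    · rw [natCast_succ_sub_one]
      exact (hFm i n).comp (h.measurable_intensity_succ i t)
    · simp only [hFloc i n n' hn]
    · rw [natCast_succ_sub_one]
      exact hA' i t
    · exact ⟨hω.2.1, hω.2.2, hjk t ω hω.1⟩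
    · rw [natCast_succ_sub_one]
      exact hW

omit [IsProbabilityMeasure P] in
lemma IsModel.load_nonneg (h : IsModel P G ν₀ ℋ y lam) (i : Fin N) (t : ℤ) (ω : Ω) :
    0 ≤ load G lam i t ω := Finset.sum_nonneg fun j _ => h.nonneg j t ω

omit [IsProbabilityMeasure P] in
lemma IsModel.intensity_le_load (h : IsModel P G ν₀ ℋ y lam) (i : Fin N) (t : ℤ) (ω : Ω) :
    lam i t ω ≤ load G lam i t ω :=
  Finset.single_le_sum (f := fun j => lam j t ω) (fun j _ => h.nonneg j t ω)
    (self_mem_closedNbhd G i)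

omit [IsProbabilityMeasure P] in
/-- On `loadEvent`, few sites have a large load. -/
lemma IsModel.frequency_le_of_loadEvent (h : IsModel P G ν₀ ℋ y lam) (hN : 0 < N) {B K w : ℝ}
    (hK : 0 < K) {T : ℕ} {ω : Ω} (hω : ω ∈ loadEvent G lam B T) (hw : ∀ i t, w ≤ lam i t ω)
    (p : Fin N → ℕ → Prop) :
    frequency (T - 1) p - B / K * T ≤ frequency (T - 1) (fun i t => p i t
      ∧ (∀ j, w ≤ lam j ((t + 1 : ℕ) : ℤ) ω) ∧ load G lam i ((t + 1 : ℕ) : ℤ) ω ≤ K) := by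
  have h1 := frequency_lt_le (l := fun i t => load G lam i (t : ℤ) ω) hN
    (fun i t => h.load_nonneg i t ω) hK hω
  have h2 : frequency (T - 1) p ≤ _ := frequency_le_add (p := p)
    (p' := fun i t => p i t ∧ (∀ j, w ≤ lam j ((t + 1 : ℕ) : ℤ) ω)
      ∧ load G lam i ((t + 1 : ℕ) : ℤ) ω ≤ K)
    (p'' := fun i t => K < load G lam i ((t + 1 : ℕ) : ℤ) ω) fun i t hp => by
      rcases le_or_gt (load G lam i ((t + 1 : ℕ) : ℤ) ω) K with h3 | h3
      · exact Or.inl ⟨hp, fun j => hw j _, h3⟩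
      · exact Or.inr h3
  linarith

/-- At most sites of bounded load, the functional is separated. -/
lemma IsModel.prob_frequency_large_le_of_forall (h : IsModel P G ν₀ ℋ y lam) (hN : 0 < N)
    {A w : ℝ} (h₀ : IsRegular A w ν₀) {F : Fin N → (Fin N → ℕ) → ℝ → ℝ}
    (hFm : ∀ i n, Measurable (F i n))
    (hFloc : ∀ i n n', (∀ j ∈ closedNbhd G i, n j = n' j) → F i n = F i n') {B s : ℝ} (hB : 0 < B)
    (hcase : ∀ i, ∃ j k, k ≤ ν₀.2 ∧ ∀ l, 0 ≤ l → l ≤ 4 * B →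
      (s ≤ |F i 0 l| ∨ s ≤ |F i (Pi.single j k) l|))
    {T : ℕ} (hT : 4 ≤ T) :
    P {ω | ω ∈ loadEvent G lam B T ∧ frequency (T - 1) (fun i t =>
          s ≤ |F i (fun j => y j ((t + 1 : ℕ) : ℤ) ω) (lam i ((t + 1 : ℕ) : ℤ) ω)|)
        ≤ configProb w (4 * B) ν₀.2 / 8 * T}
      ≤ ENNReal.ofReal (Real.exp (-(configProb w (4 * B) ν₀.2 / 8 * T))) := by
  have hq := configProb_pos h₀.pos (4 * B) ν₀.2
  set q := configProb w (4 * B) ν₀.2 with hqdef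
  have hmeasA : ∀ (i : Fin N) (t : ℕ), MeasurableSet[ℋ ((t : ℕ) : ℤ)]
      {ω | lam i ((t + 1 : ℕ) : ℤ) ω ≤ 4 * B} := fun i t =>
    h.measurable_intensity_succ i t measurableSet_Iic
  -- The deviation qT/8 is half of the mean bound (q/2)(T/2) obtained below.
  have key := h.prob_frequency_large_le hFm hFloc hmeasA h₀.pos (by positivity : 0 ≤ 4 * B)
    (s := s) (r := ν₀.2) (fun i => by
      obtain ⟨j, k, hk, hjk⟩ := hcase i
      exact ⟨j, k, hk, fun t ω hω => hjk _ (h.nonneg _ _ _) hω⟩) (T - 1) (q / 8 * T)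
  rw [← hqdef] at key
  refine (measure_mono_ae ?_).trans key
  filter_upwards [h.ae_le_intensity h₀] with ω hω hmem
  obtain ⟨h1, h2⟩ := hmem
  refine h2.trans ?_
  -- At most T/4 of the frequency is lost to loads above 4B, and T - 1 ≥ 3T/4 for T ≥ 4, so at least
  -- T/2 remains.
  have h3 := h.frequency_le_of_loadEvent hN (K := 4 * B) (by positivity) h1 hω (fun _ _ => True)
  rw [frequency_true hN] at h3
  have h4 : B / (4 * B) = 1 / 4 := by field_simp
  rw [h4] at h3
  have h5 : ((T - 1 : ℕ) : ℝ) ≥ 3 / 4 * T := by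
    rw [Nat.cast_sub (by omega)]
    have : (4 : ℝ) ≤ T := by exact_mod_cast hT
    push_cast
    linarith
  have h6 : frequency (T - 1) (fun i t => True ∧ (∀ j, w ≤ lam j ((t + 1 : ℕ) : ℤ) ω)
      ∧ load G lam i ((t + 1 : ℕ) : ℤ) ω ≤ 4 * B)
      ≤ frequency (T - 1) (fun i t => ω ∈ {ω | lam i ((t + 1 : ℕ) : ℤ) ω ≤ 4 * B}
      ∧ (∀ j, w ≤ lam j ((t + 1 : ℕ) : ℤ) ω) ∧ load G lam i ((t + 1 : ℕ) : ℤ) ω ≤ 4 * B) := by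
    refine (frequency_le_add (p' := fun i t => ω ∈ {ω | lam i ((t + 1 : ℕ) : ℤ) ω ≤ 4 * B}
      ∧ (∀ j, w ≤ lam j ((t + 1 : ℕ) : ℤ) ω) ∧ load G lam i ((t + 1 : ℕ) : ℤ) ω ≤ 4 * B)
      (p'' := fun _ _ => False) fun i t ht => Or.inl
      ⟨(h.intensity_le_load i _ ω).trans ht.2.2, ht.2⟩).trans (le_of_eq ?_)
    simp [frequency]
  have h7 : 1 / 2 * (T : ℝ) ≤ frequency (T - 1) (fun i t =>
      ω ∈ {ω | lam i ((t + 1 : ℕ) : ℤ) ω ≤ 4 * B}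
      ∧ (∀ j, w ≤ lam j ((t + 1 : ℕ) : ℤ) ω) ∧ load G lam i ((t + 1 : ℕ) : ℤ) ω ≤ 4 * B) := by
    linarith
  have h8 := mul_le_mul_of_nonneg_left h7 (by positivity : 0 ≤ q / 2)
  simp only [Set.mem_ofPred_eq] at h8 ⊢
  linarith

lemma measurable_nextIntensity_right (ν : Param) (i : Fin N) (n : Fin N → ℕ) :
    Measurable (nextIntensity G ν i n) :=
  measurable_nextIntensity (l := fun x => x) ν i n measurable_id

lemma measurable_recursionGap (ν : Param) (i : Fin N) (n : Fin N → ℕ) :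
    Measurable (recursionGap G ν₀ ν i n) :=
  (measurable_nextIntensity_right ν i n).sub (measurable_nextIntensity_right ν₀ i n)

lemma recursionGap_congr (ν : Param) (i : Fin N) {n n' : Fin N → ℕ}
    (h : ∀ j ∈ closedNbhd G i, n j = n' j) : recursionGap G ν₀ ν i n = recursionGap G ν₀ ν i n' := by
  ext l
  rw [recursionGap, recursionGap, nextIntensity_congr G ν i h, nextIntensity_congr G ν₀ i h]

/-- The event that few sites separate the parameter `ν` from the true one. -/
def gapEvent (G : SimpleGraph (Fin N)) (y : Fin N → ℤ → Ω → ℕ) (lam : Fin N → ℤ → Ω → ℝ)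
    (ν₀ ν : Param) (s f : ℝ) (T : ℕ) : Set Ω :=
  {ω | frequency (T - 1) (fun i t => s ≤ |recursionGap G ν₀ ν i
    (fun j => y j ((t + 1 : ℕ) : ℤ) ω) (lam i ((t + 1 : ℕ) : ℤ) ω)|) ≤ f * T}

/-- Separation of parameters that differ in the threshold, the slopes or the network effect. -/
lemma IsModel.prob_gapEvent_le_of_config (h : IsModel P G ν₀ ℋ y lam) (hN : 0 < N)
    {A w D B e : ℝ} (h₀ : IsRegular A w ν₀) (hD : ∀ i, 1 ≤ nodeDegree G i ∧ nodeDegree G i ≤ D)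
    (hB : 0 < B) (he : 0 ≤ e) {ν : Param}
    (hν : (∃ k ≤ ν₀.2, e ≤ |regimeTerm ν k - regimeTerm ν₀ k|)
      ∨ e ≤ |netCoef ν.1 - netCoef ν₀.1|) {T : ℕ} (hT : 4 ≤ T) :
    P (loadEvent G lam B T ∩ gapEvent G y lam ν₀ ν (e / (2 * D)) (configProb w (4 * B) ν₀.2 / 8) T)
      ≤ ENNReal.ofReal (Real.exp (-(configProb w (4 * B) ν₀.2 / 8 * T))) :=
  h.prob_frequency_large_le_of_forall hN h₀ (F := recursionGap G ν₀ ν)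
    (measurable_recursionGap ν) (fun i n n' hn => recursionGap_congr ν i hn) hB
    (fun i => by
      obtain ⟨j, k, hk, hjk⟩ := exists_config_recursionGap_ge G
        (by have := h₀.threshold; omega) hD hν he i
      exact ⟨j, k, hk, fun l _ _ => hjk l⟩) hT

/-- Separation of parameters that differ in the base or the autoregressive coefficient. -/
lemma IsModel.prob_gapEvent_le_of_affine (h : IsModel P G ν₀ ℋ y lam) (hN : 0 < N)
    {A w B e : ℝ} (h₀ : IsRegular A w ν₀) (hB : 0 < B) (he : 0 < e) {ν : Param}
    (hν : e ≤ |base ν.1 - base ν₀.1| ∨ e ≤ |garchCoef ν.1 - garchCoef ν₀.1|)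
    {q₁ q₂ : ℝ} (hq₁ : q₁ = configProb w (4 * B) ν₀.2)
    (hq₂ : q₂ = configProb w (32 * B / q₁) ν₀.2) {T : ℕ} (hT : 4 ≤ T) (hT' : 16 / q₁ ≤ T) :
    P (loadEvent G lam B T ∩ gapEvent G y lam ν₀ ν (affineGap e ν₀ (4 * B)) (q₁ * q₂ / 128) T)
      ≤ ENNReal.ofReal (Real.exp (-(q₁ / 8 * T)))
        + ENNReal.ofReal (Real.exp (-(q₁ * q₂ / 128 * T))) := by
  have hq₁0 : 0 < q₁ := hq₁ ▸ configProb_pos h₀.pos _ _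
  have hq₂0 : 0 < q₂ := hq₂ ▸ configProb_pos h₀.pos _ _
  set s := affineGap e ν₀ (4 * B)
  set a := base ν.1 - base ν₀.1
  set c := garchCoef ν.1 - garchCoef ν₀.1
  -- First of the two times: the functional is Δω + Δβ times the next intensity, so its being large
  -- is a predictable event one step later.
  have k1 := h.prob_frequency_large_le_of_forall hN h₀
    (F := fun i n l => a + c * nextIntensity G ν₀ i n l) (s := s)
    (fun i n => ((measurable_nextIntensity_right ν₀ i n).const_mul c).const_add a)
    (fun i n n' hn => by ext l; rw [nextIntensity_congr G ν₀ i hn]) hB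
    (fun i => ⟨i, 1, by have := h₀.threshold; omega, fun l hl0 hl =>
      affineGap_le_or G h₀ he hν i hl0 hl⟩) hT
  have hmeasA : ∀ (i : Fin N) (t : ℕ), MeasurableSet[ℋ ((t : ℕ) : ℤ)]
      {ω | s ≤ |a + c * lam i ((t + 1 : ℕ) : ℤ) ω|} := fun i t =>
    (((h.measurable_intensity_succ i t).const_mul c).const_add a)
      (measurableSet_le measurable_const measurable_id.abs)
  -- Second time: on the predictable event just produced, the zero configuration makes the gap equal
  -- to Δω + Δβ λ.
  have k2 := h.prob_frequency_large_le (measurable_recursionGap ν)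
    (fun i n n' hn => recursionGap_congr ν i hn) hmeasA h₀.pos
    (by positivity : 0 ≤ 32 * B / q₁) (s := s) (r := ν₀.2)
    (fun i => ⟨i, 0, Nat.zero_le _, fun t ω hω => Or.inl (by rw [recursionGap_zero]; exact hω)⟩)
    (T - 1) (q₁ * q₂ / 128 * T)
  rw [← hq₁] at k1
  rw [← hq₂] at k2
  refine le_trans (measure_mono_ae ?_) ((measure_union_le _ _).trans (add_le_add k1 k2))
  filter_upwards [h.ae_le_intensity h₀, h.ae_recursion] with ω hω hrec hmem
  obtain ⟨h1, h2⟩ := hmem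
  by_contra hcon
  have hcon1 := fun hh => hcon (Or.inl hh)
  have hcon2 := fun hh => hcon (Or.inr hh)
  have h3 : q₁ / 8 * T < frequency (T - 1) (fun i t =>
      s ≤ |a + c * lam i ((t + 1 + 1 : ℕ) : ℤ) ω|) := by
    by_contra! h4
    refine hcon1 ⟨h1, ?_⟩
    have e : ∀ i (t : ℕ), lam i ((t + 1 + 1 : ℕ) : ℤ) ω = nextIntensity G ν₀ i
        (fun j => y j ((t + 1 : ℕ) : ℤ) ω) (lam i ((t + 1 : ℕ) : ℤ) ω) := fun i t => by
      rw [hrec i ((t + 1 + 1 : ℕ) : ℤ), natCast_succ_sub_one]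
    simp only [e] at h4
    exact h4
  have h5 := frequency_succ_le (T - 1) fun i t => s ≤ |a + c * lam i ((t + 1 : ℕ) : ℤ) ω|
  -- The level 32B/q₁ limits the loss to q₁T/32. The time shift costs at most 1 ≤ q₁T/16, so of the
  -- frequency q₁T/8 at least q₁T/32 survives.
  have h6 := h.frequency_le_of_loadEvent hN (K := 32 * B / q₁) (by positivity) h1 hω
    (fun i t => s ≤ |a + c * lam i ((t + 1 : ℕ) : ℤ) ω|)
  have h7 : B / (32 * B / q₁) = q₁ / 32 := by field_simp
  rw [h7] at h6
  have h8 : 1 ≤ q₁ / 16 * T := by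
    rw [div_le_iff₀ hq₁0] at hT'
    linarith
  refine hcon2 ?_
  have h9 : q₁ / 32 * T ≤ frequency (T - 1) (fun i t =>
      ω ∈ {ω | s ≤ |a + c * lam i ((t + 1 : ℕ) : ℤ) ω|}
      ∧ (∀ j, w ≤ lam j ((t + 1 : ℕ) : ℤ) ω) ∧ load G lam i ((t + 1 : ℕ) : ℤ) ω ≤ 32 * B / q₁) := by
    refine le_trans ?_ h6
    linarith
  have h10 := mul_le_mul_of_nonneg_left h9 (by positivity : 0 ≤ q₂ / 2)
  simp only [gapEvent, Set.mem_ofPred_eq] at h2 h10 ⊢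
  linarith

end Separation

/-! ### From frequent gaps to a large Hellinger distance -/

section Frequency

variable {N : ℕ}

lemma frequency_mono {T : ℕ} {p p' : Fin N → ℕ → Prop} (h : ∀ i t, p i t → p' i t) :
    frequency T p ≤ frequency T p' := by
  refine (frequency_le_add (p'' := fun _ _ => False) fun i t hp => Or.inl (h i t hp)).trans
    (le_of_eq ?_)
  simp [frequency]

lemma mul_frequency_le_sum (hN : 0 < N) (T : ℕ) {s : ℝ} (g : Fin N → ℕ → ℝ) :
    s * (N * frequency T fun i t => s ≤ |g i t|) ≤ ∑ i, ∑ t ∈ Finset.range T, |g i t| := by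
  classical
  have hN' : (0 : ℝ) < N := by exact_mod_cast hN
  unfold frequency
  rw [Finset.mul_sum, Finset.mul_sum, Finset.sum_comm (s := Finset.univ)]
  refine Finset.sum_le_sum fun t _ => ?_
  rw [one_div, mul_inv_cancel_left₀ hN'.ne', Finset.mul_sum]
  refine Finset.sum_le_sum fun i _ => ?_
  split_ifs with h
  · simpa using h
  · simp

/-- If the intensities `x` and `l` are separated at many sites, their Hellinger distance is
large. -/
lemma le_sum_sqrt_sub_sq_of_frequency (hN : 0 < N) {T : ℕ} (hT : 0 < T) {x l : Fin N → ℕ → ℝ}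
    (hx : ∀ i t, 0 ≤ x i t) (hl : ∀ i t, 0 ≤ l i t) {β s f C : ℝ} (hβ0 : 0 ≤ β) (hβ : β ≤ 1)
    (hs : 0 < s) (hf : 0 < f) (hC : 0 < C)
    (hfreq : f * T ≤ frequency (T - 1) fun i t =>
      s ≤ |x i (t + 2) - l i (t + 2) - β * (x i (t + 1) - l i (t + 1))|)
    (hsum : ∑ i, ∑ t ∈ Finset.Icc 1 T, (x i t + l i t) ≤ C * (N * T)) :
    (s * f) ^ 2 / (8 * C) * (N * T) ≤ ∑ i, ∑ t ∈ Finset.Icc 1 T, (√(x i t) - √(l i t)) ^ 2 := by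
  have hN' : (0 : ℝ) < N := by exact_mod_cast hN
  have hT' : (0 : ℝ) < T := by exact_mod_cast hT
  set X : Fin N → ℕ → ℝ := fun i t => |x i t - l i t| with hX
  -- Every gap is at most the sum of two consecutive discrepancies, since β ≤ 1, and each
  -- discrepancy occurs in at most two gaps. The frequency runs to T - 1 so that the index t + 2
  -- stays within 1, …, T.
  have h1 : s * f * (N * T) ≤ 2 * ∑ i, ∑ t ∈ Finset.Icc 1 T, X i t := by
    have h2 := mul_frequency_le_sum hN (T - 1) (s := s)
      fun i t => x i (t + 2) - l i (t + 2) - β * (x i (t + 1) - l i (t + 1))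
    have h3 : s * f * (N * T) ≤ s * (N * frequency (T - 1) fun i t =>
        s ≤ |x i (t + 2) - l i (t + 2) - β * (x i (t + 1) - l i (t + 1))|) := by
      have := mul_le_mul_of_nonneg_left hfreq (by positivity : 0 ≤ s * N)
      linarith
    refine h3.trans (h2.trans ?_)
    rw [Finset.mul_sum]
    refine Finset.sum_le_sum fun i _ => ?_
    rw [sum_Icc_eq_sum_range]
    obtain ⟨n, rfl⟩ : ∃ n, T = n + 1 := ⟨T - 1, by omega⟩
    rw [Nat.add_sub_cancel, two_mul]
    have h4 : ∑ t ∈ Finset.range n, X i (t + 2) ≤ ∑ t ∈ Finset.range (n + 1), X i (t + 1) := by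
      rw [Finset.sum_range_succ']
      have : 0 ≤ X i (0 + 1) := abs_nonneg _
      linarith
    have h5 : ∑ t ∈ Finset.range n, X i (t + 1) ≤ ∑ t ∈ Finset.range (n + 1), X i (t + 1) := by
      rw [Finset.sum_range_succ]
      have : 0 ≤ X i (n + 1) := abs_nonneg _
      linarith
    refine le_trans ?_ (add_le_add h4 h5)
    rw [← Finset.sum_add_distrib]
    refine Finset.sum_le_sum fun t _ => (abs_sub _ _).trans (add_le_add le_rfl ?_)
    rw [abs_mul, abs_of_nonneg hβ0]
    exact mul_le_of_le_one_left (abs_nonneg _) hβ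
  have h2 := sq_sum_abs_sub_le (Finset.univ ×ˢ Finset.Icc 1 T) (a := fun z : Fin N × ℕ => x z.1 z.2)
    (b := fun z => l z.1 z.2) (fun z => hx _ _) (fun z => hl _ _)
  simp only [Finset.sum_product] at h2
  set H := ∑ i, ∑ t ∈ Finset.Icc 1 T, (√(x i t) - √(l i t)) ^ 2
  have hH : 0 ≤ H := Finset.sum_nonneg fun i _ => Finset.sum_nonneg fun t _ => sq_nonneg _
  have h3 : (s * f * (N * T)) ^ 2 ≤ 4 * (H * (2 * (C * (N * T)))) := by
    calc (s * f * (N * T)) ^ 2 ≤ (2 * ∑ i, ∑ t ∈ Finset.Icc 1 T, X i t) ^ 2 :=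
          pow_le_pow_left₀ (by positivity) h1 2
      _ = 4 * (∑ i, ∑ t ∈ Finset.Icc 1 T, X i t) ^ 2 := by ring
      _ ≤ _ := by
          refine mul_le_mul_of_nonneg_left (h2.trans ?_) (by norm_num)
          gcongr
  rw [div_mul_eq_mul_div, div_le_iff₀ (by positivity)]
  have h4 : 0 < (N : ℝ) * T := by positivity
  refine le_of_mul_le_mul_right ?_ h4
  calc (s * f) ^ 2 * (N * T) * (N * T) = (s * f * (N * T)) ^ 2 := by ring
    _ ≤ _ := h3
    _ = _ := by ring

end Frequency

/-! ### Separation of all distant parameters -/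

lemma gapEvent_subset {Ω : Type*} {N : ℕ} (G : SimpleGraph (Fin N)) (y : Fin N → ℤ → Ω → ℕ)
    (lam : Fin N → ℤ → Ω → ℝ) (ν₀ ν : Param) {s s' f f' : ℝ} (hs : s ≤ s') (hf : f ≤ f') (T : ℕ) :
    gapEvent G y lam ν₀ ν s f T ⊆ gapEvent G y lam ν₀ ν s' f' T := by
  intro ω hω
  simp only [gapEvent, Set.mem_ofPred_eq] at hω ⊢
  refine (frequency_mono fun i t h => hs.trans h).trans (hω.trans ?_)
  gcongr

/-- Every parameter at distance `ε` from the true one is separated from it at a positive frequency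
of sites, uniformly over all networks. -/
lemma exists_prob_gapEvent_le {A w D B ε : ℝ} {ν₀ : Param} (h₀ : IsRegular A w ν₀)
    (hB : 0 < B) (hD0 : 0 < D) (hε : 0 < ε) :
    ∃ s f : ℝ, 0 < s ∧ 0 < f ∧ ∃ T₀ : ℕ,
      ∀ {Ω : Type*} [mΩ : MeasurableSpace Ω] {P : Measure Ω} [IsProbabilityMeasure P] {N : ℕ}
        {G : SimpleGraph (Fin N)} {ℋ : Filtration ℤ mΩ}
        {y : Fin N → ℤ → Ω → ℕ} {lam : Fin N → ℤ → Ω → ℝ},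
        IsModel P G ν₀ ℋ y lam → 0 < N → (∀ i, 1 ≤ nodeDegree G i ∧ nodeDegree G i ≤ D) →
        ∀ ν, IsFar ε ν₀ ν → ∀ T : ℕ, T₀ ≤ T →
          P (loadEvent G lam B T ∩ gapEvent G y lam ν₀ ν s f T)
            ≤ 2 * ENNReal.ofReal (Real.exp (-(f * T))) := by
  have he := identGap_pos h₀ hε
  set e := identGap ε ν₀
  have hq₁ := configProb_pos h₀.pos (4 * B) ν₀.2
  set q₁ := configProb w (4 * B) ν₀.2 with hq₁'
  have hq₂ := configProb_pos h₀.pos (32 * B / q₁) ν₀.2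
  have hq₂1 := configProb_le_one h₀.pos (by positivity : 0 ≤ 32 * B / q₁) ν₀.2
  set q₂ := configProb w (32 * B / q₁) ν₀.2 with hq₂'
  have haff := affineGap_pos h₀ he (by positivity : 0 ≤ 4 * B)
  have hf : q₁ * q₂ / 128 ≤ q₁ / 8 := by nlinarith
  refine ⟨min (e / (2 * D)) (affineGap e ν₀ (4 * B)), q₁ * q₂ / 128,
    lt_min (by positivity) haff, by positivity, max 4 ⌈16 / q₁⌉₊, ?_⟩
  intro Ω mΩ P _ N G ℋ y lam h hN hD ν hν T hT
  have hT4 : 4 ≤ T := (le_max_left _ _).trans hT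
  have hTq : 16 / q₁ ≤ T := (Nat.le_ceil _).trans (by exact_mod_cast (le_max_right _ _).trans hT)
  have hexp : ENNReal.ofReal (Real.exp (-(q₁ / 8 * T)))
      ≤ ENNReal.ofReal (Real.exp (-(q₁ * q₂ / 128 * T))) := by
    gcongr
  have hcases : ((∃ k ≤ ν₀.2, e ≤ |regimeTerm ν k - regimeTerm ν₀ k|)
      ∨ e ≤ |netCoef ν.1 - netCoef ν₀.1|) ∨ (e ≤ |base ν.1 - base ν₀.1| ∨
          e ≤ |garchCoef ν.1 - garchCoef ν₀.1|) := by
    rw [or_assoc]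
    exact hν.cases h₀
  rcases hcases with hc | hc
  · have k := h.prob_gapEvent_le_of_config hN h₀ hD hB he.le hc hT4
    refine (measure_mono (Set.inter_subset_inter_right _
      (gapEvent_subset G y lam ν₀ ν (min_le_left _ _) hf T))).trans (k.trans (hexp.trans ?_))
    rw [two_mul]
    exact le_self_add
  · have k := h.prob_gapEvent_le_of_affine hN h₀ hB he hc hq₁' hq₂' hT4 hTq
    refine (measure_mono (Set.inter_subset_inter_right _
      (gapEvent_subset G y lam ν₀ ν (min_le_right _ _) le_rfl T))).trans (k.trans ?_)
    rw [two_mul]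
    exact add_le_add hexp le_rfl

/-! ### Likelihoods along well-behaved paths -/

section Path

variable {N : ℕ} (G : SimpleGraph (Fin N))

/-- The log-likelihood sum of an array of intensities. -/
noncomputable def logLikSum (T : ℕ) (y : Fin N → ℤ → ℕ) (x : Fin N → ℕ → ℝ) : ℝ :=
  ∑ i, ∑ t ∈ Finset.Icc 1 T, logLikTerm (y i (t : ℤ)) (x i t)

lemma logLik_eq (init : Fin N → ℝ) (T : ℕ) (y : Fin N → ℤ → ℕ) (ν : Param) :
    logLik G init T y ν
      = 1 / ((N : ℝ) * T) * logLikSum T y (fittedIntensity G init y ν) := rfl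

/-- A bound for the mean of fitted intensities with mean square initial value `u`. -/
noncomputable def intensityBound (A b u B : ℝ) : ℝ :=
  1 + (u + 3 * A ^ 2 / (1 - b) * B) / (1 - b)

lemma sum_fittedIntensity_le {A b q u B : ℝ} (hb : b < 1) (hq : 2 ≤ q) {ν : Param}
    (hν : CoefBound A ν.1) (hνb : garchCoef ν.1 ≤ b) {init : Fin N → ℝ} (hinit : ∀ i, 0 ≤ init i)
    {y : Fin N → ℤ → ℕ} {T : ℕ} (hu : ∑ i, init i ^ 2 ≤ u * (N * T))
    (hB : momentSum G q y T ≤ B * (N * T)) :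
    ∑ i, ∑ t ∈ Finset.Icc 1 T, fittedIntensity G init y ν i t
      ≤ intensityBound A b u B * (N * T) := by
  have h1b : 0 < 1 - b := by linarith
  have h1 := sum_fittedIntensity_sq_le G (y := y) hb hq hν hνb hinit T
  have h2 : ∑ i, ∑ t ∈ Finset.Icc 1 T, fittedIntensity G init y ν i t
      ≤ N * T + ∑ i, ∑ t ∈ Finset.range (T + 1), fittedIntensity G init y ν i t ^ 2 := by
    have h3 : ∀ i, ∑ t ∈ Finset.Icc 1 T, fittedIntensity G init y ν i t
        ≤ T + ∑ t ∈ Finset.range (T + 1), fittedIntensity G init y ν i t ^ 2 := by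
      intro i
      rw [sum_Icc_eq_sum_range, Finset.sum_range_succ']
      have h4 : ∑ t ∈ Finset.range T, fittedIntensity G init y ν i (t + 1)
          ≤ ∑ t ∈ Finset.range T, (1 + fittedIntensity G init y ν i (t + 1) ^ 2) :=
        Finset.sum_le_sum fun t _ => by
          nlinarith [sq_nonneg (fittedIntensity G init y ν i (t + 1) - 1),
            sq_nonneg (fittedIntensity G init y ν i (t + 1))]
      rw [Finset.sum_add_distrib] at h4
      simp only [Finset.sum_const, Finset.card_range, nsmul_eq_mul, mul_one] at h4
      linarith [sq_nonneg (fittedIntensity G init y ν i 0)]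
    have h5 := Finset.sum_le_sum fun i (_ : i ∈ Finset.univ) => h3 i
    rw [Finset.sum_add_distrib] at h5
    simpa using h5
  have h6 : (∑ i, init i ^ 2 + 3 * A ^ 2 / (1 - b) * momentSum G q y T) / (1 - b)
      ≤ (u * (N * T) + 3 * A ^ 2 / (1 - b) * (B * (N * T))) / (1 - b) := by gcongr
  refine h2.trans ((add_le_add le_rfl (h1.trans h6)).trans (le_of_eq ?_))
  unfold intensityBound
  ring

lemma sum_init_sq_le {c : ℝ} {init : Fin N → ℝ} (hinit : ∀ i, init i ∈ Set.Icc 0 c) {T : ℕ}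
    (hT : 0 < T) : ∑ i, init i ^ 2 ≤ c ^ 2 * (N * T) := by
  have h4 : ∑ i, init i ^ 2 ≤ N * c ^ 2 := by
    simpa using Finset.sum_le_sum fun i (_ : i ∈ Finset.univ) =>
      pow_le_pow_left₀ (hinit i).1 (hinit i).2 2
  have h5 : (1 : ℝ) ≤ T := by exact_mod_cast hT
  have h6 := mul_le_mul_of_nonneg_left h5 (by positivity : 0 ≤ c ^ 2 * N)
  linarith

/-- The log-likelihood of the true parameter is bounded below. -/
lemma neg_le_logLikSum {A b q B c w : ℝ} (hb : b < 1) (hq : 2 ≤ q) (hw : 0 < w) {ν : Param}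
    (hν : CoefBound A ν.1) (hνb : garchCoef ν.1 ≤ b) (hwν : w ≤ base ν.1) {init : Fin N → ℝ}
    (hinit : ∀ i, init i ∈ Set.Icc 0 c) {y : Fin N → ℤ → ℕ} {T : ℕ} (hT : 0 < T)
    (hB : momentSum G q y T ≤ B * (N * T)) :
    -((|Real.log w| * B + intensityBound A b (c ^ 2) B) * (N * T))
      ≤ logLikSum T y (fittedIntensity G init y ν) := by
  have h1 := sum_fittedIntensity_le G hb hq hν hνb (fun i => (hinit i).1)
    (sum_init_sq_le hinit hT) hB
  have h2 : ∀ i (t : ℕ), -(|Real.log w| * momentTerm G q (fun j => y j ((t + 1 : ℕ) : ℤ)) i)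
      - fittedIntensity G init y ν i (t + 1)
      ≤ logLikTerm (y i ((t + 1 : ℕ) : ℤ)) (fittedIntensity G init y ν i (t + 1)) := by
    intro i t
    have h3 := hwν.trans (base_le_fittedIntensity_succ G (y := y) hν (fun i => (hinit i).1) i t)
    have h4 : -|Real.log w| ≤ Real.log (fittedIntensity G init y ν i (t + 1)) :=
      (neg_abs_le _).trans (Real.log_le_log hw h3)
    have h5 := one_add_sq_add_sq_le_momentTerm G hq (fun j => y j ((t + 1 : ℕ) : ℤ)) i
    have h6 : (y i ((t + 1 : ℕ) : ℤ) : ℝ) ≤ momentTerm G q (fun j => y j ((t + 1 : ℕ) : ℤ)) i := by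
      nlinarith [sq_nonneg (netMean G (fun j => y j ((t + 1 : ℕ) : ℤ)) i),
        sq_nonneg ((y i ((t + 1 : ℕ) : ℤ) : ℝ) - 1)]
    have h7 := mul_le_mul_of_nonneg_left h4 (Nat.cast_nonneg (α := ℝ) (y i ((t + 1 : ℕ) : ℤ)))
    have h8 := mul_le_mul_of_nonneg_left h6 (abs_nonneg (Real.log w))
    unfold logLikTerm
    linarith
  have h3 : -(|Real.log w| * momentSum G q y T)
      - ∑ i, ∑ t ∈ Finset.Icc 1 T, fittedIntensity G init y ν i t
      ≤ logLikSum T y (fittedIntensity G init y ν) := by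
    unfold logLikSum momentSum
    rw [Finset.mul_sum, ← Finset.sum_neg_distrib, ← Finset.sum_sub_distrib]
    refine Finset.sum_le_sum fun i _ => ?_
    simp only [sum_Icc_eq_sum_range]
    rw [Finset.sum_range_succ', mul_add, Finset.mul_sum, neg_add, ← Finset.sum_neg_distrib]
    have h4 := Finset.sum_le_sum fun t (_ : t ∈ Finset.range T) => h2 i t
    rw [Finset.sum_sub_distrib] at h4
    have h5 : 0 ≤ |Real.log w| * momentTerm G q (fun j => y j ((0 : ℕ) : ℤ)) i :=
      mul_nonneg (abs_nonneg _) (zero_le_one.trans (one_le_momentTerm G hq _ i))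
    linarith
  have h4 := mul_le_mul_of_nonneg_left hB (abs_nonneg (Real.log w))
  linarith

/-- The log-likelihood of parameters with large `β` is very negative. -/
lemma logLikSum_le_of_garchCoef_large {A q B w : ℝ} (hq : 2 ≤ q) (hw : 0 < w) {ν : Param}
    (hν : CoefBound A ν.1) (hwν : w ≤ base ν.1) {init : Fin N → ℝ} (hinit : ∀ i, 0 ≤ init i)
    {m : ℕ} (hm : 0 < m) (hβ : 1 - 1 / (2 * m) ≤ garchCoef ν.1) {y : Fin N → ℤ → ℕ} {T : ℕ}
    (hT : 2 * m ≤ T) (hB : momentSum G q y T ≤ B * (N * T)) :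
    logLikSum T y (fittedIntensity G init y ν) ≤ (2 * B - w * m / 8) * (N * T) := by
  have h1 : ∀ i (t : ℕ), logLikTerm (y i ((t + 1 : ℕ) : ℤ)) (fittedIntensity G init y ν i (t + 1))
      ≤ 2 * momentTerm G q (fun j => y j ((t + 1 : ℕ) : ℤ)) i
        - w * (min ((t + 1 : ℕ) : ℝ) m / 2) / 2 := by
    intro i t
    have h3 := hwν.trans (base_le_fittedIntensity_succ G (y := y) hν hinit i t)
    have h4 := base_mul_min_le_fittedIntensity G (y := y) hν hw.le hwν hinit hm hβ i (t + 1)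
    have h5 := one_add_sq_add_sq_le_momentTerm G hq (fun j => y j ((t + 1 : ℕ) : ℤ)) i
    have h6 := logLikTerm_le (hw.trans_le h3) (y i ((t + 1 : ℕ) : ℤ))
    nlinarith [sq_nonneg (netMean G (fun j => y j ((t + 1 : ℕ) : ℤ)) i)]
  -- As T ≥ 2m, at least half of the times lie beyond the initial growth phase, where the minimum
  -- equals m.
  have h2 : (m : ℝ) * T / 2 ≤ ∑ t ∈ Finset.range T, min ((t + 1 : ℕ) : ℝ) m := by
    have h3 : ∑ t ∈ Finset.Ico m T, (m : ℝ) ≤ ∑ t ∈ Finset.range T, min ((t + 1 : ℕ) : ℝ) m := by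
      rw [Finset.range_eq_Ico]
      refine (Finset.sum_le_sum fun t ht => ?_).trans (Finset.sum_le_sum_of_subset_of_nonneg
        (Finset.Ico_subset_Ico_left (Nat.zero_le m)) fun t _ _ => by positivity)
      refine le_min ?_ le_rfl
      have := (Finset.mem_Ico.1 ht).1
      exact_mod_cast this.trans t.le_succ
    rw [Finset.sum_const, Nat.card_Ico, nsmul_eq_mul, Nat.cast_sub (by omega)] at h3
    have h4 : (2 : ℝ) * m ≤ T := by exact_mod_cast hT
    have h5 : 0 ≤ (T - 2 * m : ℝ) * m := mul_nonneg (by linarith) (Nat.cast_nonneg _)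
    linarith
  have h3 : logLikSum T y (fittedIntensity G init y ν)
      ≤ 2 * momentSum G q y T - w * m / 8 * (N * T) := by
    have h4 : ∀ i, ∑ t ∈ Finset.Icc 1 T, logLikTerm (y i (t : ℤ)) (fittedIntensity G init y ν i t)
        ≤ 2 * ∑ t ∈ Finset.range (T + 1), momentTerm G q (fun j => y j (t : ℤ)) i
          - w * m / 8 * T := by
      intro i
      rw [sum_Icc_eq_sum_range, Finset.sum_range_succ']
      refine (Finset.sum_le_sum fun t _ => h1 i t).trans ?_
      rw [Finset.sum_sub_distrib, ← Finset.mul_sum]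
      have h5 : ∑ t ∈ Finset.range T, w * (min ((t + 1 : ℕ) : ℝ) m / 2) / 2
          = w / 4 * ∑ t ∈ Finset.range T, min ((t + 1 : ℕ) : ℝ) m := by
        rw [Finset.mul_sum]
        exact Finset.sum_congr rfl fun t _ => by ring
      have h6 := mul_le_mul_of_nonneg_left h2 (by positivity : 0 ≤ w / 4)
      have h7 := one_le_momentTerm G hq (fun j => y j ((0 : ℕ) : ℤ)) i
      rw [h5]
      linear_combination h6 + 2 * h7
    have h5 := Finset.sum_le_sum fun i (_ : i ∈ Finset.univ) => h4 i
    rw [Finset.sum_sub_distrib, ← Finset.mul_sum] at h5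
    simp only [Finset.sum_const, Finset.card_univ, Fintype.card_fin, nsmul_eq_mul] at h5
    unfold logLikSum momentSum
    linarith
  linarith

end Path

/-! ### Moment bounds -/

section Moments

variable {Ω : Type*} [mΩ : MeasurableSpace Ω] {P : Measure Ω} {N : ℕ}
  {G : SimpleGraph (Fin N)} {ν₀ : Param} {ℋ : Filtration ℤ mΩ}
  {y : Fin N → ℤ → Ω → ℕ} {lam : Fin N → ℤ → Ω → ℝ}

lemma measure_lt_le_of_lintegral_le {f : Ω → ℝ} (hf : Measurable f) {C L B : ℝ}
    (hL : 0 < L) (hB : 0 < B) (h : ∫⁻ ω, ENNReal.ofReal (f ω) ∂P ≤ ENNReal.ofReal (C * L)) :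
    P {ω | B * L < f ω} ≤ ENNReal.ofReal (C / B) := by
  have h1 : P {ω | B * L < f ω} ≤ P {ω | ENNReal.ofReal (B * L) ≤ ENNReal.ofReal (f ω)} :=
    measure_mono fun ω hω => ENNReal.ofReal_le_ofReal (le_of_lt hω)
  have h2 := meas_ge_le_lintegral_div (μ := P) (f := fun ω => ENNReal.ofReal (f ω))
    (ENNReal.measurable_ofReal.comp hf).aemeasurable (ε := ENNReal.ofReal (B * L))
    (by simpa using mul_pos hB hL) ENNReal.ofReal_ne_top
  refine h1.trans (h2.trans ((ENNReal.div_le_div_right h _).trans (le_of_eq ?_)))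
  rw [← ENNReal.ofReal_div_of_pos (mul_pos hB hL)]
  congr 1
  field_simp

lemma ofReal_natCast_rpow (k : ℕ) {q : ℝ} (hq : 0 ≤ q) :
    ENNReal.ofReal ((k : ℝ) ^ q) = (k : ℝ≥0∞) ^ q := by
  rw [← ENNReal.ofReal_rpow_of_nonneg (Nat.cast_nonneg k) hq, ENNReal.ofReal_natCast]

lemma natCast_rpow_mono (k : ℕ) {q q' : ℝ} (hq : 0 < q) (h : q ≤ q') :
    (k : ℝ≥0∞) ^ q ≤ (k : ℝ≥0∞) ^ q' := by
  rcases Nat.eq_zero_or_pos k with rfl | hk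
  · simp [ENNReal.zero_rpow_of_pos hq]
  · exact ENNReal.rpow_le_rpow_of_exponent_le (by exact_mod_cast hk) h

variable [IsProbabilityMeasure P]

lemma IsModel.lintegral_ofReal_rpow_le (h : IsModel P G ν₀ ℋ y lam) (i : Fin N) (t : ℤ) {q q' M : ℝ}
    (hq : 1 ≤ q) (hq' : q ≤ q') (hM : ∫⁻ ω, (y i t ω : ℝ≥0∞) ^ q' ∂P ≤ ENNReal.ofReal M) :
    ∫⁻ ω, ENNReal.ofReal (lam i t ω ^ q) ∂P ≤ ENNReal.ofReal M := by
  simp only [← ENNReal.ofReal_rpow_of_nonneg (h.nonneg i t _) (by linarith : 0 ≤ q)]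
  refine (h.lintegral_rpow_le i t hq).trans (le_trans (lintegral_mono fun ω => ?_) hM)
  exact natCast_rpow_mono _ (by linarith) hq'

/-- All terms of the recursion are nonnegative, so each one is bounded by the sum. With positive
slopes and positive β this controls the count and the intensity at time 0, where no moments are
assumed, by the intensity at time 1. -/
lemma IsRegular.mul_le_nextIntensity {A w : ℝ} (h₀ : IsRegular A w ν₀) (i : Fin N) (n : Fin N → ℕ)
    {l : ℝ} (hl : 0 ≤ l) :
    min (alphaUp ν₀.1) (alphaDown ν₀.1) * n i ≤ nextIntensity G ν₀ i n l
      ∧ garchCoef ν₀.1 * l ≤ nextIntensity G ν₀ i n l := by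
  rw [nextIntensity_eq]
  have h1 : min (alphaUp ν₀.1) (alphaDown ν₀.1) * n i ≤ regimeTerm ν₀ (n i) := by
    unfold regimeTerm
    split_ifs
    · exact mul_le_mul_of_nonneg_right (min_le_left _ _) (Nat.cast_nonneg _)
    · exact mul_le_mul_of_nonneg_right (min_le_right _ _) (Nat.cast_nonneg _)
  have h2 := mul_nonneg (h₀.bound 3).1 (netMean_nonneg G n i)
  have h3 := mul_nonneg h₀.garch_pos.le hl
  have h4 := h₀.pos.trans_le h₀.le_base
  have h5 := regimeTerm_nonneg h₀.bound (n i)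
  unfold netCoef
  constructor <;> linarith

/-- The moments at time `0` are bounded by those at time `1`. -/
lemma IsModel.lintegral_count_zero_le (h : IsModel P G ν₀ ℋ y lam) {A w : ℝ}
    (h₀ : IsRegular A w ν₀) (i : Fin N) {q M : ℝ} (hq : 1 ≤ q)
    (hM : ∫⁻ ω, (y i 1 ω : ℝ≥0∞) ^ q ∂P ≤ ENNReal.ofReal M) :
    ∫⁻ ω, (y i 0 ω : ℝ≥0∞) ^ q ∂P
      ≤ ENNReal.ofReal ((min (alphaUp ν₀.1) (alphaDown ν₀.1))⁻¹ ^ q * M) := by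
  have ha : 0 < min (alphaUp ν₀.1) (alphaDown ν₀.1) := lt_min h₀.alphaUp_pos h₀.alphaDown_pos
  set a := min (alphaUp ν₀.1) (alphaDown ν₀.1) with hadef
  have h1 : ∀ᵐ ω ∂P, (y i 0 ω : ℝ≥0∞) ^ q
      ≤ ENNReal.ofReal (a⁻¹ ^ q) * ENNReal.ofReal (lam i 1 ω ^ q) := by
    filter_upwards [h.recursion i 1] with ω hω
    have h2 := (h₀.mul_le_nextIntensity (G := G) i (fun j => y j (1 - 1) ω) (h.nonneg i (1 - 1) ω)).1
    rw [← hω, sub_self, ← hadef] at h2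
    rw [← ofReal_natCast_rpow _ (by linarith), ← ENNReal.ofReal_mul (by positivity),
      ← Real.mul_rpow (by positivity) (h.nonneg i 1 ω)]
    refine ENNReal.ofReal_le_ofReal (Real.rpow_le_rpow (by positivity) ?_ (by linarith))
    rw [inv_mul_eq_div, le_div_iff₀ ha]
    linarith
  refine (lintegral_mono_ae h1).trans ?_
  rw [lintegral_const_mul _ ((h.measurable_intensity i 1).pow_const q).ennreal_ofReal, ENNReal.ofReal_mul (by positivity)]
  exact mul_le_mul_right (h.lintegral_ofReal_rpow_le i 1 hq le_rfl hM) _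

lemma IsModel.lintegral_intensity_zero_sq_le (h : IsModel P G ν₀ ℋ y lam) {A w : ℝ}
    (h₀ : IsRegular A w ν₀) (i : Fin N) {q M : ℝ} (hq : 2 ≤ q)
    (hM : ∫⁻ ω, (y i 1 ω : ℝ≥0∞) ^ q ∂P ≤ ENNReal.ofReal M) :
    ∫⁻ ω, ENNReal.ofReal (lam i 0 ω ^ 2) ∂P
      ≤ ENNReal.ofReal ((garchCoef ν₀.1)⁻¹ ^ 2 * M) := by
  have ha := h₀.garch_pos
  have h1 : ∀ᵐ ω ∂P, ENNReal.ofReal (lam i 0 ω ^ 2)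
      ≤ ENNReal.ofReal ((garchCoef ν₀.1)⁻¹ ^ 2) * ENNReal.ofReal (lam i 1 ω ^ (2 : ℝ)) := by
    filter_upwards [h.recursion i 1] with ω hω
    have h2 := (h₀.mul_le_nextIntensity (G := G) i (fun j => y j (1 - 1) ω) (h.nonneg i (1 - 1) ω)).2
    rw [← hω, sub_self] at h2
    rw [← ENNReal.ofReal_mul (by positivity), Real.rpow_two, ← mul_pow]
    refine ENNReal.ofReal_le_ofReal (pow_le_pow_left₀ (h.nonneg i 0 ω) ?_ 2)
    rw [inv_mul_eq_div, le_div_iff₀ ha]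
    linarith
  refine (lintegral_mono_ae h1).trans ?_
  rw [lintegral_const_mul _ ((h.measurable_intensity i 1).pow_const (2 : ℝ)).ennreal_ofReal, ENNReal.ofReal_mul (by positivity)]
  exact mul_le_mul_right (h.lintegral_ofReal_rpow_le i 1 one_le_two hq hM) _

/-- The paths on which all the averages that occur in the proof are at most `B`. -/
def boundedPaths (G : SimpleGraph (Fin N)) (y : Fin N → ℤ → Ω → ℕ) (lam : Fin N → ℤ → Ω → ℝ)
    (q B : ℝ) (T : ℕ) : Set Ω :=
  {ω | momentSum G q (fun i t => y i t ω) T ≤ B * (N * T)} ∩ {ω | ∑ i, lam i 0 ω ^ 2 ≤ B * N}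
    ∩ loadEvent G lam B T

omit [IsProbabilityMeasure P] in
lemma IsModel.measurable_momentTerm (h : IsModel P G ν₀ ℋ y lam) (q : ℝ) (i : Fin N) (t : ℤ) :
    Measurable fun ω => momentTerm G q (fun j => y j t ω) i := by
  have hy : ∀ j, Measurable fun ω => (y j t ω : ℝ) := fun j =>
    (measurable_from_top (f := fun k : ℕ => (k : ℝ))).comp (h.measurable_count j t)
  unfold momentTerm
  exact (((hy i).pow_const q).const_add 1).add
    (Finset.measurable_sum _ fun j _ => ((hy j).pow_const 2).const_mul _)

/-- The weights of a row sum to at most one, so averaging over neighbours does not increase the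
moment bound. -/
lemma IsModel.lintegral_momentTerm_le (h : IsModel P G ν₀ ℋ y lam) {q M : ℝ} (hq : 2 ≤ q)
    (hM0 : 0 ≤ M) (i : Fin N) (t : ℤ)
    (hM : ∀ j, ∫⁻ ω, (y j t ω : ℝ≥0∞) ^ q ∂P ≤ ENNReal.ofReal M) :
    ∫⁻ ω, ENNReal.ofReal (momentTerm G q (fun j => y j t ω) i) ∂P
      ≤ ENNReal.ofReal (1 + 2 * M) := by
  have hy : ∀ j, Measurable fun ω => (y j t ω : ℝ≥0∞) ^ q := fun j =>
    (measurable_from_top (f := fun k : ℕ => (k : ℝ≥0∞) ^ q)).comp (h.measurable_count j t)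
  have h1 : ∀ ω, ENNReal.ofReal (momentTerm G q (fun j => y j t ω) i)
      ≤ 1 + (y i t ω : ℝ≥0∞) ^ q
        + ∑ j, ENNReal.ofReal (weight G i j) * (y j t ω : ℝ≥0∞) ^ q := by
    intro ω
    have hnn : ∀ j, 0 ≤ weight G i j * (y j t ω : ℝ) ^ 2 := fun j =>
      mul_nonneg (weight_nonneg G i j) (by positivity)
    unfold momentTerm
    rw [ENNReal.ofReal_add (by positivity) (Finset.sum_nonneg fun j _ => hnn j),
      ENNReal.ofReal_add zero_le_one (by positivity), ENNReal.ofReal_one,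
      ofReal_natCast_rpow _ (by linarith), ENNReal.ofReal_sum_of_nonneg fun j _ => hnn j]
    gcongr with j
    rw [ENNReal.ofReal_mul (weight_nonneg G i j), ← ofReal_natCast_rpow _ (by linarith)]
    gcongr
    exact natCast_sq_le_rpow hq _
  refine (lintegral_mono h1).trans ?_
  have hy1 : Measurable fun ω => 1 + (y i t ω : ℝ≥0∞) ^ q := (hy i).const_add 1
  rw [lintegral_add_left hy1, lintegral_add_left measurable_const,
    lintegral_finsetSum _ fun j _ => (hy j).const_mul _]
  simp only [lintegral_const_mul _ (hy _), lintegral_const, measure_univ, mul_one]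
  have h2 : ∑ j, ENNReal.ofReal (weight G i j) * ∫⁻ ω, (y j t ω : ℝ≥0∞) ^ q ∂P
      ≤ ENNReal.ofReal M := by
    calc _ ≤ ∑ j, ENNReal.ofReal (weight G i j) * ENNReal.ofReal M :=
          Finset.sum_le_sum fun j _ => mul_le_mul_right (hM j) _
      _ = ENNReal.ofReal (∑ j, weight G i j) * ENNReal.ofReal M := by
          rw [← Finset.sum_mul, ENNReal.ofReal_sum_of_nonneg fun j _ => weight_nonneg G i j]
      _ ≤ 1 * ENNReal.ofReal M := by
          gcongr
          rw [← ENNReal.ofReal_one]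
          exact ENNReal.ofReal_le_ofReal (sum_weight_le_one G i)
      _ = _ := one_mul _
  calc _ ≤ 1 + ENNReal.ofReal M + ENNReal.ofReal M := add_le_add (add_le_add le_rfl (hM i)) h2
    _ = _ := by
      rw [← ENNReal.ofReal_one, ← ENNReal.ofReal_add zero_le_one hM0,
        ← ENNReal.ofReal_add (by positivity) hM0]
      congr 1
      ring

omit [IsProbabilityMeasure P] in
lemma lintegral_sum_ofReal_le {ι : Type*} (s : Finset ι) {f : ι → Ω → ℝ} (hf : ∀ k, Measurable (f k))
    (hf0 : ∀ k ω, 0 ≤ f k ω) {C : ℝ} (h : ∀ k ∈ s, ∫⁻ ω, ENNReal.ofReal (f k ω) ∂P ≤ ENNReal.ofReal C) :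
    ∫⁻ ω, ENNReal.ofReal (∑ k ∈ s, f k ω) ∂P ≤ ENNReal.ofReal (C * s.card) := by
  simp only [ENNReal.ofReal_sum_of_nonneg fun k _ => hf0 k _]
  rw [lintegral_finsetSum _ fun k _ => (hf k).ennreal_ofReal]
  refine (Finset.sum_le_sum h).trans (le_of_eq ?_)
  rw [Finset.sum_const, nsmul_eq_mul, mul_comm C, ENNReal.ofReal_mul (Nat.cast_nonneg _),
    ENNReal.ofReal_natCast]

/-- Markov's inequality for each of the three averages. A load has at most D + 1 summands, and the
factor 2 in the first term pays for the T + 1 times of the moment sum. -/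
lemma IsModel.prob_not_boundedPaths_le (h : IsModel P G ν₀ ℋ y lam) (hN : 0 < N) {A w D : ℝ}
    (h₀ : IsRegular A w ν₀) (hD : ∀ i, nodeDegree G i ≤ D) {q M M₁ : ℝ} (hq : 2 ≤ q) (hM0 : 0 ≤ M)
    (hM₁ : M₁ = max M ((min (alphaUp ν₀.1) (alphaDown ν₀.1))⁻¹ ^ q * M))
    (hM : ∀ i (t : ℤ), 1 ≤ t → ∫⁻ ω, (y i t ω : ℝ≥0∞) ^ q ∂P ≤ ENNReal.ofReal M)
    {B : ℝ} (hB : 0 < B) {T : ℕ} (hT : 1 ≤ T) :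
    P (boundedPaths G y lam q B T)ᶜ ≤ ENNReal.ofReal (2 * (1 + 2 * M₁) / B)
      + ENNReal.ofReal ((garchCoef ν₀.1)⁻¹ ^ 2 * M / B) + ENNReal.ofReal (M * (D + 1) / B) := by
  have hN' : (0 : ℝ) < N := by exact_mod_cast hN
  have hT' : (1 : ℝ) ≤ T := by exact_mod_cast hT
  have hM₁0 : 0 ≤ M₁ := hM0.trans (hM₁ ▸ le_max_left _ _)
  have hm : ∀ j (t : ℕ), ∫⁻ ω, (y j (t : ℤ) ω : ℝ≥0∞) ^ q ∂P ≤ ENNReal.ofReal M₁ := by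
    intro j t
    rcases Nat.eq_zero_or_pos t with rfl | ht
    · refine (h.lintegral_count_zero_le h₀ j (by linarith) (hM j 1 le_rfl)).trans ?_
      exact ENNReal.ofReal_le_ofReal (hM₁ ▸ le_max_right _ _)
    · refine (hM j t (by exact_mod_cast ht)).trans ?_
      exact ENNReal.ofReal_le_ofReal (hM₁ ▸ le_max_left _ _)
  have hD0 : 0 ≤ D := (nodeDegree_nonneg G ⟨0, hN⟩).trans (hD _)
  have e1 : P {ω | B * (N * T) < momentSum G q (fun i t => y i t ω) T}
      ≤ ENNReal.ofReal (2 * (1 + 2 * M₁) / B) := by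
    have hmeas : Measurable fun ω => momentSum G q (fun i t => y i t ω) T :=
      Finset.measurable_sum _ fun i _ => Finset.measurable_sum _ fun t _ =>
        h.measurable_momentTerm q i t
    refine measure_lt_le_of_lintegral_le hmeas (by positivity) hB ?_
    have k1 := lintegral_sum_ofReal_le (P := P) (Finset.univ ×ˢ Finset.range (T + 1))
      (f := fun (z : Fin N × ℕ) ω => momentTerm G q (fun j => y j (z.2 : ℤ) ω) z.1)
      (fun z => h.measurable_momentTerm q z.1 z.2)
      (fun z ω => zero_le_one.trans (one_le_momentTerm G hq _ _))
      (fun z _ => h.lintegral_momentTerm_le hq hM₁0 z.1 z.2 fun j => hm j z.2)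
    simp only [Finset.sum_product] at k1
    refine k1.trans (ENNReal.ofReal_le_ofReal ?_)
    rw [Finset.card_product, Finset.card_univ, Fintype.card_fin, Finset.card_range]
    push_cast
    have : (1 + 2 * M₁) * N * (T + 1) ≤ (1 + 2 * M₁) * N * (2 * T) := by gcongr; linarith
    linarith
  have e2 : P {ω | B * N < ∑ i, lam i 0 ω ^ 2}
      ≤ ENNReal.ofReal ((garchCoef ν₀.1)⁻¹ ^ 2 * M / B) := by
    have hmeas : ∀ i, Measurable fun ω => lam i 0 ω ^ 2 := fun i =>
      (h.measurable_intensity i 0).pow_const 2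
    refine measure_lt_le_of_lintegral_le (Finset.measurable_sum _ fun i _ => hmeas i) hN' hB ?_
    have k1 := lintegral_sum_ofReal_le (P := P) Finset.univ hmeas (fun i ω => sq_nonneg _)
      (fun i _ => h.lintegral_intensity_zero_sq_le h₀ i hq (hM i 1 le_rfl))
    simpa using k1
  have e3 : P {ω | B * (N * T) < ∑ i, ∑ t ∈ Finset.Icc 1 T, load G lam i (t : ℤ) ω}
      ≤ ENNReal.ofReal (M * (D + 1) / B) := by
    have hmeas : ∀ i t, Measurable fun ω => load G lam i t ω := fun i t =>
      Finset.measurable_sum _ fun j _ => h.measurable_intensity j t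
    have hmeas' : Measurable fun ω => ∑ i, ∑ t ∈ Finset.Icc 1 T, load G lam i (t : ℤ) ω :=
      Finset.measurable_sum _ fun i _ => Finset.measurable_sum _ fun t _ => hmeas i t
    refine measure_lt_le_of_lintegral_le hmeas' (by positivity) hB ?_
    have k0 : ∀ z ∈ (Finset.univ : Finset (Fin N)) ×ˢ Finset.Icc 1 T,
        ∫⁻ ω, ENNReal.ofReal (load G lam z.1 (z.2 : ℤ) ω) ∂P ≤ ENNReal.ofReal (M * (D + 1)) := by
      intro z hz
      have hz1 : (1 : ℤ) ≤ (z.2 : ℤ) := by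
        have := (Finset.mem_Icc.1 (Finset.mem_product.1 hz).2).1
        exact_mod_cast this
      have k2 := lintegral_sum_ofReal_le (P := P) (closedNbhd G z.1)
        (f := fun j ω => lam j (z.2 : ℤ) ω) (fun j => h.measurable_intensity j _)
        (fun j ω => h.nonneg j _ ω) (C := M) (fun j _ => by
          have := h.lintegral_ofReal_rpow_le j z.2 le_rfl (by linarith : 1 ≤ q) (hM j z.2 hz1)
          simpa using this)
      refine k2.trans (ENNReal.ofReal_le_ofReal ?_)
      have := card_closedNbhd_le G z.1
      have := hD z.1
      gcongr
      linarith
    have k1 := lintegral_sum_ofReal_le (P := P) (Finset.univ ×ˢ Finset.Icc 1 T)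
      (f := fun (z : Fin N × ℕ) ω => load G lam z.1 (z.2 : ℤ) ω) (fun z => hmeas _ _)
      (fun z ω => h.load_nonneg _ _ ω) k0
    simp only [Finset.sum_product] at k1
    refine k1.trans (ENNReal.ofReal_le_ofReal (le_of_eq ?_))
    rw [Finset.card_product, Finset.card_univ, Fintype.card_fin, Nat.card_Icc]
    push_cast
    simp
  have hsub : (boundedPaths G y lam q B T)ᶜ
      ⊆ ({ω | B * (N * T) < momentSum G q (fun i t => y i t ω) T}
        ∪ {ω | B * N < ∑ i, lam i 0 ω ^ 2})
        ∪ {ω | B * (N * T) < ∑ i, ∑ t ∈ Finset.Icc 1 T, load G lam i (t : ℤ) ω} := by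
    intro ω hω
    simp only [boundedPaths, loadEvent, Set.compl_inter, Set.mem_union, Set.mem_compl_iff,
      Set.mem_ofPred_eq, not_le] at hω ⊢
    exact hω
  exact (measure_mono hsub).trans ((measure_union_le _ _).trans
    (add_le_add ((measure_union_le _ _).trans (add_le_add e1 e2)) e3))

end Moments

/-! ### The likelihood of distant parameters -/

section Likelihood

variable {Ω : Type*} [mΩ : MeasurableSpace Ω] {P : Measure Ω} {N : ℕ}
  {G : SimpleGraph (Fin N)} {ν₀ : Param} {ℋ : Filtration ℤ mΩ}
  {y : Fin N → ℤ → Ω → ℕ} {lam : Fin N → ℤ → Ω → ℝ}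

/-- The true intensities are the fitted ones for the true parameter and initial values. -/
lemma IsModel.ae_eq_fittedIntensity (h : IsModel P G ν₀ ℋ y lam) : ∀ᵐ ω ∂P, ∀ i (t : ℕ),
    lam i (t : ℤ) ω
      = fittedIntensity G (fun i => lam i 0 ω) (fun i t => y i t ω) ν₀ i t := by
  filter_upwards [h.ae_recursion] with ω hω i t
  induction t with
  | zero => rfl
  | succ t ih => rw [hω, natCast_succ_sub_one, ih, fittedIntensity]

/-- The fitted intensity at t + 1 depends only on counts up to t. This predictability is what the
exponential martingale requires. -/
lemma IsModel.measurable_fittedIntensity (h : IsModel P G ν₀ ℋ y lam) (init : Fin N → ℝ)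
    (ν : Param) (i : Fin N) (t : ℕ) :
    Measurable[ℋ (t : ℤ)] fun ω => fittedIntensity G init (fun i t => y i t ω) ν i (t + 1) := by
  have key : ∀ t : ℕ, Measurable[ℋ (t : ℤ)] (fun ω =>
      fittedIntensity G init (fun i t => y i t ω) ν i t) →
      Measurable[ℋ (t : ℤ)] fun ω => fittedIntensity G init (fun i t => y i t ω) ν i (t + 1) :=
    fun t ht => measurable_eval_counts (n := fun j ω => y j (t : ℤ) ω)
      (F := fun n ω => nextIntensity G ν i n (fittedIntensity G init (fun i t => y i t ω) ν i t))
      (fun j => h.adapted j t) fun n => measurable_nextIntensity ν i n ht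
  induction t with
  | zero => exact key 0 measurable_const
  | succ t ih => exact key (t + 1) (ih.mono (ℋ.mono (by simp)) le_rfl)

/-- Subtracting β times the previous discrepancy removes the memory of the fitted recursion, so the
gap is a function of the present counts and true intensity only, whatever the initial values. -/
lemma recursionGap_eq (init : Fin N → ℝ) (y : Fin N → ℤ → ℕ) (ν : Param) (i : Fin N) (t : ℕ)
    {l l' : ℝ} (hl : l' = nextIntensity G ν₀ i (fun j => y j (t : ℤ)) l) :
    recursionGap G ν₀ ν i (fun j => y j (t : ℤ)) l
      = fittedIntensity G init y ν i (t + 1) - l'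
        - garchCoef ν.1 * (fittedIntensity G init y ν i t - l) := by
  rw [recursionGap, ← hl, fittedIntensity, nextIntensity_eq, nextIntensity_eq]
  ring

/-- With overwhelming probability, the log-likelihood at a distant parameter falls short of the true
one by an amount proportional to the sample size. -/
lemma exists_prob_logLikSum_ge_le {A w D B ε b c q : ℝ} (h₀ : IsRegular A w ν₀) (hq : 2 ≤ q)
    (hB : 0 < B) (hD0 : 0 < D) (hε : 0 < ε) (hb : b < 1) (hb₀ : garchCoef ν₀.1 ≤ b) :
    ∃ δ ζ : ℝ, 0 < δ ∧ 0 < ζ ∧ ∃ T₀ : ℕ,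
      ∀ {Ω : Type*} [mΩ : MeasurableSpace Ω] {P : Measure Ω} [IsProbabilityMeasure P] {N : ℕ}
        {G : SimpleGraph (Fin N)} {ℋ : Filtration ℤ mΩ}
        {y : Fin N → ℤ → Ω → ℕ} {lam : Fin N → ℤ → Ω → ℝ},
        IsModel P G ν₀ ℋ y lam → 0 < N → (∀ i, 1 ≤ nodeDegree G i ∧ nodeDegree G i ≤ D) →
        ∀ init : Fin N → ℝ, (∀ i, init i ∈ Set.Icc 0 c) →
        ∀ ν, IsFar ε ν₀ ν → CoefBound A ν.1 → w ≤ base ν.1 → garchCoef ν.1 ≤ b →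
        ∀ T : ℕ, T₀ ≤ T →
          P (boundedPaths G y lam q B T ∩
            {ω | logLikSum T (fun i t => y i t ω) (fun i t => lam i (t : ℤ) ω) - δ * (N * T)
              ≤ logLikSum T (fun i t => y i t ω)
                (fittedIntensity G init (fun i t => y i t ω) ν)})
            ≤ 3 * ENNReal.ofReal (Real.exp (-(ζ * T))) := by
  obtain ⟨s, f, hs, hf, T₀, hsep⟩ := exists_prob_gapEvent_le h₀ hB hD0 hε
  have h1b : 0 < 1 - b := by linarith
  have hI : ∀ u, 0 ≤ u → 0 < intensityBound A b u B := fun u hu => by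
    unfold intensityBound
    positivity
  -- C bounds the mean of fitted plus true intensities on bounded paths, and η is the resulting
  -- Hellinger distance per site.
  set C := intensityBound A b (c ^ 2) B + intensityBound A b B B with hC
  have hC0 : 0 < C := add_pos (hI _ (sq_nonneg c)) (hI _ hB.le)
  set η := (s * f) ^ 2 / (8 * C) with hη
  have hη0 : 0 < η := by positivity
  -- If the shortfall is at most (η/2)NT while H ≥ ηNT, the martingale exponent is at least -(η/4)NT
  -- + (η/2)NT, more than the level (η/8)NT used in `k2`.
  refine ⟨η / 2, min f (η / 8), by positivity, lt_min hf (by positivity), max 1 T₀, ?_⟩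
  intro Ω mΩ P _ N G ℋ y lam h hN hD init hinit ν hfar hν hνw hνb T hT
  have hT1 : 0 < T := (le_max_left _ _).trans hT
  have hN' : (1 : ℝ) ≤ N := by exact_mod_cast hN
  have hT' : (1 : ℝ) ≤ T := by exact_mod_cast hT1
  have k1 := hsep h hN hD ν hfar T ((le_max_right _ _).trans hT)
  have hlampos : ∀ᵐ ω ∂P, ∀ i (t : ℕ), 0 < lam i ((t + 1 : ℕ) : ℤ) ω := by
    filter_upwards [h.ae_le_intensity h₀] with ω hω i t
    exact h₀.pos.trans_le (hω i _)
  have k2 := h.prob_likelihood_ge (b := fun i t ω => fittedIntensity G init (fun i t => y i t ω) ν i t)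
    (fun i t => h.measurable_fittedIntensity init ν i t) (fun i t ω => h₀.pos.trans_le
      (hνw.trans (base_le_fittedIntensity_succ G hν (fun i => (hinit i).1) i t))) hlampos T
    (η / 8 * (N * T))
  have hexp1 : ENNReal.ofReal (Real.exp (-(f * T)))
      ≤ ENNReal.ofReal (Real.exp (-(min f (η / 8) * T))) := by
    gcongr
    exact min_le_left _ _
  have hexp2 : ENNReal.ofReal (Real.exp (-(η / 8 * (N * T))))
      ≤ ENNReal.ofReal (Real.exp (-(min f (η / 8) * T))) := by
    gcongr
    · exact min_le_right _ _
    · exact le_mul_of_one_le_left (by positivity) hN'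
  have hfin : 2 * ENNReal.ofReal (Real.exp (-(f * T)))
        + ENNReal.ofReal (Real.exp (-(η / 8 * (N * T))))
      ≤ 3 * ENNReal.ofReal (Real.exp (-(min f (η / 8) * T))) := by
    calc _ ≤ 2 * ENNReal.ofReal (Real.exp (-(min f (η / 8) * T)))
          + ENNReal.ofReal (Real.exp (-(min f (η / 8) * T))) := by gcongr
      _ = _ := by ring
  refine le_trans (measure_mono_ae ?_) ((measure_union_le _ _).trans ((add_le_add k1 k2).trans hfin))
  filter_upwards [h.ae_eq_fittedIntensity, h.ae_recursion] with ω heq hrec hmem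
  obtain ⟨⟨⟨hmom, hlam0⟩, hload⟩, hlik⟩ := hmem
  simp only [Set.mem_ofPred_eq] at hmom hlam0 hlik
  by_contra hcon
  have hcon1 : ω ∉ gapEvent G y lam ν₀ ν s f T := fun hh => hcon (Or.inl ⟨hload, hh⟩)
  have hcon2 := fun hh => hcon (Or.inr hh)
  simp only [Set.mem_ofPred_eq] at hcon2
  set x := fittedIntensity G init (fun i t => y i t ω) ν with hx
  set l : Fin N → ℕ → ℝ := fun i t => lam i (t : ℤ) ω with hl
  have hgap : f * T ≤ frequency (T - 1) fun i t =>
      s ≤ |x i (t + 2) - l i (t + 2) - garchCoef ν.1 * (x i (t + 1) - l i (t + 1))| := by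
    simp only [gapEvent, Set.mem_ofPred_eq, not_le] at hcon1
    refine hcon1.le.trans (frequency_mono fun i t hst => ?_)
    rwa [recursionGap_eq init (fun i t => y i t ω) ν i (t + 1)
      (l' := lam i ((t + 1 + 1 : ℕ) : ℤ) ω)] at hst
    rw [hrec i ((t + 1 + 1 : ℕ) : ℤ), natCast_succ_sub_one]
  have hx0 : ∀ i t, 0 ≤ x i t := fittedIntensity_nonneg G hν fun i => (hinit i).1
  have hl0 : ∀ i t, 0 ≤ l i t := fun i t => h.nonneg i t ω
  have hsum : ∑ i, ∑ t ∈ Finset.Icc 1 T, (x i t + l i t) ≤ C * (N * T) := by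
    simp only [Finset.sum_add_distrib]
    have a1 := sum_fittedIntensity_le G hb hq hν hνb (fun i => (hinit i).1)
      (sum_init_sq_le hinit hT1) hmom
    have a2 := sum_fittedIntensity_le G (init := fun i => lam i 0 ω) (u := B) hb hq h₀.bound hb₀
      (fun i => h.nonneg i 0 ω)
      (hlam0.trans (by
        have : (N : ℝ) ≤ N * T := le_mul_of_one_le_right (by positivity) hT'
        gcongr)) hmom
    simp only [← heq] at a2
    rw [hC, add_mul]
    exact add_le_add a1 a2
  have hH := le_sum_sqrt_sub_sq_of_frequency hN hT1 hx0 hl0 (hν 4).1 (hνb.trans hb.le) hs hf hC0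
    hgap hsum
  refine hcon2 ?_
  have e1 : ∑ t ∈ Finset.range T, ∑ i,
      (1 / 2 * (logLikTerm (y i ((t + 1 : ℕ) : ℤ) ω) (x i (t + 1))
        - logLikTerm (y i ((t + 1 : ℕ) : ℤ) ω) (l i (t + 1)))
        + 1 / 2 * (√(x i (t + 1)) - √(l i (t + 1))) ^ 2)
      = 1 / 2 * (logLikSum T (fun i t => y i t ω) x - logLikSum T (fun i t => y i t ω) l)
        + 1 / 2 * ∑ i, ∑ t ∈ Finset.Icc 1 T, (√(x i t) - √(l i t)) ^ 2 := by
    rw [Finset.sum_comm]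
    simp only [logLikSum, sum_Icc_eq_sum_range, Finset.sum_add_distrib, ← Finset.mul_sum,
      Finset.sum_sub_distrib]
  have e2 : η / 8 * (N * T) ≤ 1 / 2 * (logLikSum T (fun i t => y i t ω) x
      - logLikSum T (fun i t => y i t ω) l)
        + 1 / 2 * ∑ i, ∑ t ∈ Finset.Icc 1 T, (√(x i t) - √(l i t)) ^ 2 := by
    have : 0 ≤ η * (N * T) := by positivity
    linarith
  rw [← e1] at e2
  exact e2

end Likelihood

/-! ### Comparison of neighbouring parameters on bounded paths -/

section Comparison

variable {N : ℕ} (G : SimpleGraph (Fin N)) {y : Fin N → ℤ → ℕ}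

/-- The constant in the mean square continuity of fitted intensities in the parameter. -/
noncomputable def continuityConst (A b c : ℝ) : ℝ :=
  (1 + (c ^ 2 + 3 * A ^ 2 / (1 - b)) / (1 - b)) / (1 - b) ^ 2

lemma continuityConst_pos {A b c : ℝ} (hb : b < 1) : 0 < continuityConst A b c := by
  have : 0 < 1 - b := by linarith
  unfold continuityConst
  positivity

lemma logLikSum_le_of_near {A b q B c w τ δ : ℝ} (hb : b < 1) (hq : 2 ≤ q) (hw : 0 < w)
    (hτ : 0 < τ) {ν ν' : Param} (hν : CoefBound A ν.1) (hν' : CoefBound A ν'.1)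
    (hwν : w ≤ base ν.1) (hwν' : w ≤ base ν'.1) (hνb : garchCoef ν.1 ≤ b)
    (hνb' : garchCoef ν'.1 ≤ b) {init : Fin N → ℝ} (hinit : ∀ i, init i ∈ Set.Icc 0 c)
    (hδ : ∀ k, |ν.1 k - ν'.1 k| ≤ δ) {R : ℕ} (hR0 : 0 < R) (hR : ν'.2 = min ν.2 R) {T : ℕ}
    (hB : momentSum G q y T ≤ B * (N * T)) :
    logLikSum T y (fittedIntensity G init y ν) ≤ logLikSum T y (fittedIntensity G init y ν')
      + (τ * (2 / w ^ 2 + 2) * B + τ⁻¹ * ((8 * δ ^ 2 + 2 * A ^ 2 * (R : ℝ) ^ (2 - q))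
        * (continuityConst A b c * B))) * (N * T) := by
  have h1 := abs_sum_logLikTerm_sub_le G (y := y) hq hw hτ
    (fun i t => hwν.trans (base_le_fittedIntensity_succ G (y := y) hν (fun i => (hinit i).1) i t))
    (fun i t => hwν'.trans (base_le_fittedIntensity_succ G (y := y) hν' (fun i => (hinit i).1) i t)) T
  have h2 := sum_fittedIntensity_sub_sq_le G (y := y) hb hq hν hν' hνb hνb' hinit hδ hR0 hR T
  have h3 := (le_abs_self _).trans h1
  have hc := continuityConst_pos (A := A) (c := c) hb
  have h4 : τ⁻¹ * ∑ i, ∑ t ∈ Finset.range (T + 1),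
      (fittedIntensity G init y ν i t - fittedIntensity G init y ν' i t) ^ 2
      ≤ τ⁻¹ * ((8 * δ ^ 2 + 2 * A ^ 2 * (R : ℝ) ^ (2 - q))
        * (continuityConst A b c * (B * (N * T)))) := by
    refine mul_le_mul_of_nonneg_left (h2.trans ?_) (by positivity)
    unfold continuityConst at hc ⊢
    gcongr
  have h5 : τ * (2 / w ^ 2 + 2) * momentSum G q y T ≤ τ * (2 / w ^ 2 + 2) * (B * (N * T)) := by
    gcongr
  unfold logLikSum
  linarith

/-- Replaces the unobserved true initial intensities by the prescribed ones. The last term is of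
order N, not NT, so it is negligible for large T. -/
lemma logLikSum_le_of_init {A b q B c w τ : ℝ} (hb : b < 1) (hq : 2 ≤ q) (hw : 0 < w)
    (hτ : 0 < τ) {ν : Param} (hν : CoefBound A ν.1) (hwν : w ≤ base ν.1)
    (hνb : garchCoef ν.1 ≤ b) {init init' : Fin N → ℝ} (hinit : ∀ i, init i ∈ Set.Icc 0 c)
    (hinit' : ∀ i, 0 ≤ init' i) (hB' : ∑ i, init' i ^ 2 ≤ B * N) {T : ℕ}
    (hB : momentSum G q y T ≤ B * (N * T)) :
    logLikSum T y (fittedIntensity G init' y ν) ≤ logLikSum T y (fittedIntensity G init y ν)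
      + τ * (2 / w ^ 2 + 2) * B * (N * T) + τ⁻¹ * ((B + c ^ 2) / (1 - b)) * N := by
  have h1b : 0 < 1 - b := by linarith
  have h1 := abs_sum_logLikTerm_sub_le G (y := y) hq hw hτ
    (fun i t => hwν.trans (base_le_fittedIntensity_succ G (y := y) hν hinit' i t))
    (fun i t => hwν.trans (base_le_fittedIntensity_succ G (y := y) hν (fun i => (hinit i).1) i t)) T
  have h2 := sum_fittedIntensity_init_sub_sq_le G (y := y) (init := init') hb hν hνb init T
  have h3 := (le_abs_self _).trans h1
  have h6 : ∑ i, (init' i - init i) ^ 2 ≤ (B + c ^ 2) * N := by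
    have h7 : ∀ i, (init' i - init i) ^ 2 ≤ init' i ^ 2 + c ^ 2 := fun i => by
      have h8 := pow_le_pow_left₀ (hinit i).1 (hinit i).2 2
      nlinarith [mul_nonneg (hinit' i) (hinit i).1]
    have h9 := Finset.sum_le_sum fun i (_ : i ∈ Finset.univ) => h7 i
    rw [Finset.sum_add_distrib] at h9
    simp only [Finset.sum_const, Finset.card_univ, Fintype.card_fin, nsmul_eq_mul] at h9
    linarith
  have h4 : τ⁻¹ * ∑ i, ∑ t ∈ Finset.range (T + 1),
      (fittedIntensity G init' y ν i t - fittedIntensity G init y ν i t) ^ 2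
      ≤ τ⁻¹ * ((B + c ^ 2) * N / (1 - b)) := by
    refine mul_le_mul_of_nonneg_left (h2.trans ?_) (by positivity)
    gcongr
  have h5 : τ * (2 / w ^ 2 + 2) * momentSum G q y T ≤ τ * (2 / w ^ 2 + 2) * (B * (N * T)) := by
    gcongr
  have h8 : τ⁻¹ * ((B + c ^ 2) * N / (1 - b)) = τ⁻¹ * ((B + c ^ 2) / (1 - b)) * N := by ring
  unfold logLikSum
  linarith

end Comparison

/-! ### Consistency -/

lemma isFar_of_le_dist {ε : ℝ} (hε : 0 < ε) {ν₀ ν : Param} (h : ε ≤ dist ν ν₀) :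
    IsFar ε ν₀ ν := by
  by_contra hcon
  unfold IsFar at hcon
  push Not at hcon
  obtain ⟨h1, h2⟩ := hcon
  have h3 : dist ν.1 ν₀.1 < ε := (dist_pi_lt_iff hε).2 fun k => by
    rw [Real.dist_eq]
    exact h2 k
  rw [Prod.dist_eq, h1, dist_self, max_eq_left dist_nonneg] at h
  linarith

/-- Truncation at a level R > r₀ never turns a wrong threshold into r₀, so only the coefficients can
come closer. -/
lemma IsFar.of_near {ε δ : ℝ} {ν₀ ν ν' : Param} (h : IsFar ε ν₀ ν)
    (hδ : ∀ k, |ν.1 k - ν'.1 k| ≤ δ) (hδε : δ ≤ ε / 2) {R : ℕ} (hR₀ : ν₀.2 < R)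
    (hR : ν'.2 = min ν.2 R) : IsFar (ε / 2) ν₀ ν' := by
  by_cases hr : ν.2 = ν₀.2
  · obtain ⟨k, hk⟩ := h.resolve_left fun h' => h' hr
    refine Or.inr ⟨k, ?_⟩
    have h1 := abs_sub_le (ν.1 k) (ν'.1 k) (ν₀.1 k)
    linarith [hδ k]
  · left
    omega

/-- The sum of the bounds of `IsModel.prob_not_boundedPaths_le`, times the level `B`. -/
noncomputable def escapeConst (q M D : ℝ) (ν₀ : Param) : ℝ :=
  2 * (1 + 2 * max M ((min (alphaUp ν₀.1) (alphaDown ν₀.1))⁻¹ ^ q * M))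
    + (garchCoef ν₀.1)⁻¹ ^ 2 * M + M * (D + 1)

/-- Consistency of the maximum likelihood estimator as the number of time points grows, uniformly
over all networks of bounded degree. -/
lemma eventually_prob_le_dist_le {A w D c q M ε ε' : ℝ} {ν₀ : Param} (h₀ : IsRegular A w ν₀)
    (hq : 2 < q) (hM : 0 ≤ M) (hD0 : 0 < D) (hε : 0 < ε) (hε' : 0 < ε') {S : ℕ → Set Coef}
    {K : Set Coef} (hK : IsCompact K) (hKA : ∀ θ ∈ K, CoefBound A θ ∧ w ≤ base θ)
    (hSK : ∀ r, S r ⊆ K) (hν₀ : ν₀.1 ∈ S ν₀.2) :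
    ∀ᶠ T : ℕ in atTop,
      ∀ {Ω : Type*} [mΩ : MeasurableSpace Ω] {P : Measure Ω} [IsProbabilityMeasure P] {N : ℕ}
        {G : SimpleGraph (Fin N)} {ℋ : Filtration ℤ mΩ}
        {y : Fin N → ℤ → Ω → ℕ} {lam : Fin N → ℤ → Ω → ℝ},
        IsModel P G ν₀ ℋ y lam → 0 < N → (∀ i, 1 ≤ nodeDegree G i ∧ nodeDegree G i ≤ D) →
        (∀ i (t : ℤ), 1 ≤ t → ∫⁻ ω, (y i t ω : ℝ≥0∞) ^ q ∂P ≤ ENNReal.ofReal M) →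
        ∀ init : Fin N → ℝ, (∀ i, init i ∈ Set.Icc 0 c) →
        ∀ νhat : Ω → Param, (∀ᵐ ω ∂P, IsMLE G init T (fun i t => y i t ω) S (νhat ω)) →
          P {ω | ε ≤ dist (νhat ω) ν₀} ≤ ENNReal.ofReal ε' := by
  set E := escapeConst q M D ν₀ with hE
  have ha : 0 < min (alphaUp ν₀.1) (alphaDown ν₀.1) := lt_min h₀.alphaUp_pos h₀.alphaDown_pos
  have hβ := h₀.garch_pos
  have hM₁ : 0 ≤ max M ((min (alphaUp ν₀.1) (alphaDown ν₀.1))⁻¹ ^ q * M) := le_max_of_le_left hM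
  have hE0 : 0 < E := by
    rw [hE]
    unfold escapeConst
    positivity
  -- Chosen so that paths outside the bounded set have probability at most E/B = ε'/2.
  set B := 2 * E / ε' with hBdef
  have hB : 0 < B := by positivity
  have hw := h₀.pos
  set b₀ := garchCoef ν₀.1 with hb₀
  -- With this m the upper bound for the likelihood at β > 1 - 1/(2m) lies below the lower bound for
  -- the likelihood at ν₀. Only b₀ enters here, so the choice of b below is not circular.
  obtain ⟨m, hm⟩ := exists_nat_gt (8 * (2 * B + (|Real.log w| * B + intensityBound A b₀ (c ^ 2) B)) / w)
  have hI0 : 0 ≤ intensityBound A b₀ (c ^ 2) B := by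
    have := h₀.garch_lt
    unfold intensityBound
    have : 0 < 1 - b₀ := by linarith
    positivity
  have hm0 : 0 < m := by
    have : (0 : ℝ) < m := lt_of_le_of_lt (by positivity) hm
    exact_mod_cast this
  rw [div_lt_iff₀ hw] at hm
  set b := max b₀ (1 - 1 / (2 * m)) with hbdef
  have hb : b < 1 := max_lt h₀.garch_lt (by
    have : (0 : ℝ) < 1 / (2 * m) := by positivity
    linarith)
  have h1b : 0 < 1 - b := by linarith
  obtain ⟨η, ζ, hη, hζ, T₁, hlik⟩ := exists_prob_logLikSum_ge_le (A := A) (c := c) h₀ hq.le hB hD0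
    (half_pos hε) hb (le_max_left _ _)
  -- Error budget: the moment part of Young's inequality occurs twice, the net error and the initial
  -- values once each. Each is at most (η/8)NT, so the total (η/2)NT stays below the gap ηNT.
  set τ := η / (8 * ((2 / w ^ 2 + 2) * B)) with hτdef
  have hτ : 0 < τ := by positivity
  have hτη : τ * (2 / w ^ 2 + 2) * B = η / 8 := by
    rw [hτdef]
    field_simp
  have hcc := continuityConst_pos (A := A) (c := c) hb
  set cc := continuityConst A b c
  set κ := η * τ / (8 * (cc * B)) with hκdef
  have hκ : 0 < κ := by positivity
  set δ := min (ε / 2) (√(κ / 16)) with hδdef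
  have hδ : 0 < δ := lt_min (half_pos hε) (Real.sqrt_pos.2 (by positivity))
  have hδsq : 8 * δ ^ 2 ≤ κ / 2 := by
    have h1 : δ ^ 2 ≤ √(κ / 16) ^ 2 := pow_le_pow_left₀ hδ.le (min_le_right _ _) 2
    rw [Real.sq_sqrt (by positivity)] at h1
    linarith
  obtain ⟨R, hR₀, hRκ⟩ : ∃ R : ℕ, ν₀.2 < R ∧ 2 * A ^ 2 * (R : ℝ) ^ (2 - q) ≤ κ / 2 := by
    have h1 : Tendsto (fun R : ℕ => 2 * A ^ 2 * (R : ℝ) ^ (-(q - 2))) atTop (𝓝 (2 * A ^ 2 * 0)) :=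
      ((tendsto_rpow_neg_atTop (by linarith : 0 < q - 2)).comp
        tendsto_natCast_atTop_atTop).const_mul _
    rw [mul_zero] at h1
    obtain ⟨R, h2, h3⟩ := ((h1.eventually (ge_mem_nhds (half_pos hκ))).and
      (eventually_gt_atTop ν₀.2)).exists
    refine ⟨R, h3, ?_⟩
    rwa [neg_sub] at h2
  obtain ⟨net, hnetK, hnetfin, hnet⟩ := (hK.inter_right
    (isClosed_le (continuous_apply 4) continuous_const : IsClosed {θ : Coef | θ 4 ≤ b})
    ).finite_cover_balls hδ
  -- Its size depends on neither N nor T, so the union bound over it is beaten by exp(-ζT) uniformly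
  -- in N.
  set cand : Finset Param := hnetfin.toFinset ×ˢ Finset.range (R + 1) with hcand
  have hlim : Tendsto (fun T : ℕ => (cand.card : ℝ) * (3 * Real.exp (-(ζ * T)))) atTop
      (𝓝 ((cand.card : ℝ) * (3 * 0))) := by
    refine ((Real.tendsto_exp_neg_atTop_nhds_zero.comp ?_).const_mul 3).const_mul _
    exact tendsto_natCast_atTop_atTop.const_mul_atTop hζ
  rw [mul_zero, mul_zero] at hlim
  set X := τ⁻¹ * ((B + c ^ 2) / (1 - b)) with hX
  filter_upwards [hlim.eventually (ge_mem_nhds (half_pos hε')), eventually_ge_atTop T₁,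
    eventually_ge_atTop (2 * m), eventually_ge_atTop 1, eventually_ge_atTop ⌈8 * X / η⌉₊]
    with T hT1 hT2 hT3 hT4 hT5
  intro Ω mΩ P _ N G ℋ y lam h hN hD hmom init hinit νhat hMLE
  have hN' : (0 : ℝ) < N := by exact_mod_cast hN
  have hT' : (0 : ℝ) < T := by exact_mod_cast hT4
  have hNT : (0 : ℝ) < N * T := by positivity
  have hXT : X * N ≤ η / 8 * (N * T) := by
    have h1 : 8 * X / η ≤ T := (Nat.le_ceil _).trans (by exact_mod_cast hT5)
    rw [div_le_iff₀ hη] at h1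
    have := mul_le_mul_of_nonneg_right h1 hN'.le
    linarith
  have p1 : P (boundedPaths G y lam q B T)ᶜ ≤ ENNReal.ofReal (ε' / 2) := by
    refine (h.prob_not_boundedPaths_le hN h₀ (fun i => (hD i).2) hq.le hM rfl hmom hB hT4).trans ?_
    rw [← ENNReal.ofReal_add (by positivity) (by positivity),
      ← ENNReal.ofReal_add (by positivity) (by positivity), ← add_div, ← add_div]
    refine ENNReal.ofReal_le_ofReal (le_of_eq ?_)
    change E / B = ε' / 2
    rw [hBdef]
    field_simp
  -- Net points close to ν₀ get the empty event, so the union may run over the whole net.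
  set bad : Param → Set Ω := fun ν => {_ω | IsFar (ε / 2) ν₀ ν} ∩ (boundedPaths G y lam q B T ∩
    {ω | logLikSum T (fun i t => y i t ω) (fun i t => lam i (t : ℤ) ω) - η * (N * T)
      ≤ logLikSum T (fun i t => y i t ω) (fittedIntensity G init (fun i t => y i t ω) ν)})
    with hbad
  have p2 : P (⋃ ν ∈ cand, bad ν) ≤ ENNReal.ofReal (ε' / 2) := by
    have h1 : ∀ ν ∈ cand, P (bad ν) ≤ ENNReal.ofReal (3 * Real.exp (-(ζ * T))) := by
      intro ν hν
      by_cases hfar : IsFar (ε / 2) ν₀ ν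
      · have hνK := hnetK (hnetfin.mem_toFinset.1 (Finset.mem_product.1 hν).1)
        refine (measure_mono Set.inter_subset_right).trans ((hlik h hN hD init hinit ν hfar
          (hKA _ hνK.1).1 (hKA _ hνK.1).2 hνK.2 T hT2).trans (le_of_eq ?_))
        rw [ENNReal.ofReal_mul (by norm_num)]
        norm_num
      · simp [hbad, hfar]
    refine (measure_biUnion_finset_le _ _).trans ((Finset.sum_le_sum h1).trans ?_)
    rw [Finset.sum_const, nsmul_eq_mul, ← ENNReal.ofReal_natCast, ← ENNReal.ofReal_mul (by positivity)]
    exact ENNReal.ofReal_le_ofReal hT1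
  -- The estimator is not assumed measurable; almost sure inclusion into a union of two sets bounds
  -- the outer measure.
  refine le_trans (measure_mono_ae ?_) ((measure_union_le _ _).trans ((add_le_add p1 p2).trans ?_))
  swap
  · rw [← ENNReal.ofReal_add (by positivity) (by positivity), add_halves]
  filter_upwards [hMLE, h.ae_eq_fittedIntensity] with ω hω heq hdist
  have hfar := isFar_of_le_dist hε hdist
  by_contra hcon
  have hbp : ω ∈ boundedPaths G y lam q B T := by
    by_contra h'
    exact hcon (Or.inl h')
  have hnb : ω ∉ ⋃ ν ∈ cand, bad ν := fun h' => hcon (Or.inr h')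
  obtain ⟨⟨hms, hl0⟩, -⟩ := id hbp
  simp only [Set.mem_ofPred_eq] at hms hl0
  obtain ⟨hνS, hmax⟩ := hω
  set ν := νhat ω with hν
  have hle : logLikSum T (fun i t => y i t ω) (fittedIntensity G init (fun i t => y i t ω) ν₀)
      ≤ logLikSum T (fun i t => y i t ω) (fittedIntensity G init (fun i t => y i t ω) ν) := by
    have h1 := hmax ν₀ hν₀
    rw [logLik_eq, logLik_eq] at h1
    exact le_of_mul_le_mul_left h1 (by positivity)
  obtain ⟨hνA, hνw⟩ := hKA _ (hSK _ hνS)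
  rcases le_or_gt (garchCoef ν.1) b with hνb | hνb
  · have hcov := hnet (⟨hSK _ hνS, hνb⟩ : ν.1 ∈ K ∩ {θ : Coef | θ 4 ≤ b})
    simp only [Set.mem_iUnion] at hcov
    obtain ⟨θ', hθ', hdist'⟩ := hcov
    have hθK := hnetK hθ'
    set ν' : Param := (θ', min ν.2 R) with hν'
    have hδ' : ∀ k, |ν.1 k - ν'.1 k| ≤ δ := fun k => by
      rw [← Real.dist_eq]
      exact (dist_le_pi_dist _ _ k).trans (Metric.mem_ball.1 hdist').le
    have hfar' := hfar.of_near hδ' (min_le_left _ _) hR₀ rfl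
    have hnot : logLikSum T (fun i t => y i t ω) (fittedIntensity G init (fun i t => y i t ω) ν')
        < logLikSum T (fun i t => y i t ω) (fun i t => lam i (t : ℤ) ω) - η * (N * T) := by
      by_contra! h'
      refine hnb (Set.mem_biUnion (x := ν') ?_ ⟨hfar', hbp, h'⟩)
      exact Finset.mem_coe.2 (Finset.mem_product.2 ⟨hnetfin.mem_toFinset.2 hθ',
        Finset.mem_range.2 (Nat.lt_succ_of_le (min_le_right _ _))⟩)
    have hθb : garchCoef ν'.1 ≤ b := hθK.2
    have k1 := logLikSum_le_of_near G (ν := ν) (ν' := ν') hb hq.le hw hτ hνA (hKA _ hθK.1).1 hνw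
      (hKA _ hθK.1).2 hνb hθb hinit hδ' (by omega : 0 < R) rfl hms
    have k2 := logLikSum_le_of_init G (init' := fun i => lam i 0 ω) hb hq.le hw hτ h₀.bound
      h₀.le_base (le_max_left _ _) hinit (fun i => h.nonneg i 0 ω) hl0 hms
    have hlam : fittedIntensity G (fun i => lam i 0 ω) (fun i t => y i t ω) ν₀
        = fun i (t : ℕ) => lam i (t : ℤ) ω := by
      ext i t
      exact (heq i t).symm
    rw [hlam] at k2
    rw [hτη] at k1 k2
    have k3 : τ⁻¹ * ((8 * δ ^ 2 + 2 * A ^ 2 * (R : ℝ) ^ (2 - q)) * (cc * B)) ≤ η / 8 := by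
      calc _ ≤ τ⁻¹ * (κ * (cc * B)) := by
            gcongr
            linarith
        _ = η / 8 := by
            rw [hκdef]
            field_simp
    have k4 := mul_le_mul_of_nonneg_right k3 hNT.le
    have k5 : 0 < η * (N * T) := by positivity
    linarith
  -- Here β exceeds b, where the net gives nothing; comparison with ν₀ alone contradicts maximality.
  · have k1 := neg_le_logLikSum G h₀.garch_lt hq.le hw h₀.bound le_rfl h₀.le_base hinit hT4 hms
    have k2 := logLikSum_le_of_garchCoef_large G hq.le hw hνA hνw (fun i => (hinit i).1) hm0
      ((le_max_right _ _).trans hνb.le) hT3 hms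
    have k3 : (2 * B - w * m / 8) * (N * T)
        < -((|Real.log w| * B + intensityBound A b₀ (c ^ 2) B) * (N * T)) := by
      rw [← neg_mul]
      refine mul_lt_mul_of_pos_right ?_ hNT
      linarith
    linarith

lemma coef_pos_of_mem_interior {S : Set Coef} {θ : Coef} (hθ : θ ∈ interior S) {k : Fin 5}
    (hS : ∀ θ' ∈ S, 0 ≤ θ' k) : 0 < θ k := by
  obtain ⟨ρ, hρ, hball⟩ := Metric.mem_nhds_iff.1 (mem_interior_iff_mem_nhds.1 hθ)
  -- Lowering one coordinate by half the radius stays in the set, so that coordinate is at least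
  -- ρ/2.
  have h1 : Function.update θ k (θ k - ρ / 2) ∈ Metric.ball θ ρ := by
    rw [Metric.mem_ball, dist_pi_lt_iff hρ]
    intro l
    by_cases hl : l = k
    · subst hl
      rw [Function.update_self, Real.dist_eq, sub_sub_cancel_left, abs_neg, abs_of_pos (by positivity)]
      linarith
    · rw [Function.update_of_ne hl, dist_self]
      exact hρ
  have h2 := hS _ (hball h1)
  rw [Function.update_self] at h2
  linarith

end PTNGARCH

/-! ### Reduction of the theorem to the uniform estimate -/

theorem theorem2
    {Ω : ℕ → Type*} [∀ N, MeasurableSpace (Ω N)]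
    (P : ∀ N, Measure (Ω N)) [∀ N, IsProbabilityMeasure (P N)]
    -- the networks, one for each number `N` of nodes; no node is isolated
    (G : ∀ N, SimpleGraph (Fin N))
    (hG : ∀ N, 2 ≤ N → ∀ i, ∃ j, (G N).Adj i j)
    -- the true parameter; there is a threshold effect
    (θ₀ : PTNGARCH.Coef) (r₀ : ℕ)
    (hr₀ : 2 ≤ r₀) (hα : PTNGARCH.alphaUp θ₀ ≠ PTNGARCH.alphaDown θ₀)
    -- the data are generated by the model with the true parameter
    (ℋ : ∀ N, Filtration ℤ (inferInstance : MeasurableSpace (Ω N)))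
    (y : ∀ N, Fin N → ℤ → Ω N → ℕ) (lam : ∀ N, Fin N → ℤ → Ω N → ℝ)
    (hmodel : ∀ N, 1 ≤ N → PTNGARCH.IsModel (P N) (G N) (θ₀, r₀) (ℋ N) (y N) (lam N))
    -- for each threshold `r`, the coefficients range over a compact set `S r`;
    -- these sets lie in a common compact set of admissible coefficients
    (S : ℕ → Set PTNGARCH.Coef) (K : Set PTNGARCH.Coef)
    (hK : IsCompact K) (hKadm : K ⊆ PTNGARCH.admissible)
    (hS : ∀ r, IsCompact (S r)) (hSK : ∀ r, S r ⊆ K)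
    (hθ₀ : θ₀ ∈ interior (S r₀))
    (hcontr : PTNGARCH.Contraction (θ₀, r₀))
    -- uniform moments and weak dependence
    (p : ℝ) (hp : 1 < p)
    (hmom : ∃ M : ℝ≥0, ∀ N (i : Fin N) (t : ℤ), 1 ≤ t →
      ∫⁻ ω, (y N i t ω : ℝ≥0∞) ^ (2 * p) ∂(P N) ≤ M)
    (μy : ℝ) (hμy : 2 * ((2 * p - 1) / (p - 1)) < μy)
    (η : ℕ → ℝ)
    (hweak : PTNGARCH.EtaWeaklyDependent P (fun N i t ω => (y N i t ω : ℝ)) η)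
    (hη : η =O[atTop] fun s : ℕ => (s : ℝ) ^ (-μy))
    -- decay of the network weights
    (C b : ℝ) (hC : 0 < C) (hb : μy < b)
    (hweight : ∀ N (i j : Fin N), i ≠ j →
      PTNGARCH.weight (G N) i j ≤ C * |((j : ℕ) : ℝ) - ((i : ℕ) : ℝ)| ^ (-b))
    -- bounded nonnegative initial values of the intensities
    (init : ∀ N, Fin N → ℝ) (c : ℝ) (hinit : ∀ N i, init N i ∈ Set.Icc 0 c)
    -- the maximum likelihood estimator
    (νhat : ∀ N, ℕ → Ω N → PTNGARCH.Param)
    (hMLE : ∀ N T, 1 ≤ N → 1 ≤ T → ∀ᵐ ω ∂(P N),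
      PTNGARCH.IsMLE (G N) (init N) T (fun i t => y N i t ω) S (νhat N T ω)) :
    ∀ ε : ℝ, 0 < ε →
      Tendsto (fun NT : ℕ × ℕ => P NT.1 {ω | ε ≤ dist (νhat NT.1 NT.2 ω) (θ₀, r₀)})
        (atTop ×ˢ atTop) (𝓝 0) := by
  intro ε hε
  have hθmem : θ₀ ∈ S r₀ := interior_subset hθ₀
  have hnonneg : ∀ θ ∈ K, ∀ k, 0 ≤ θ k := by
    intro θ hθ k
    obtain ⟨h0, h1, h2, h3, h4⟩ := hKadm hθ
    fin_cases k
    exacts [h0.le, h1, h2, h3, h4]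
  have hpos : ∀ k, 0 < θ₀ k := fun k =>
    PTNGARCH.coef_pos_of_mem_interior hθ₀ fun θ hθ => hnonneg θ (hSK _ hθ) k
  obtain ⟨A, hA⟩ := hK.isBounded.exists_norm_le
  have hbound : ∀ θ ∈ K, PTNGARCH.CoefBound A θ := fun θ hθ k =>
    ⟨hnonneg θ hθ k, (le_abs_self _).trans ((norm_le_pi_norm θ k).trans (hA θ hθ))⟩
  obtain ⟨θm, hθm, hmin⟩ := hK.exists_isMinOn ⟨θ₀, hSK _ hθmem⟩
    (continuous_apply (0 : Fin 5)).continuousOn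
  have hmin' : ∀ θ ∈ K, PTNGARCH.base θm ≤ PTNGARCH.base θ := fun θ hθ => hmin hθ
  -- Interiority makes all true coefficients positive, and compactness of K gives the common bounds
  -- A and `base θm`. With α⁽¹⁾ and ξ positive, the contraction condition yields β < 1.
  have hreg : PTNGARCH.IsRegular A (PTNGARCH.base θm) (θ₀, r₀) :=
    { bound := hbound _ (hSK _ hθmem)
      pos := (hKadm hθm).1
      le_base := hmin' _ (hSK _ hθmem)
      alphaUp_pos := hpos 1
      alphaDown_pos := hpos 2
      garch_pos := hpos 4
      garch_lt := by
        have h1 : 0 < PTNGARCH.alphaUp θ₀ := hpos 1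
        have h2 : 0 < PTNGARCH.netCoef θ₀ := hpos 3
        have h3 := (le_max_left (PTNGARCH.alphaUp θ₀) (PTNGARCH.alphaDown θ₀)).trans
          (le_max_left _ |PTNGARCH.alphaUp θ₀ * (r₀ : ℝ) - PTNGARCH.alphaDown θ₀ * ((r₀ : ℝ) - 1)|)
        have h4 := hcontr
        unfold PTNGARCH.Contraction at h4
        dsimp only at h4 ⊢
        linarith
      threshold := hr₀
      ne := hα }
  -- The quotient (2p - 1)/(p - 1) is at least 1, so b > μ_y > 2.
  have hb2 : 2 ≤ b := by
    have h1 : 1 ≤ (2 * p - 1) / (p - 1) := by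
      rw [le_div_iff₀ (by linarith)]
      linarith
    linarith
  have hdeg : ∀ N, 2 ≤ N → ∀ i, 1 ≤ PTNGARCH.nodeDegree (G N) i
      ∧ PTNGARCH.nodeDegree (G N) i ≤ 4 * |C| + 2 := by
    intro N hN i
    refine ⟨?_, PTNGARCH.nodeDegree_le (G N) hb2 i (hweight N i)⟩
    classical
    obtain ⟨j, hj⟩ := hG N hN i
    rw [PTNGARCH.nodeDegree_eq_card]
    exact_mod_cast Finset.card_pos.2 ⟨j, by simpa using hj⟩
  obtain ⟨M, hM⟩ := hmom
  rw [ENNReal.tendsto_nhds_zero]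
  intro e he
  obtain ⟨e', he', hee⟩ := ENNReal.lt_iff_exists_nnreal_btwn.1 he
  have he'0 : (0 : ℝ) < e' := by exact_mod_cast he'
  have key := PTNGARCH.eventually_prob_le_dist_le (D := 4 * |C| + 2) (c := c) (q := 2 * p)
    (M := (M : ℝ)) hreg (by linarith) M.coe_nonneg (by positivity) hε he'0 hK
    (fun θ hθ => ⟨hbound θ hθ, hmin' θ hθ⟩) hSK hθmem
  -- The threshold on T does not depend on N, so the limit is joint with arbitrary relative rates; N
  -- ≥ 2 ensures that no node is isolated.
  filter_upwards [(eventually_ge_atTop 2).prod_mk (key.and (eventually_ge_atTop 1))]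
    with NT ⟨hN, hT, hT1⟩
  refine (hT (hmodel NT.1 (by omega)) (by omega) (hdeg NT.1 hN) (fun i t ht => ?_) (init NT.1)
    (hinit NT.1) (νhat NT.1 NT.2) (hMLE NT.1 NT.2 (by omega) hT1)).trans ?_
  · rw [ENNReal.ofReal_coe_nnreal]
    exact hM NT.1 i t ht
  · rw [ENNReal.ofReal_coe_nnreal]
    exact hee.le
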